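/- **Setting.** A marked line $p=(z,w,r)\in\mathbb R^3$ represents the space-time line $\ell(p)=\{(z+ws,s):s\in\mathbb R\}$ with mark (rod length) $r$. Its right half-plane is $\{(\tilde x,\tilde t):\tilde x\ge z+w\tilde t\}$ and its left half-plane is $\{(\tilde x,\tilde t):\tilde x<z+w\tilde t\}$. For space-time points $a,b\in\mathbb R^2$ let $ab$ be the set of marked lines meeting the closed segment $\overline{ab}$ (so $aa$ is the set of lines through $a$), let $ab_+$ be the set of lines in $ab$ with $a$ in the left and $b$ in the right half-plane, and $ab_-$ the set of those with $a$ in the right and $b$ in the left half-plane. For a measure $\nu$ on $\mathbb R^3$ put $d\nu_k=r^k\,d\nu$, and let $\mathcal M$ be the set of Borel measures $\mu$ on $\mathbb R^3$ with $\mu(ab)+\mu_2(ab)<\infty$ for all $a,b$. With $o=(0,0)$ define $$H_\nu(b)=\nu_1(ob_+)-\nu_1(ob_-),\qquad y_\nu(x,v;t)=x+vt+H_\nu(x+vt,t),$$ $$m_0^x(\nu)=\iiint r\,\bigl(\mathbf 1\{0\le z<x\}-\mathbf 1\{x\le z<0\}\bigr)\,d\nu(z,w,r),$$ and let $\nu_t$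 be the image of $\nu$ under $(z,w,r)\mapsto(z+wt,w,r)$. Here $y_\nu(x,v;\cdot)$ is the quasi-particle trajectory and $m_0^x(\nu_t)$ is the mass between $0$ and $x$ at time $t$. Let $\mu\in\mathcal M$. For $\varepsilon>0$ let $N[X^\varepsilon]$ be the empirical measure of a Poisson process $X^\varepsilon$ with intensity measure $\varepsilon^{-1}\mu$, and let $N^\varepsilon=\varepsilon N[X^\varepsilon]$. Let $W$ be a standard two-sided Brownian motion on $\mathbb R$ with $W(0)=0$. Define $$\widehat B^\varepsilon(x,v;t)=\varepsilon^{-1/2}\Bigl(\bigl[y_{N^\varepsilon}(x,v;t)-y_{N^\varepsilon}(x,v;0)\bigr]-\bigl[y_\mu(x,v;t)-y_\mu(x,v;0)\bigr]\Bigr),$$ $$\widehat B^\varepsilon(x;t)=\varepsilon^{-1/2}\bigl(\varepsilon\, m_0^x(N[X^\varepsilon]_t)-m_0^x(\mu_t)\bigr).$$ **Corollary (time changed Brownian motion).** 1. Let $x,v\in\mathbb R$ and $b_t=(x+vt,t)$, and suppose that $\mu_2(b_tb_t)=0$ for every $t\in\mathbb R$. Then, as $\varepsilon\downarrow0$, $$\bigl(\widehat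 B^\varepsilon(x,v;t)\bigr)_{t\in\mathbb R}\ \Longrightarrow\ \bigl(W(\operatorname{sgn}(t)\,\mu_2(b_0b_t))\bigr)_{t\in\mathbb R}.$$ 2. Let $t\in\mathbb R$ and $a_x=(x,t)$, and suppose that $\mu_2(a_xa_x)=0$ for every $x\in\mathbb R$. Then, as $\varepsilon\downarrow0$, $$\bigl(\widehat B^\varepsilon(x;t)\bigr)_{x\in\mathbb R}\ \Longrightarrow\ \bigl(W(\operatorname{sgn}(x)\,\mu_2(a_0a_x))\bigr)_{x\in\mathbb R}.$$ (Here $\mu_2(a_0a_x)$ is the $(\mu_t)_2$-measure of the lines meeting the segment from $(0,0)$ to $(x,0)$.) Here $\Rightarrow$ is functional convergence in law for the topology of uniform convergence on compact subsets of $\mathbb R$, in the sense of Hoffmann-Jørgensen: $Z^\varepsilon\Rightarrow Y$ means that $Y$ is a Borel random element with separable range, and $E^*F(Z^\varepsilon)\to E\,F(Y)$ for every bounded continuous functional $F$ of the path, where $E^*$ is the outer expectation. -/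

import Mathlib

open MeasureTheory ProbabilityTheory Filter Topology
open scoped ENNReal NNReal UniformConvergence BoundedContinuousFunction

noncomputable section

namespace HardRods

/-! ### Marked lines in the space-time plane -/

/-- A marked line `(x, v, r)`: position `x` at time zero, velocity `v`, mark (rod length) `r`. -/
abbrev MarkedLine : Type := ℝ × ℝ × ℝ

/-- The space-time line `{(x + v t, t) : t ∈ ℝ}`; points of the plane are pairs `(space, time)`. -/
def line (p : MarkedLine) : Set (ℝ × ℝ) := Set.range fun t : ℝ => (p.1 + p.2.1 * t, t)

/-- The right half-plane of a line; it contains the line. -/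
def rightHalf (p : MarkedLine) : Set (ℝ × ℝ) := {q | p.1 + q.2 * p.2.1 ≤ q.1}

/-- The (open) left half-plane of a line. -/
def leftHalf (p : MarkedLine) : Set (ℝ × ℝ) := {q | q.1 < p.1 + q.2 * p.2.1}

/-- The set `ab` of lines that intersect the closed segment with extremes `a` and `b`.
In particular `aa` is the set of lines through `a`. -/
def linesMeeting (a b : ℝ × ℝ) : Set MarkedLine := {p | (line p ∩ segment ℝ a b).Nonempty}

/-- The set `ab₊` of lines in `ab` with `a` on the left and `b` on the right. -/
def linesPos (a b : ℝ × ℝ) : Set MarkedLine :=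
  {p | p ∈ linesMeeting a b ∧ a ∈ leftHalf p ∧ b ∈ rightHalf p}

/-- The set `ab₋` of lines in `ab` with `a` on the right and `b` on the left. -/
def linesNeg (a b : ℝ × ℝ) : Set MarkedLine :=
  {p | p ∈ linesMeeting a b ∧ a ∈ rightHalf p ∧ b ∈ leftHalf p}

/-- The measure `μ₂`, with `dμ₂(x, v, r) = r² dμ(x, v, r)`. -/
def markSq (μ : Measure MarkedLine) : Measure MarkedLine :=
  μ.withDensity fun p => ENNReal.ofReal (p.2.2 ^ 2)

/-- The class `𝓜` of measures with `μ(ab) + μ₂(ab) < ∞` for all `a`, `b`. -/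
def IsAdmissible (μ : Measure MarkedLine) : Prop :=
  ∀ a b : ℝ × ℝ, μ (linesMeeting a b) + markSq μ (linesMeeting a b) < ∞

/-- The surface `H_ν(b) = ν₁(ob₊) - ν₁(ob₋)`, where `dν₁ = r dν` and `o` is the origin. -/
def surface (ν : Measure MarkedLine) (b : ℝ × ℝ) : ℝ :=
  (∫ p in linesPos (0, 0) b, p.2.2 ∂ν) - ∫ p in linesNeg (0, 0) b, p.2.2 ∂ν

/-! ### Hard rod observables -/

/-- The position `y_ν(x, v; t) = x + v t + H_ν(x + v t, t)` at time `t` of the quasi-particle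
with velocity `v` that starts at the dilated position of `x`. -/
def quasiParticle (ν : Measure MarkedLine) (x v t : ℝ) : ℝ :=
  x + v * t + surface ν (x + v * t, t)

/-- The measure `ν_t`: the image of `ν` under the ideal gas evolution `(x, v, r) ↦ (x + v t, v, r)`. -/
def evolve (t : ℝ) (ν : Measure MarkedLine) : Measure MarkedLine :=
  ν.map fun p => (p.1 + p.2.1 * t, p.2.1, p.2.2)

/-- The signed mass `m_0^x(ν) = ∫ r (1{0 ≤ z < x} - 1{x ≤ z < 0}) dν(z, w, r)`. -/
def mass (x : ℝ) (ν : Measure MarkedLine) : ℝ :=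
  ∫ p, p.2.2 * ((Set.Ico 0 x).indicator 1 p.1 - (Set.Ico x 0).indicator 1 p.1) ∂ν

/-! ### Random objects -/

/-- `N` is (the empirical measure of) a Poisson process with intensity measure `μ`: a random
measure whose value on a measurable set of finite `μ`-measure `m` is a Poisson variable with
mean `m`, and whose values on pairwise disjoint measurable sets are independent. -/
structure IsPoissonProcess {Ω : Type*} [MeasurableSpace Ω] (P : Measure Ω)
    (N : Ω → Measure MarkedLine) (μ : Measure MarkedLine) : Prop where
  measurable : Measurable N
  hasLaw : ∀ A : Set MarkedLine, MeasurableSet A → μ A ≠ ∞ →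
    HasLaw (fun ω => N ω A) ((poissonMeasure (μ A).toNNReal).map (Nat.cast : ℕ → ℝ≥0∞)) P
  indep : ∀ (n : ℕ) (A : Fin n → Set MarkedLine), (∀ i, MeasurableSet (A i)) →
    Pairwise (fun i j => Disjoint (A i) (A j)) → iIndepFun (fun i ω => N ω (A i)) P

/-- `W` is a standard two-sided Brownian motion on `ℝ` with `W 0 = 0`. -/
structure IsTwoSidedBrownian {Ω : Type*} [MeasurableSpace Ω] (P : Measure Ω)
    (W : ℝ → Ω → ℝ) : Prop where
  zero : ∀ᵐ ω ∂P, W 0 ω = 0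
  hasLaw_increment : ∀ s t : ℝ, s ≤ t →
    HasLaw (fun ω => W t ω - W s ω) (gaussianReal 0 (t - s).toNNReal) P
  indep_increments : HasIndepIncrements W P
  continuous_paths : ∀ᵐ ω ∂P, Continuous fun t => W t ω

/-- The outer expectation of a bounded, not necessarily measurable, function. -/
def outerExpectation {Ω : Type*} [MeasurableSpace Ω] (P : Measure Ω) (f : Ω → ℝ) : ℝ :=
  sInf {c | ∃ g : Ω → ℝ, Integrable g P ∧ (∀ ω, f ω ≤ g ω) ∧ c = ∫ ω, g ω ∂P}

/-- All functions `ℝ → ℝ`, with the topology of uniform convergence on compact sets. -/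
abbrev PathSpace : Type := ℝ →ᵤ[{K : Set ℝ | IsCompact K}] ℝ

/-- A function `ℝ → ℝ` as a point of the path space. -/
def toPath (f : ℝ → ℝ) : PathSpace := UniformOnFun.ofFun {K : Set ℝ | IsCompact K} f

/-- Functional convergence in law, as `ε ↓ 0`, of the processes `X ε` (each on a probability space
of its own) to the process `Y`, in the sense of Hoffmann-Jørgensen for locally uniform
convergence: `Y` is a Borel random element with separable range, and `E* F(X ε) → E F(Y)` for
every bounded continuous functional `F` of the path. The outer expectation `E*` is used since the
paths of `X ε` have jumps, and need not be continuous from one and the same side. -/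
def TendstoInLaw {Ω : ℝ → Type*} [∀ ε, MeasurableSpace (Ω ε)] (P : ∀ ε, Measure (Ω ε))
    (X : ∀ ε, Ω ε → ℝ → ℝ) {Ω' : Type*} [MeasurableSpace Ω'] (P' : Measure Ω')
    (Y : Ω' → ℝ → ℝ) : Prop :=
  AEStronglyMeasurable (fun ω' => toPath (Y ω')) P' ∧
    ∀ F : PathSpace →ᵇ ℝ,
      Tendsto (fun ε => outerExpectation (P ε) fun ω => F (toPath (X ε ω))) (𝓝[>] 0)
        (𝓝 (∫ ω', F (toPath (Y ω')) ∂P'))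

/-! ### Fluctuation processes -/

/-- Fluctuations of the displacement of the quasi-particle during `[0, t]`,
`ε^{-1/2} ((y_{N^ε}(x,v;t) - y_{N^ε}(x,v;0)) - (y_μ(x,v;t) - y_μ(x,v;0)))`, where `N^ε = ε N` is
the rescaled empirical measure. -/
def quasiFluctuation (μ : Measure MarkedLine) (ε : ℝ) (N : Measure MarkedLine) (x v t : ℝ) : ℝ :=
  (√ε)⁻¹ *
    ((quasiParticle (ENNReal.ofReal ε • N) x v t - quasiParticle (ENNReal.ofReal ε • N) x v 0)
      - (quasiParticle μ x v t - quasiParticle μ x v 0))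

/-- Fluctuations of the mass at time `t` between `0` and `x`:
`ε^{-1/2} (ε m_0^x(N_t) - m_0^x(μ_t))`. -/
def massFluctuation (μ : Measure MarkedLine) (ε : ℝ) (N : Measure MarkedLine) (t x : ℝ) : ℝ :=
  (√ε)⁻¹ * (ε * mass x (evolve t N) - mass x (evolve t μ))

end HardRods

end

/-!
Along a path, the displacement of the quasi-particle and the mass are integrals of signed marks
against the point process, and the signed marks picked up during a parameter interval are increments
of two weighted increasing families of sets: a path of velocity `v` crosses the lines slower than
`v` in one direction and the faster ones in the other, each at most once. Increments over disjoint
intervals live on disjoint sets of lines, so the characteristic functional of the Poisson process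
makes them independent, and makes their fluctuations converge to Gaussian variables whose variances
are the `μ₂`-measures of the lines crossed. Brownian motion run with this clock therefore has the
limiting increments along every finite grid.

Passing from grids to paths needs a bound on the oscillation between grid points. By Ottaviani's
inequality the probability that it exceeds `δ` is controlled by the tail of the increment over one
cell, whose Gaussian limit makes it of the order of the squared variance of the cell. The clock is
continuous, since no `μ₂`-mass sits on the lines through one point of the path, so the sum of these
squares vanishes as the grid is refined. Because outer expectations are monotone, it suffices to
compare both sides with grid interpolations for uniformly continuous functionals: Lipschitz
regularization approximates an arbitrary bounded continuous functional by these from below and,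
applied to its negative, from above.
-/

noncomputable section

namespace HardRods

/-! ### Integrals against a Poisson process -/

section Poisson

lemma lintegral_natCast_poissonMeasure (r : ℝ≥0) :
    ∫⁻ n : ℕ, (n : ℝ≥0∞) ∂(poissonMeasure r) = r := by
  have hasSum_mean :
      HasSum (fun n : ℕ => (n : ℝ) * (Real.exp (-r) * (r : ℝ) ^ n / (n.factorial : ℝ))) r := by
    rw [← hasSum_nat_add_iff' 1]
    convert! (hasSum_one_poissonMeasure r).mul_left (r : ℝ) using 1
    · ext n
      rw [Nat.factorial_succ]
      push_cast
      field_simp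
      ring
    · simp
  simp_rw [lintegral_countable', poissonMeasure_singleton, ← ENNReal.ofReal_natCast,
    ← ENNReal.ofReal_mul (Nat.cast_nonneg _)]
  rw [← ENNReal.ofReal_tsum_of_nonneg (fun n => by positivity) hasSum_mean.summable,
    hasSum_mean.tsum_eq, ENNReal.ofReal_coe_nnreal]

variable {Ω : Type*} [MeasurableSpace Ω] {P : Measure Ω}
  {N : Ω → Measure MarkedLine} {ν : Measure MarkedLine} {A : Set MarkedLine} {h : MarkedLine → ℝ}

lemma IsPoissonProcess.lintegral_apply (hN : IsPoissonProcess P N ν)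
    (hA : MeasurableSet A) (hν : ν A ≠ ∞) : ∫⁻ ω, N ω A ∂P = ν A := by
  rw [(hN.hasLaw A hA hν).lintegral_comp (f := fun x => x) aemeasurable_id,
    lintegral_map (f := fun x => x) measurable_id .of_discrete, lintegral_natCast_poissonMeasure,
    ENNReal.coe_toNNReal hν]

lemma IsPoissonProcess.lintegral_setLIntegral (hN : IsPoissonProcess P N ν)
    (hA : MeasurableSet A) (hν : ν A ≠ ∞) {f : MarkedLine → ℝ≥0∞} (hf : Measurable f) :
    ∫⁻ ω, ∫⁻ p in A, f p ∂(N ω) ∂P = ∫⁻ p in A, f p ∂ν := by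
  have restrict_bind : (P.bind N).restrict A = ν.restrict A := by
    ext B hB
    rw [Measure.restrict_apply hB, Measure.restrict_apply hB,
      Measure.bind_apply (hB.inter hA) hN.measurable.aemeasurable,
      hN.lintegral_apply (hB.inter hA)
        (ne_top_of_le_ne_top hν (measure_mono Set.inter_subset_right))]
  rw [← restrict_bind, ← lintegral_indicator hA,
    Measure.lintegral_bind hN.measurable.aemeasurable (hf.indicator hA).aemeasurable]
  simp_rw [lintegral_indicator hA]

lemma IsPoissonProcess.ae_integrable (hN : IsPoissonProcess P N ν) (hm : Measurable h)
    (hs : ν (Function.support h) ≠ ∞) (hi : Integrable h ν) : ∀ᵐ ω ∂P, Integrable h (N ω) := by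
  have setLIntegral_support (κ : Measure MarkedLine) :
      ∫⁻ p in Function.support h, ‖h p‖ₑ ∂κ = ∫⁻ p, ‖h p‖ₑ ∂κ :=
    setLIntegral_eq_of_support_subset fun p hp => by simpa using hp
  have campbell := hN.lintegral_setLIntegral (measurableSet_support hm) hs hm.enorm
  simp_rw [setLIntegral_support] at campbell
  have measurable_lintegral : Measurable fun ω => ∫⁻ p, ‖h p‖ₑ ∂(N ω) :=
    (Measure.measurable_lintegral hm.enorm).comp hN.measurable
  filter_upwards [ae_lt_top measurable_lintegral (campbell.trans_ne hi.2.ne)] with ω hω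
  exact ⟨hm.aestronglyMeasurable, hω⟩

lemma IsPoissonProcess.aemeasurable_integral (hN : IsPoissonProcess P N ν) (hm : Measurable h)
    (hs : ν (Function.support h) ≠ ∞) (hi : Integrable h ν) :
    AEMeasurable (fun ω => ∫ p, h p ∂(N ω)) P := by
  refine ⟨fun ω => (∫⁻ p, ENNReal.ofReal (h p) ∂(N ω)).toReal
    - (∫⁻ p, ENNReal.ofReal (-h p) ∂(N ω)).toReal, ?_, ?_⟩
  · have measurable_pos := (Measure.measurable_lintegral hm.ennreal_ofReal).comp hN.measurable
    have measurable_neg := (Measure.measurable_lintegral hm.neg.ennreal_ofReal).comp hN.measurable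
    exact measurable_pos.ennreal_toReal.sub measurable_neg.ennreal_toReal
  · filter_upwards [hN.ae_integrable hm hs hi] with ω hω
    exact integral_eq_lintegral_pos_part_sub_lintegral_neg_part hω

open Complex in
lemma IsPoissonProcess.integral_exp_count [IsProbabilityMeasure P] (hN : IsPoissonProcess P N ν)
    (hA : MeasurableSet A) {a : ℝ} (hν : a ≠ 0 → ν A ≠ ∞) :
    ∫ ω, exp (((N ω).real A * a : ℝ) * I) ∂P = exp (ν.real A * (exp (a * I) - 1)) := by
  rcases eq_or_ne a 0 with rfl | ha
  · simp
  have charFun_poisson := charFun_map_cast_poissonMeasure (ν A).toNNReal a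
  rw [charFun_apply, integral_map .of_discrete (by fun_prop)] at charFun_poisson
  have integral_law := (hN.hasLaw A hA (hν ha)).integral_comp
    (f := fun x : ℝ≥0∞ => exp ((x.toReal * a : ℝ) * I))
    (Measurable.aestronglyMeasurable (by fun_prop))
  simp only [Function.comp_def] at integral_law
  simp only [measureReal_def]
  rw [integral_law, integral_map .of_discrete (Measurable.aestronglyMeasurable (by fun_prop))]
  simpa [mul_comm, ← ENNReal.coe_toNNReal_eq_toReal] using charFun_poisson

lemma IsPoissonProcess.iIndepFun_fiber (hN : IsPoissonProcess P N ν)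
    (f : SimpleFunc MarkedLine ℝ) :
    iIndepFun (fun (y : f.range) ω => N ω (f ⁻¹' {(y : ℝ)})) P := by
  have indep_enumeration := hN.indep f.range.card
    (fun i => f ⁻¹' {((f.range.equivFin.symm i : f.range) : ℝ)}) (fun i => f.measurableSet_fiber _)
    fun i j hij => Disjoint.preimage _ <| by
      simpa only [Set.disjoint_singleton, ne_eq] using fun h =>
        hij (f.range.equivFin.symm.injective (Subtype.ext h))
  simpa using indep_enumeration.precomp f.range.equivFin.injective

open Complex in
lemma IsPoissonProcess.integral_exp_simpleFunc [IsProbabilityMeasure P]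
    (hN : IsPoissonProcess P N ν) (f : SimpleFunc MarkedLine ℝ) (hf : Integrable f ν) :
    ∫ ω, exp (f.integral (N ω) * I) ∂P = exp (∫ p, (exp (f p * I) - 1) ∂ν) := by
  have exp_integral (ω : Ω) : exp (f.integral (N ω) * I)
      = ∏ y : f.range, exp (((N ω).real (f ⁻¹' {(y : ℝ)}) * y : ℝ) * I) := by
    rw [SimpleFunc.integral_eq, ← exp_sum, ← Finset.sum_mul, ← Finset.sum_coe_sort, ofReal_sum]
    rfl
  have integral_exp_sub_one : ∫ p, (exp (f p * I) - 1) ∂ν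
      = ∑ y : f.range, (ν.real (f ⁻¹' {(y : ℝ)}) : ℂ) * (exp ((y : ℝ) * I) - 1) := by
    have integrable_map : Integrable (f.map fun x : ℝ => exp (x * I) - 1) ν :=
      SimpleFunc.integrable_iff_finMeasSupp.2 <|
        (SimpleFunc.integrable_iff_finMeasSupp.1 hf).map (by simp)
    change ∫ p, f.map (fun x : ℝ => exp (x * I) - 1) p ∂ν = _
    rw [← SimpleFunc.integral_eq_integral _ integrable_map,
      SimpleFunc.map_integral f _ hf (by simp), ← Finset.sum_coe_sort]
    simp
  have integral_prod := ((hN.iIndepFun_fiber f).comp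
    (fun y x => exp ((x.toReal * (y : ℝ) : ℝ) * I)) fun y => by fun_prop
    ).integral_fun_prod_eq_prod_integral fun y => Measurable.aestronglyMeasurable <| by
      have : Measurable fun x : ℝ≥0∞ => exp ((x.toReal * (y : ℝ) : ℝ) * I) := by fun_prop
      exact this.comp ((Measure.measurable_coe (f.measurableSet_fiber _)).comp hN.measurable)
  rw [integral_congr_ae (.of_forall exp_integral), integral_exp_sub_one, exp_sum]
  refine integral_prod.trans (Finset.prod_congr rfl fun y _ => ?_)
  exact hN.integral_exp_count (f.measurableSet_fiber _) fun hy =>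
    (SimpleFunc.integrable_iff.1 hf y hy).ne

open Complex in
lemma IsPoissonProcess.integral_exp [IsProbabilityMeasure P] (hN : IsPoissonProcess P N ν)
    (hm : Measurable h) (hs : ν (Function.support h) ≠ ∞) (hi : Integrable h ν) :
    ∫ ω, exp ((∫ p, h p ∂(N ω) : ℝ) * I) ∂P = exp (∫ p, (exp (h p * I) - 1) ∂ν) := by
  let f (n : ℕ) : SimpleFunc MarkedLine ℝ :=
    SimpleFunc.approxOn h hm Set.univ 0 (Set.mem_univ _) n
  have norm_f_le (n : ℕ) (p : MarkedLine) : ‖f n p‖ ≤ ‖h p‖ + ‖h p‖ :=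
    SimpleFunc.norm_approxOn_zero_le hm (Set.mem_univ _) p n
  have tendsto_f (p : MarkedLine) : Tendsto (fun n => f n p) atTop (𝓝 (h p)) :=
    SimpleFunc.tendsto_approxOn hm (Set.mem_univ _) (by simp)
  have tendsto_integral {κ : Measure MarkedLine} (hκ : Integrable h κ) :
      Tendsto (fun n => (f n).integral κ) atTop (𝓝 (∫ p, h p ∂κ)) :=
    tendsto_integral_approxOn_of_measurable hκ hm (by simp) _ (integrable_zero _ _ _)
  have tendsto_lhs : Tendsto (fun n => ∫ ω, exp ((f n).integral (N ω) * I) ∂P) atTop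
      (𝓝 (∫ ω, exp ((∫ p, h p ∂(N ω) : ℝ) * I) ∂P)) := by
    refine tendsto_integral_of_dominated_convergence (fun _ => 1) (fun n => ?_)
      (integrable_const _) (fun n => .of_forall fun ω => (norm_exp_ofReal_mul_I _).le) ?_
    · have : Measurable fun ω => (f n).integral (N ω) := by
        simp_rw [SimpleFunc.integral_eq]
        exact Finset.measurable_sum _ fun y _ => ((Measure.measurable_coe
          ((f n).measurableSet_fiber y)).comp hN.measurable).ennreal_toReal.smul_const y
      exact Measurable.aestronglyMeasurable (by fun_prop)
    · filter_upwards [hN.ae_integrable hm hs hi] with ω hω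
      exact ((by fun_prop : Continuous fun x : ℝ => exp (x * I)).tendsto _).comp
        (tendsto_integral hω)
  have tendsto_rhs : Tendsto (fun n => exp (∫ p, (exp (f n p * I) - 1) ∂ν)) atTop
      (𝓝 (exp (∫ p, (exp (h p * I) - 1) ∂ν))) := by
    refine (continuous_exp.tendsto _).comp <| tendsto_integral_of_dominated_convergence
      (fun p => ‖h p‖ + ‖h p‖) (fun n => ?_) (hi.norm.add hi.norm)
      (fun n => .of_forall fun p => ?_) (.of_forall fun p => ?_)
    · have := (f n).measurable
      exact Measurable.aestronglyMeasurable (by fun_prop)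
    · rw [mul_comm]
      exact Real.norm_exp_I_mul_ofReal_sub_one_le.trans (norm_f_le n p)
    · exact ((by fun_prop : Continuous fun x : ℝ => exp (x * I) - 1).tendsto _).comp (tendsto_f p)
  refine tendsto_nhds_unique tendsto_lhs (tendsto_rhs.congr fun n => ?_)
  exact (hN.integral_exp_simpleFunc (f n)
    (SimpleFunc.integrable_approxOn hm hi _ (integrable_zero _ _ _) n)).symm

end Poisson

/-! ### The fluctuation field -/

section Fluctuation

variable {α : Type*} [MeasurableSpace α] {μ κ : Measure α} {ε : ℝ} {h g : α → ℝ}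

/-- The fluctuation field `ε^{-1/2} (ε ∫ h dκ - ∫ h dμ)`: the centred and rescaled integral of `h`
against an empirical measure `κ` of intensity `ε⁻¹ μ`. -/
def fluctuation (μ : Measure α) (ε : ℝ) (κ : Measure α) (h : α → ℝ) : ℝ :=
  (√ε)⁻¹ * (ε * ∫ p, h p ∂κ - ∫ p, h p ∂μ)

lemma fluctuation_const_mul (a : ℝ) :
    fluctuation μ ε κ (fun p => a * h p) = a * fluctuation μ ε κ h := by
  simp only [fluctuation, integral_const_mul]
  ring

lemma fluctuation_add (hh : Integrable h μ) (hg : Integrable g μ) (hh' : Integrable h κ)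
    (hg' : Integrable g κ) :
    fluctuation μ ε κ (fun p => h p + g p) = fluctuation μ ε κ h + fluctuation μ ε κ g := by
  simp only [fluctuation]
  rw [integral_add hh hg, integral_add hh' hg']
  ring

lemma fluctuation_sum {ι : Type*} (s : Finset ι) {h : ι → α → ℝ}
    (hh : ∀ i ∈ s, Integrable (h i) μ) (hκ : ∀ i ∈ s, Integrable (h i) κ) :
    fluctuation μ ε κ (fun p => ∑ i ∈ s, h i p) = ∑ i ∈ s, fluctuation μ ε κ (h i) := by
  simp only [fluctuation]
  rw [integral_finsetSum s hh, integral_finsetSum s hκ, Finset.mul_sum, ← Finset.sum_sub_distrib,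
    Finset.mul_sum]

/-- The test functions of the fluctuation field: square integrable functions whose support has
finite measure, so that both the mean and the variance of the field are finite. -/
structure IsTestFunction (μ : Measure α) (h : α → ℝ) : Prop where
  measurable : Measurable h
  support : μ (Function.support h) ≠ ∞
  memLp : MemLp h 2 μ

namespace IsTestFunction

lemma integrable (hh : IsTestFunction μ h) : Integrable h μ :=
  memLp_one_iff_integrable.1 <|
    hh.memLp.mono_exponent_of_measure_support_ne_top (fun _ => Function.notMem_support.1)
      hh.support one_le_two

lemma integrable_sq (hh : IsTestFunction μ h) : Integrable (fun p => h p ^ 2) μ :=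
  hh.memLp.integrable_sq

lemma smul_measure (hh : IsTestFunction μ h) {c : ℝ≥0∞} (hc : c ≠ ∞) :
    IsTestFunction (c • μ) h where
  measurable := hh.measurable
  support := ENNReal.mul_ne_top hc hh.support
  memLp := hh.memLp.smul_measure hc

lemma zero : IsTestFunction μ fun _ => 0 where
  measurable := measurable_const
  support := by simp
  memLp := MemLp.zero

lemma add (hh : IsTestFunction μ h) (hg : IsTestFunction μ g) :
    IsTestFunction μ fun p => h p + g p where
  measurable := hh.measurable.add hg.measurable
  support := ne_top_of_le_ne_top (ENNReal.add_ne_top.2 ⟨hh.support, hg.support⟩) <|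
    (measure_mono (Function.support_add h g)).trans (measure_union_le _ _)
  memLp := hh.memLp.add hg.memLp

lemma const_mul (hh : IsTestFunction μ h) (a : ℝ) : IsTestFunction μ fun p => a * h p where
  measurable := hh.measurable.const_mul a
  support := ne_top_of_le_ne_top hh.support <|
    measure_mono (Function.support_const_smul_subset a h)
  memLp := hh.memLp.const_mul a

lemma indicator (hh : IsTestFunction μ h) {A : Set α} (hA : MeasurableSet A) :
    IsTestFunction μ (A.indicator h) where
  measurable := hh.measurable.indicator hA
  support := ne_top_of_le_ne_top hh.support <| measure_mono <|
    Set.support_indicator.trans_subset Set.inter_subset_right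
  memLp := hh.memLp.indicator hA

lemma sum {ι : Type*} (s : Finset ι) {h : ι → α → ℝ} (hh : ∀ i ∈ s, IsTestFunction μ (h i)) :
    IsTestFunction μ fun p => ∑ i ∈ s, h i p := by
  classical
  induction s using Finset.induction_on with
  | empty => simpa using zero
  | insert i s his ih =>
    simp only [Finset.sum_insert his]
    exact (hh i (by simp)).add (ih fun j hj => hh j (by simp [hj]))

end IsTestFunction

/-- The compensated exponential `e^{i x} - 1 - i x`, whose integral is the log-characteristic
function of a centred Poisson integral. -/
def compExp (x : ℝ) : ℂ := Complex.exp (x * Complex.I) - 1 - x * Complex.I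

@[simp] lemma compExp_zero : compExp 0 = 0 := by simp [compExp]

@[fun_prop] lemma continuous_compExp : Continuous compExp := by
  unfold compExp; fun_prop

lemma norm_compExp_le (x : ℝ) : ‖compExp x‖ ≤ 3 * x ^ 2 := by
  have norm_mul_I : ‖(x : ℂ) * Complex.I‖ = |x| := by simp
  rcases le_total |x| 1 with hx | hx
  · have quadratic := Complex.norm_exp_sub_one_sub_id_le (norm_mul_I.trans_le hx)
    rw [norm_mul_I, sq_abs] at quadratic
    exact quadratic.trans (by linarith [sq_nonneg x])
  · calc ‖compExp x‖
        ≤ ‖Complex.exp (x * Complex.I)‖ + ‖(1 : ℂ)‖ + ‖(x : ℂ) * Complex.I‖ :=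
          (norm_sub_le _ _).trans (by gcongr; exact norm_sub_le _ _)
      _ = 2 + |x| := by
          rw [Complex.norm_exp_ofReal_mul_I, norm_one, norm_mul_I]
          norm_num
      _ ≤ 3 * x ^ 2 := by rw [← sq_abs]; nlinarith

lemma compExp_sum_of_pairwise_eq_zero {ι : Type*} (s : Finset ι) {x : ι → ℝ}
    (hx : Pairwise fun i j => x i = 0 ∨ x j = 0) :
    compExp (∑ i ∈ s, x i) = ∑ i ∈ s, compExp (x i) := by
  by_cases all_zero : ∀ i ∈ s, x i = 0
  · rw [Finset.sum_eq_zero all_zero, Finset.sum_eq_zero fun i hi => by rw [all_zero i hi]; simp]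
    simp
  · push Not at all_zero
    obtain ⟨i, hi, hxi⟩ := all_zero
    have others_zero (j : ι) (hj : j ≠ i) : x j = 0 := (hx hj).resolve_right hxi
    rw [Finset.sum_eq_single_of_mem i hi fun j _ hj => others_zero j hj,
      Finset.sum_eq_single_of_mem i hi fun j _ hj => by rw [others_zero j hj, compExp_zero]]

lemma IsTestFunction.integrable_compExp (hh : IsTestFunction μ h) :
    Integrable (fun p => compExp (h p)) μ :=
  (hh.integrable_sq.const_mul 3).mono'
    (continuous_compExp.measurable.comp hh.measurable).aestronglyMeasurable
    (.of_forall fun p => norm_compExp_le (h p))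

open Complex in
lemma IsTestFunction.integral_compExp (hh : IsTestFunction μ h) :
    ∫ p, compExp (h p) ∂μ = ∫ p, (exp (h p * I) - 1) ∂μ - (∫ p, h p ∂μ : ℝ) * I := by
  have integrable_linear : Integrable (fun p => (h p : ℂ) * I) μ :=
    hh.integrable.ofReal.mul_const I
  have integrable_exp : Integrable (fun p => exp (h p * I) - 1) μ := by
    refine (hh.integrable_compExp.add integrable_linear).congr (.of_forall fun p => ?_)
    simp [compExp]
  simp only [compExp]
  rw [integral_sub integrable_exp integrable_linear, integral_mul_const, integral_complex_ofReal]

end Fluctuation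

section PoissonFluctuation

variable {Ω : Type*} [MeasurableSpace Ω] {P : Measure Ω} {N : Ω → Measure MarkedLine}
  {μ : Measure MarkedLine} {ε : ℝ} {h : MarkedLine → ℝ}

lemma IsTestFunction.ae_integrable (hh : IsTestFunction μ h)
    (hN : IsPoissonProcess P N (ENNReal.ofReal ε⁻¹ • μ)) : ∀ᵐ ω ∂P, Integrable h (N ω) :=
  have hh' := hh.smul_measure (ENNReal.ofReal_ne_top (r := ε⁻¹))
  hN.ae_integrable hh'.measurable hh'.support hh'.integrable

lemma IsTestFunction.aemeasurable_fluctuation (hh : IsTestFunction μ h)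
    (hN : IsPoissonProcess P N (ENNReal.ofReal ε⁻¹ • μ)) :
    AEMeasurable (fun ω => fluctuation μ ε (N ω) h) P := by
  have hh' := hh.smul_measure (ENNReal.ofReal_ne_top (r := ε⁻¹))
  have := hN.aemeasurable_integral hh'.measurable hh'.support hh'.integrable
  unfold fluctuation
  fun_prop

variable [IsProbabilityMeasure P]

open Complex in
lemma IsTestFunction.integral_exp_fluctuation (hh : IsTestFunction μ h) (hε : 0 < ε)
    (hN : IsPoissonProcess P N (ENNReal.ofReal ε⁻¹ • μ)) :
    ∫ ω, exp ((fluctuation μ ε (N ω) h : ℝ) * I) ∂P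
      = exp ((ε⁻¹ : ℝ) * ∫ p, compExp (√ε * h p) ∂μ) := by
  have hscaled := hh.const_mul √ε
  have hscaled' := hscaled.smul_measure (ENNReal.ofReal_ne_top (r := ε⁻¹))
  have sqrt_eq : (√ε)⁻¹ * ε = √ε := by rw [inv_mul_eq_div, Real.div_sqrt]
  have inv_sqrt_eq : (√ε)⁻¹ = ε⁻¹ * √ε := by
    rw [inv_mul_eq_div, Real.sqrt_div_self', one_div]
  have exp_fluctuation (ω : Ω) : exp ((fluctuation μ ε (N ω) h : ℝ) * I)
      = exp ((∫ p, √ε * h p ∂(N ω) : ℝ) * I) * exp (-((√ε)⁻¹ * ∫ p, h p ∂μ : ℝ) * I) := by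
    rw [← Complex.exp_add, ← add_mul, ← ofReal_neg, ← ofReal_add, fluctuation, mul_sub,
      ← mul_assoc, sqrt_eq, integral_const_mul]
    rfl
  simp_rw [exp_fluctuation]
  rw [integral_mul_const, hN.integral_exp hscaled'.measurable hscaled'.support hscaled'.integrable,
    ← Complex.exp_add, hscaled.integral_compExp, integral_smul_measure,
    ENNReal.toReal_ofReal (by positivity), integral_const_mul, inv_sqrt_eq, real_smul]
  congr 1
  push_cast
  ring

lemma IsTestFunction.charFun_fluctuation (hh : IsTestFunction μ h) (hε : 0 < ε)
    (hN : IsPoissonProcess P N (ENNReal.ofReal ε⁻¹ • μ)) (t : ℝ) :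
    charFun (P.map fun ω => fluctuation μ ε (N ω) h) t
      = Complex.exp ((ε⁻¹ : ℝ) * ∫ p, compExp (√ε * (t * h p)) ∂μ) := by
  rw [charFun_apply, integral_map (hh.aemeasurable_fluctuation hN) (by fun_prop),
    ← (hh.const_mul t).integral_exp_fluctuation hε hN]
  simp_rw [fluctuation_const_mul]
  simp

lemma charFun_fluctuation_pi {ι : Type*} [Fintype ι] {h : ι → MarkedLine → ℝ}
    (hh : ∀ i, IsTestFunction μ (h i)) (hε : 0 < ε)
    (hN : IsPoissonProcess P N (ENNReal.ofReal ε⁻¹ • μ)) (t : EuclideanSpace ℝ ι) :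
    charFun (P.map fun ω => WithLp.toLp 2 fun i => fluctuation μ ε (N ω) (h i)) t
      = Complex.exp ((ε⁻¹ : ℝ) * ∫ p, compExp (√ε * ∑ i, t i * h i p) ∂μ) := by
  have hscaled (i : ι) : IsTestFunction μ fun p => t i * h i p := (hh i).const_mul (t i)
  have aemeasurable_vector :
      AEMeasurable (fun ω => WithLp.toLp 2 fun i => fluctuation μ ε (N ω) (h i)) P :=
    (WithLp.measurable_toLp 2 _).comp_aemeasurable
      (aemeasurable_pi_lambda _ fun i => (hh i).aemeasurable_fluctuation hN)
  have inner_eq : ∀ᵐ ω ∂P,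
      inner ℝ (WithLp.toLp 2 fun i => fluctuation μ ε (N ω) (h i)) t
        = fluctuation μ ε (N ω) fun p => ∑ i, t i * h i p := by
    filter_upwards [ae_all_iff.2 fun i => (hscaled i).ae_integrable hN] with ω hω
    rw [fluctuation_sum _ (fun i _ => (hscaled i).integrable) (fun i _ => hω i)]
    simp [fluctuation_const_mul, PiLp.inner_apply]
  rw [charFun_apply, integral_map aemeasurable_vector (by fun_prop),
    ← (IsTestFunction.sum Finset.univ fun i _ => hscaled i).integral_exp_fluctuation hε hN]
  exact integral_congr_ae (inner_eq.mono fun ω hω => by simp only [hω])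

lemma iIndepFun_fluctuation {ι : Type*} {h : ι → MarkedLine → ℝ} (hε : 0 < ε)
    (hN : IsPoissonProcess P N (ENNReal.ofReal ε⁻¹ • μ)) (hh : ∀ i, IsTestFunction μ (h i))
    (hd : Pairwise fun i j => ∀ p, h i p = 0 ∨ h j p = 0) :
    iIndepFun (fun i ω => fluctuation μ ε (N ω) (h i)) P := by
  rw [iIndepFun_iff_finset]
  intro s
  change iIndepFun (fun (i : s) ω => fluctuation μ ε (N ω) (h i)) P
  rw [iIndepFun_iff_charFun_pi fun i : s => (hh i).aemeasurable_fluctuation hN]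
  intro t
  have hscaled (i : s) : IsTestFunction μ fun p => √ε * (t i * h i p) :=
    ((hh i).const_mul (t i)).const_mul √ε
  rw [charFun_fluctuation_pi (fun i : s => hh i) hε hN]
  simp_rw [fun i : s => (hh i).charFun_fluctuation hε hN (t i)]
  rw [← Complex.exp_sum, ← Finset.mul_sum,
    ← integral_finsetSum _ fun i _ => (hscaled i).integrable_compExp]
  congr 3
  ext p
  rw [Finset.mul_sum]
  refine compExp_sum_of_pairwise_eq_zero _ fun i j hij => ?_
  exact (hd (Subtype.coe_ne_coe.2 hij) p).imp (by simp [·]) (by simp [·])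

end PoissonFluctuation

/-! ### The central limit theorem -/

section Tail

lemma norm_one_sub_exp_le {z : ℂ} {a : ℝ} (hz : ‖z‖ ≤ a) (norm_exp_le : ‖Complex.exp z‖ ≤ 1) :
    ‖1 - Complex.exp z‖ ≤ 2 * a := by
  rcases le_total a 1 with ha | ha
  · rw [norm_sub_rev]
    exact (Complex.norm_exp_sub_one_le (hz.trans ha)).trans (by gcongr)
  · calc ‖1 - Complex.exp z‖ ≤ ‖(1 : ℂ)‖ + ‖Complex.exp z‖ := norm_sub_le _ _
      _ ≤ 1 + 1 := by rw [norm_one]; gcongr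
      _ ≤ 2 * a := by linarith

variable {Ω : Type*} [MeasurableSpace Ω] {P : Measure Ω} [IsProbabilityMeasure P]
  {N : Ω → Measure MarkedLine} {μ : Measure MarkedLine} {ε : ℝ} {h : MarkedLine → ℝ}

lemma IsTestFunction.norm_one_sub_charFun_fluctuation_le (hh : IsTestFunction μ h) (hε : 0 < ε)
    (hN : IsPoissonProcess P N (ENNReal.ofReal ε⁻¹ • μ)) (t : ℝ) :
    ‖1 - charFun (P.map fun ω => fluctuation μ ε (N ω) h) t‖
      ≤ 6 * t ^ 2 * ∫ p, h p ^ 2 ∂μ := by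
  have := Measure.isProbabilityMeasure_map (hh.aemeasurable_fluctuation hN)
  have norm_integral_le :
      ‖∫ p, compExp (√ε * (t * h p)) ∂μ‖ ≤ ε * (3 * t ^ 2 * ∫ p, h p ^ 2 ∂μ) := by
    rw [← mul_assoc, ← integral_const_mul]
    refine norm_integral_le_of_norm_le (hh.integrable_sq.const_mul _)
      (.of_forall fun p => (norm_compExp_le _).trans_eq ?_)
    rw [mul_pow, Real.sq_sqrt hε.le]
    ring
  have norm_le_one := norm_charFun_le_one (μ := P.map fun ω => fluctuation μ ε (N ω) h) (t := t)
  rw [hh.charFun_fluctuation hε hN t] at norm_le_one ⊢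
  refine (norm_one_sub_exp_le (a := 3 * t ^ 2 * ∫ p, h p ^ 2 ∂μ) ?_ norm_le_one).trans_eq (by ring)
  rw [norm_mul, Complex.norm_real, Real.norm_of_nonneg (by positivity)]
  exact inv_mul_le_of_le_mul₀ hε.le (by positivity) norm_integral_le

lemma IsTestFunction.measureReal_fluctuation_gt_le (hh : IsTestFunction μ h) (hε : 0 < ε)
    (hN : IsPoissonProcess P N (ENNReal.ofReal ε⁻¹ • μ)) {δ : ℝ} (hδ : 0 < δ) :
    P.real {ω | δ < |fluctuation μ ε (N ω) h|} ≤ 48 * (∫ p, h p ^ 2 ∂μ) / δ ^ 2 := by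
  have hm := hh.aemeasurable_fluctuation hN
  have := Measure.isProbabilityMeasure_map hm
  have hδ' : 0 < δ⁻¹ := by positivity
  have norm_one_sub_charFun_le : ∀ t ∈ Set.uIoc (-2 * δ⁻¹) (2 * δ⁻¹),
      ‖1 - charFun (P.map fun ω => fluctuation μ ε (N ω) h) t‖
        ≤ 24 * (∫ p, h p ^ 2 ∂μ) / δ ^ 2 := fun t ht => by
    rw [Set.uIoc_of_le (by linarith)] at ht
    have sq_le : t ^ 2 ≤ (2 * δ⁻¹) ^ 2 := sq_le_sq' (by linarith [ht.1]) ht.2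
    calc ‖1 - charFun (P.map fun ω => fluctuation μ ε (N ω) h) t‖
        ≤ 6 * t ^ 2 * ∫ p, h p ^ 2 ∂μ := hh.norm_one_sub_charFun_fluctuation_le hε hN t
      _ ≤ 6 * (2 * δ⁻¹) ^ 2 * ∫ p, h p ^ 2 ∂μ := by gcongr
      _ = 24 * (∫ p, h p ^ 2 ∂μ) / δ ^ 2 := by field_simp; norm_num [mul_comm]
  have tail_le := measureReal_abs_gt_le_integral_charFun
    (μ := P.map fun ω => fluctuation μ ε (N ω) h) hδ
  rw [map_measureReal_apply_of_aemeasurable hm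
    (measurableSet_lt measurable_const (by fun_prop))] at tail_le
  refine tail_le.trans ((mul_le_mul_of_nonneg_left
    (intervalIntegral.norm_integral_le_of_norm_le_const norm_one_sub_charFun_le)
    (by positivity)).trans_eq ?_)
  rw [abs_of_nonneg (by linarith)]
  field_simp
  ring

end Tail

section CentralLimit

lemma norm_compExp_add_sq_le (x : ℝ) :
    ‖compExp x + (x ^ 2 / 2 : ℝ)‖ ≤ |x| ^ 3 * Real.exp |x| := by
  have cubic := Complex.norm_exp_sub_sum_le_norm_mul_exp ((x : ℂ) * Complex.I) 3
  rw [show ‖(x : ℂ) * Complex.I‖ = |x| by simp] at cubic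
  refine le_of_eq_of_le (congrArg norm ?_) cubic
  simp only [compExp, Finset.sum_range_succ, Finset.range_zero, Finset.sum_empty, mul_pow,
    Complex.I_sq]
  push_cast
  norm_num [Nat.factorial]
  ring

lemma tendsto_inv_mul_compExp (x : ℝ) :
    Tendsto (fun ε : ℝ => (ε⁻¹ : ℝ) * compExp (√ε * x)) (𝓝[>] 0)
      (𝓝 ((-(x ^ 2 / 2) : ℝ) : ℂ)) := by
  rw [tendsto_iff_norm_sub_tendsto_zero]
  have tendsto_bound :
      Tendsto (fun ε : ℝ => √ε * |x| ^ 3 * Real.exp (√ε * |x|)) (𝓝[>] 0) (𝓝 0) := by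
    have : Continuous fun ε : ℝ => √ε * |x| ^ 3 * Real.exp (√ε * |x|) := by fun_prop
    simpa using (this.tendsto 0).mono_left nhdsWithin_le_nhds
  refine squeeze_zero' (.of_forall fun _ => norm_nonneg _) ?_ tendsto_bound
  filter_upwards [self_mem_nhdsWithin] with ε (hε : 0 < ε)
  have sq_sqrt : √ε ^ 2 = ε := Real.sq_sqrt hε.le
  have remainder_eq : (ε⁻¹ : ℝ) * compExp (√ε * x) - ((-(x ^ 2 / 2) : ℝ) : ℂ)
      = (ε⁻¹ : ℝ) * (compExp (√ε * x) + ((√ε * x) ^ 2 / 2 : ℝ)) := by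
    rw [mul_pow, sq_sqrt, mul_add, ← Complex.ofReal_mul, sub_eq_add_neg, ← Complex.ofReal_neg]
    congr 2
    field_simp
  rw [remainder_eq, norm_mul, Complex.norm_real, Real.norm_of_nonneg (by positivity)]
  calc ε⁻¹ * ‖compExp (√ε * x) + ((√ε * x) ^ 2 / 2 : ℝ)‖
      ≤ ε⁻¹ * (|√ε * x| ^ 3 * Real.exp |√ε * x|) := by
        gcongr
        exact norm_compExp_add_sq_le _
    _ = ε⁻¹ * √ε ^ 2 * (√ε * |x| ^ 3 * Real.exp (√ε * |x|)) := by
        rw [abs_mul, abs_of_nonneg (Real.sqrt_nonneg _)]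
        ring
    _ = √ε * |x| ^ 3 * Real.exp (√ε * |x|) := by rw [sq_sqrt, inv_mul_cancel₀ hε.ne', one_mul]

lemma IsTestFunction.tendsto_exp_integral_compExp {α : Type*} [MeasurableSpace α] {μ : Measure α}
    {h : α → ℝ} (hh : IsTestFunction μ h) :
    Tendsto (fun ε : ℝ => Complex.exp ((ε⁻¹ : ℝ) * ∫ p, compExp (√ε * h p) ∂μ)) (𝓝[>] 0)
      (𝓝 (Complex.exp ((-((∫ p, h p ^ 2 ∂μ) / 2) : ℝ) : ℂ))) := by
  refine (Complex.continuous_exp.tendsto _).comp ?_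
  have integral_sq : ((-((∫ p, h p ^ 2 ∂μ) / 2) : ℝ) : ℂ)
      = ∫ p, ((-(h p ^ 2 / 2) : ℝ) : ℂ) ∂μ := by
    rw [integral_complex_ofReal, integral_neg, integral_div]
  simp_rw [← integral_const_mul, integral_sq]
  refine tendsto_integral_filter_of_dominated_convergence (fun p => 3 * h p ^ 2)
    (.of_forall fun ε => ?_) ?_ (hh.integrable_sq.const_mul 3)
    (.of_forall fun p => tendsto_inv_mul_compExp (h p))
  · have := hh.measurable
    exact Measurable.aestronglyMeasurable (by fun_prop)
  · filter_upwards [self_mem_nhdsWithin] with ε (hε : 0 < ε)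
    refine .of_forall fun p => ?_
    rw [norm_mul, Complex.norm_real, Real.norm_of_nonneg (by positivity)]
    refine inv_mul_le_of_le_mul₀ hε.le (by positivity) ((norm_compExp_le _).trans_eq ?_)
    rw [mul_pow, Real.sq_sqrt hε.le]
    ring

variable {β : Type*} {Ω : β → Type*} [∀ ε, MeasurableSpace (Ω ε)] {P : ∀ ε, Measure (Ω ε)}
  [∀ ε, IsProbabilityMeasure (P ε)]

open Classical in
/-- Lévy's continuity theorem for random vectors that are measurable eventually. -/
lemma tendsto_integral_of_tendsto_charFun {E : Type*} [NormedAddCommGroup E]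
    [InnerProductSpace ℝ E] [FiniteDimensional ℝ E] [MeasurableSpace E] [BorelSpace E]
    {l : Filter β} [l.IsCountablyGenerated] {V : ∀ ε, Ω ε → E}
    (hV : ∀ᶠ ε in l, AEMeasurable (V ε) (P ε)) (γ : Measure E) [hγ : IsProbabilityMeasure γ]
    (tendsto_charFun : ∀ t, Tendsto (fun ε => charFun ((P ε).map (V ε)) t) l (𝓝 (charFun γ t)))
    (Φ : E →ᵇ ℝ) :
    Tendsto (fun ε => ∫ ω, Φ (V ε ω) ∂(P ε)) l (𝓝 (∫ x, Φ x ∂γ)) := by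
  let law (ε : β) : ProbabilityMeasure E :=
    if hm : AEMeasurable (V ε) (P ε) then ⟨_, Measure.isProbabilityMeasure_map hm⟩ else ⟨γ, hγ⟩
  have law_eq {ε : β} (hm : AEMeasurable (V ε) (P ε)) :
      (law ε : Measure E) = (P ε).map (V ε) := by
    rw [show law ε = ⟨_, Measure.isProbabilityMeasure_map hm⟩ from dif_pos hm]
    rfl
  refine tendsto_of_seq_tendsto fun x hx => ?_
  have hVx : ∀ᶠ n in atTop, AEMeasurable (V (x n)) (P (x n)) := hx.eventually hV
  have tendsto_law : Tendsto (fun n => law (x n)) atTop (𝓝 ⟨γ, hγ⟩) :=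
    ProbabilityMeasure.tendsto_of_tendsto_charFun fun t =>
      ((tendsto_charFun t).comp hx).congr' (hVx.mono fun n hm => by
        simp only [law_eq hm, Function.comp_apply])
  refine (ProbabilityMeasure.tendsto_iff_forall_integral_tendsto.1 tendsto_law Φ).congr'
    (hVx.mono fun n hm => ?_)
  rw [law_eq hm, integral_map hm Φ.continuous.aestronglyMeasurable, Function.comp_apply]

end CentralLimit

section PoissonCentralLimit

variable {Ω : ℝ → Type*} [∀ ε, MeasurableSpace (Ω ε)] {P : ∀ ε, Measure (Ω ε)}
  [∀ ε, IsProbabilityMeasure (P ε)] {N : ∀ ε, Ω ε → Measure MarkedLine} {μ : Measure MarkedLine}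

lemma IsTestFunction.tendsto_charFun_fluctuation {h : MarkedLine → ℝ} (hh : IsTestFunction μ h)
    (hN : ∀ ε : ℝ, 0 < ε → IsPoissonProcess (P ε) (N ε) (ENNReal.ofReal ε⁻¹ • μ)) (t : ℝ) :
    Tendsto (fun ε => charFun ((P ε).map fun ω => fluctuation μ ε (N ε ω) h) t) (𝓝[>] 0)
      (𝓝 (charFun (gaussianReal 0 (∫ p, h p ^ 2 ∂μ).toNNReal) t)) := by
  have charFun_gaussian : charFun (gaussianReal 0 (∫ p, h p ^ 2 ∂μ).toNNReal) t
      = Complex.exp ((-((∫ p, (t * h p) ^ 2 ∂μ) / 2) : ℝ) : ℂ) := by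
    rw [charFun_gaussianReal, Real.coe_toNNReal _ (integral_nonneg fun p => sq_nonneg _)]
    simp_rw [mul_pow, integral_const_mul]
    push_cast
    ring_nf
  rw [charFun_gaussian]
  refine (hh.const_mul t).tendsto_exp_integral_compExp.congr' ?_
  filter_upwards [self_mem_nhdsWithin] with ε hε
  exact (hh.charFun_fluctuation hε (hN ε hε) t).symm

lemma tendsto_integral_fluctuation {ι : Type*} [Fintype ι] {h : ι → MarkedLine → ℝ}
    (hN : ∀ ε : ℝ, 0 < ε → IsPoissonProcess (P ε) (N ε) (ENNReal.ofReal ε⁻¹ • μ))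
    (hh : ∀ i, IsTestFunction μ (h i)) (hd : Pairwise fun i j => ∀ p, h i p = 0 ∨ h j p = 0)
    (Φ : (ι → ℝ) →ᵇ ℝ) :
    Tendsto (fun ε => ∫ ω, Φ (fun i => fluctuation μ ε (N ε ω) (h i)) ∂(P ε)) (𝓝[>] 0)
      (𝓝 (∫ x, Φ x ∂(Measure.pi fun i =>
        gaussianReal 0 (∫ p, h i p ^ 2 ∂μ).toNNReal))) := by
  set γ : Measure (ι → ℝ) := Measure.pi fun i => gaussianReal 0 (∫ p, h i p ^ 2 ∂μ).toNNReal with hγ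
  let V (ε : ℝ) (ω : Ω ε) : EuclideanSpace ℝ ι :=
    WithLp.toLp 2 fun i => fluctuation μ ε (N ε ω) (h i)
  let Ψ : EuclideanSpace ℝ ι →ᵇ ℝ := Φ.compContinuous ⟨_, PiLp.continuous_ofLp 2 _⟩
  have measurable_toLp : Measurable (WithLp.toLp 2 : (ι → ℝ) → EuclideanSpace ℝ ι) :=
    WithLp.measurable_toLp 2 _
  have aemeasurable_V : ∀ᶠ ε in 𝓝[>] 0, AEMeasurable (V ε) (P ε) := by
    filter_upwards [self_mem_nhdsWithin] with ε hε
    exact measurable_toLp.comp_aemeasurable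
      (aemeasurable_pi_lambda _ fun i => (hh i).aemeasurable_fluctuation (hN ε hε))
  have tendsto_charFun (t : EuclideanSpace ℝ ι) :
      Tendsto (fun ε => charFun ((P ε).map (V ε)) t) (𝓝[>] 0)
        (𝓝 (charFun (γ.map (WithLp.toLp 2)) t)) := by
    rw [hγ, charFun_pi]
    refine (tendsto_finsetProd Finset.univ fun i _ =>
      (hh i).tendsto_charFun_fluctuation hN (t i)).congr' ?_
    filter_upwards [self_mem_nhdsWithin] with ε hε
    exact ((iIndepFun_iff_charFun_pi fun i => (hh i).aemeasurable_fluctuation (hN ε hε)).1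
      (iIndepFun_fluctuation hε (hN ε hε) hh hd) t).symm
  have := Measure.isProbabilityMeasure_map (μ := γ) measurable_toLp.aemeasurable
  have integral_map_toLp : ∫ y, Ψ y ∂(γ.map (WithLp.toLp 2)) = ∫ x, Φ x ∂γ :=
    integral_map measurable_toLp.aemeasurable Ψ.continuous.aestronglyMeasurable
  rw [← integral_map_toLp]
  exact tendsto_integral_of_tendsto_charFun aemeasurable_V _ tendsto_charFun Ψ

end PoissonCentralLimit

section FourthMoment

/-- The truncated fourth power `min 1 ((x / δ) ^ 4)`, a bounded continuous majorant of the
indicator of `δ < |x|`. -/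
def truncFourth (δ : ℝ) : ℝ →ᵇ ℝ :=
  BoundedContinuousFunction.ofNormedAddCommGroup (fun x => min 1 ((x / δ) ^ 4)) (by fun_prop) 1
    (fun x => by
      rw [Real.norm_of_nonneg (le_min zero_le_one (by positivity))]
      exact min_le_left _ _)

lemma truncFourth_nonneg (δ x : ℝ) : 0 ≤ truncFourth δ x :=
  le_min zero_le_one (by positivity)

lemma one_le_truncFourth {δ x : ℝ} (hδ : 0 < δ) (hx : δ ≤ |x|) : 1 ≤ truncFourth δ x := by
  refine le_min le_rfl ?_
  rw [← Even.pow_abs (by decide), abs_div, abs_of_pos hδ]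
  exact one_le_pow₀ ((one_le_div hδ).2 hx)

lemma integral_truncFourth_gaussianReal_le (δ : ℝ) (v : ℝ≥0) :
    ∫ x, truncFourth δ x ∂(gaussianReal 0 v)
      ≤ (∫ x, x ^ 4 ∂(gaussianReal 0 1)) * v ^ 2 / δ ^ 4 := by
  have integrable_pow_four : Integrable (fun x : ℝ => x ^ 4) (gaussianReal 0 1) := by
    simpa [Even.pow_abs (show Even 4 by decide)] using
      (memLp_id_gaussianReal (μ := 0) (v := 1) 4).integrable_norm_pow (p := 4) (by norm_num)
  have gaussianReal_eq_map : gaussianReal 0 v = (gaussianReal 0 1).map (fun x => √v * x) := by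
    rw [gaussianReal_map_const_mul]
    congr 1
    · simp
    · ext
      simp
  have scaled_pow_four (x : ℝ) : (√v * x / δ) ^ 4 = (v ^ 2 / δ ^ 4) * x ^ 4 := by
    rw [div_pow, mul_pow, show √(v : ℝ) ^ 4 = (√(v : ℝ) ^ 2) ^ 2 by ring, Real.sq_sqrt v.coe_nonneg]
    ring
  rw [gaussianReal_eq_map,
    integral_map (by fun_prop) (truncFourth δ).continuous.aestronglyMeasurable]
  calc ∫ x, truncFourth δ (√v * x) ∂(gaussianReal 0 1)
      ≤ ∫ x, ((v : ℝ) ^ 2 / δ ^ 4) * x ^ 4 ∂(gaussianReal 0 1) :=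
        integral_mono_of_nonneg (.of_forall fun x => truncFourth_nonneg _ _)
          (integrable_pow_four.const_mul _)
          (.of_forall fun x => (min_le_right _ _).trans_eq (scaled_pow_four x))
    _ = (∫ x, x ^ 4 ∂(gaussianReal 0 1)) * v ^ 2 / δ ^ 4 := by
        rw [integral_const_mul]
        ring

lemma measureReal_abs_gt_le_integral_truncFourth {Ω : Type*} [MeasurableSpace Ω] {P : Measure Ω}
    [IsFiniteMeasure P] {X : Ω → ℝ} (hX : AEMeasurable X P) {δ : ℝ} (hδ : 0 < δ) :
    P.real {ω | δ < |X ω|} ≤ ∫ ω, truncFourth δ (X ω) ∂P := by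
  have integrable_truncFourth : Integrable (fun ω => truncFourth δ (X ω)) P :=
    .of_bound ((truncFourth δ).continuous.comp_aestronglyMeasurable hX.aestronglyMeasurable)
      ‖truncFourth δ‖ (.of_forall fun ω => (truncFourth δ).norm_coe_le_norm _)
  have markov := mul_meas_ge_le_integral_of_nonneg
    (.of_forall fun ω => truncFourth_nonneg δ (X ω)) integrable_truncFourth 1
  rw [one_mul] at markov
  exact (measureReal_mono fun ω (hω : δ < |X ω|) => one_le_truncFourth hδ hω.le).trans markov

variable {Ω : ℝ → Type*} [∀ ε, MeasurableSpace (Ω ε)] {P : ∀ ε, Measure (Ω ε)}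
  [∀ ε, IsProbabilityMeasure (P ε)] {N : ∀ ε, Ω ε → Measure MarkedLine} {μ : Measure MarkedLine}
  {h : MarkedLine → ℝ}

/-- The bound is of second order in the variance; this makes it summable over the cells of a grid,
which Chebyshev's inequality would not be. -/
lemma IsTestFunction.eventually_measureReal_fluctuation_gt_le (hh : IsTestFunction μ h)
    (hN : ∀ ε : ℝ, 0 < ε → IsPoissonProcess (P ε) (N ε) (ENNReal.ofReal ε⁻¹ • μ))
    {δ η : ℝ} (hδ : 0 < δ) (hη : 0 < η) :
    ∀ᶠ ε in 𝓝[>] 0, (P ε).real {ω | δ < |fluctuation μ ε (N ε ω) h|}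
      ≤ (∫ x, x ^ 4 ∂(gaussianReal 0 1)) * (∫ p, h p ^ 2 ∂μ) ^ 2 / δ ^ 4 + η := by
  have gaussian_bound := integral_truncFourth_gaussianReal_le δ (∫ p, h p ^ 2 ∂μ).toNNReal
  rw [Real.coe_toNNReal _ (integral_nonneg fun p => sq_nonneg _)] at gaussian_bound
  have integral_pi_unit : ∫ x : Unit → ℝ, truncFourth δ (x ())
      ∂(Measure.pi fun _ : Unit => gaussianReal 0 (∫ p, h p ^ 2 ∂μ).toNNReal)
      = ∫ x, truncFourth δ x ∂(gaussianReal 0 (∫ p, h p ^ 2 ∂μ).toNNReal) :=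
    (measurePreserving_eval (fun _ : Unit => gaussianReal 0 (∫ p, h p ^ 2 ∂μ).toNNReal)
      ()).integral_comp' (f := MeasurableEquiv.funUnique Unit ℝ) _
  have tendsto_truncFourth := tendsto_integral_fluctuation (h := fun _ : Unit => h) hN
    (fun _ => hh) (fun i j hij => (hij (Subsingleton.elim i j)).elim)
    ((truncFourth δ).compContinuous ⟨fun x => x (), by fun_prop⟩)
  simp only [BoundedContinuousFunction.compContinuous_apply, ContinuousMap.coe_mk,
    integral_pi_unit] at tendsto_truncFourth
  filter_upwards [self_mem_nhdsWithin, tendsto_truncFourth.eventually_le_const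
    (gaussian_bound.trans_lt (lt_add_of_pos_right _ hη))] with ε hε integral_le
  exact (measureReal_abs_gt_le_integral_truncFourth
    (hh.aemeasurable_fluctuation (hN ε hε)) hδ).trans integral_le

end FourthMoment

/-! ### Ottaviani's maximal inequality -/

section Ottaviani

variable {Ω E : Type*} [NormedAddCommGroup E] [MeasurableSpace E] [BorelSpace E]
  [SecondCountableTopology E]

lemma measurableSet_norm_sum_le [MeasurableSpace Ω] {X : ℕ → Ω → E} {s : Finset ℕ}
    (hX : ∀ i ∈ s, Measurable (X i)) (b : ℝ) : MeasurableSet {ω | ‖∑ i ∈ s, X i ω‖ ≤ b} :=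
  measurableSet_le (s.measurable_fun_sum hX).norm measurable_const

/-- The event that `k` is the first index for which the partial sum `∑ i < k, X i` has norm larger
than `a`. -/
def firstExit {Ω E : Type*} [NormedAddCommGroup E] (X : ℕ → Ω → E) (a : ℝ) : ℕ → Set Ω :=
  disjointed fun k => {ω | a < ‖∑ i ∈ Finset.range k, X i ω‖}

lemma measurableSet_firstExit [MeasurableSpace Ω] {X : ℕ → Ω → E} (a : ℝ) {k : ℕ}
    (hX : ∀ i < k, Measurable (X i)) : MeasurableSet (firstExit X a k) := by
  have measurable_exceed (j : ℕ) (hj : j ≤ k) :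
      MeasurableSet {ω | a < ‖∑ i ∈ Finset.range j, X i ω‖} := by
    simpa only [Set.compl_ofPred, not_le] using (measurableSet_norm_sum_le (s := Finset.range j)
      (fun i hi => hX i ((Finset.mem_range.1 hi).trans_le hj)) a).compl
  rw [firstExit, disjointed_eq_inter_compl]
  exact (measurable_exceed k le_rfl).inter (.iInter fun j => .iInter fun hj =>
    (measurable_exceed j hj.le).compl)

variable [MeasurableSpace Ω] {P : Measure Ω}

lemma measureReal_firstExit_inter {X : ℕ → Ω → E} (hX : ∀ i, Measurable (X i))
    (hind : iIndepFun X P) (a b : ℝ) (k l : ℕ) :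
    P.real (firstExit X a k ∩ {ω | ‖∑ i ∈ Finset.Ico k l, X i ω‖ ≤ b})
      = P.real (firstExit X a k) * P.real {ω | ‖∑ i ∈ Finset.Ico k l, X i ω‖ ≤ b} := by
  let σ (i : ℕ) : MeasurableSpace Ω := MeasurableSpace.comap (X i) inferInstance
  have measurable_of_mem (S : Set ℕ) (i : ℕ) (hi : i ∈ S) : Measurable[⨆ j ∈ S, σ j] (X i) :=
    Measurable.mono (comap_measurable (X i)) (le_iSup₂ (f := fun j (_ : j ∈ S) => σ j) i hi) le_rfl
  have indep_past_future : Indep (⨆ i ∈ Set.Iio k, σ i) (⨆ i ∈ Set.Ici k, σ i) P :=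
    indep_iSup_of_disjoint (fun i => (hX i).comap_le) hind.iIndep
      (Set.Iio_disjoint_Ici le_rfl)
  simp only [measureReal_def, ← ENNReal.toReal_mul]
  congr 1
  exact Indep_iff _ _ P |>.1 indep_past_future _ _
    (@measurableSet_firstExit _ _ _ _ _ _ (_) X a k (measurable_of_mem (Set.Iio k)))
    (@measurableSet_norm_sum_le _ _ _ _ _ _ (_) X _ (fun i hi =>
      measurable_of_mem (Set.Ici k) i (Finset.mem_Ico.1 hi).1) b)

variable [IsProbabilityMeasure P]

lemma one_sub_mul_measureReal_firstExit_le {X : ℕ → Ω → E} (hX : ∀ i, Measurable (X i))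
    (hind : iIndepFun X P) (a : ℝ) {b c : ℝ} {k l : ℕ}
    (hc : P.real {ω | b < ‖∑ i ∈ Finset.Ico k l, X i ω‖} ≤ c) :
    (1 - c) * P.real (firstExit X a k)
      ≤ P.real (firstExit X a k ∩ {ω | ‖∑ i ∈ Finset.Ico k l, X i ω‖ ≤ b}) := by
  have measurable_le := measurableSet_norm_sum_le (s := Finset.Ico k l) (fun i _ => hX i) b
  have one_sub_le : 1 - c ≤ P.real {ω | ‖∑ i ∈ Finset.Ico k l, X i ω‖ ≤ b} := by
    have compl_eq : {ω | b < ‖∑ i ∈ Finset.Ico k l, X i ω‖}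
        = {ω | ‖∑ i ∈ Finset.Ico k l, X i ω‖ ≤ b}ᶜ := by
      ext; simp
    rw [compl_eq, probReal_compl_eq_one_sub measurable_le] at hc
    linarith
  rw [measureReal_firstExit_inter hX hind, mul_comm]
  gcongr

lemma ottaviani_of_measurable {X : ℕ → Ω → E} (hX : ∀ i, Measurable (X i))
    (hind : iIndepFun X P) {l : ℕ} {a b c : ℝ}
    (hc : ∀ k ≤ l, P.real {ω | b < ‖∑ i ∈ Finset.Ico k l, X i ω‖} ≤ c) :
    (1 - c) * P.real {ω | ∃ k ≤ l, a + b < ‖∑ i ∈ Finset.range k, X i ω‖}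
      ≤ P.real {ω | a < ‖∑ i ∈ Finset.range l, X i ω‖} := by
  set A := firstExit X (a + b) with hA
  let B : ℕ → Set Ω := fun k => {ω | ‖∑ i ∈ Finset.Ico k l, X i ω‖ ≤ b}
  have measurable_A (k) : MeasurableSet (A k) := measurableSet_firstExit _ fun i _ => hX i
  have measurable_B (k) : MeasurableSet (B k) :=
    measurableSet_norm_sum_le (fun i _ => hX i) b
  have disjoint_A : Pairwise (Function.onFun Disjoint A) := disjoint_disjointed _
  have exceed_eq : {ω | ∃ k ≤ l, a + b < ‖∑ i ∈ Finset.range k, X i ω‖}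
      = ⋃ k ∈ Finset.range (l + 1), A k := by
    rw [hA, firstExit, biUnion_range_succ_disjointed, partialSups_eq_biSup]
    ext; simp
  have final_gt : ⋃ k ∈ Finset.range (l + 1), A k ∩ B k
      ⊆ {ω | a < ‖∑ i ∈ Finset.range l, X i ω‖} := by
    intro ω hω
    obtain ⟨k, hk, hAk, hBk⟩ := Set.mem_iUnion₂.1 hω
    have exceed : a + b < ‖∑ i ∈ Finset.range k, X i ω‖ := disjointed_subset _ k hAk
    have tail_le : ‖∑ i ∈ Finset.Ico k l, X i ω‖ ≤ b := hBk
    rw [Set.mem_ofPred_eq, ← Finset.sum_range_add_sum_Ico (fun i => X i ω)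
      (Finset.mem_range_succ_iff.1 hk)]
    linarith [norm_sub_le_norm_add (∑ i ∈ Finset.range k, X i ω) (∑ i ∈ Finset.Ico k l, X i ω)]
  calc (1 - c) * P.real {ω | ∃ k ≤ l, a + b < ‖∑ i ∈ Finset.range k, X i ω‖}
      = ∑ k ∈ Finset.range (l + 1), (1 - c) * P.real (A k) := by
        rw [exceed_eq, measureReal_biUnion_finset (fun _ _ _ _ hjk => disjoint_A hjk)
          fun k _ => measurable_A k, Finset.mul_sum]
    _ ≤ ∑ k ∈ Finset.range (l + 1), P.real (A k ∩ B k) :=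
        Finset.sum_le_sum fun k hk => one_sub_mul_measureReal_firstExit_le hX hind _
          (hc k (Finset.mem_range_succ_iff.1 hk))
    _ = P.real (⋃ k ∈ Finset.range (l + 1), A k ∩ B k) :=
        (measureReal_biUnion_finset (fun _ _ _ _ hjk =>
          (disjoint_A hjk).mono Set.inter_subset_left Set.inter_subset_left)
          fun k _ => (measurable_A k).inter (measurable_B k)).symm
    _ ≤ P.real {ω | a < ‖∑ i ∈ Finset.range l, X i ω‖} := measureReal_mono final_gt

lemma ottaviani {X : ℕ → Ω → E} (hX : ∀ i, AEMeasurable (X i) P) (hind : iIndepFun X P)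
    {l : ℕ} {a b c : ℝ}
    (hc : ∀ k ≤ l, P.real {ω | b < ‖∑ i ∈ Finset.Ico k l, X i ω‖} ≤ c) :
    (1 - c) * P.real {ω | ∃ k ≤ l, a + b < ‖∑ i ∈ Finset.range k, X i ω‖}
      ≤ P.real {ω | a < ‖∑ i ∈ Finset.range l, X i ω‖} := by
  have eq_mk : ∀ᵐ ω ∂P, ∀ i, X i ω = (hX i).mk _ ω := ae_all_iff.2 fun i => (hX i).ae_eq_mk
  have real_congr (p : (ℕ → E) → Prop) :
      P.real {ω | p fun i => X i ω} = P.real {ω | p fun i => (hX i).mk _ ω} := by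
    refine measureReal_congr (eventuallyEq_set.2 ?_)
    filter_upwards [eq_mk] with ω hω
    simp only [hω]
  rw [real_congr fun x => ∃ k ≤ l, a + b < ‖∑ i ∈ Finset.range k, x i‖,
    real_congr fun x => a < ‖∑ i ∈ Finset.range l, x i‖]
  refine ottaviani_of_measurable (fun i => (hX i).measurable_mk)
    (hind.congr fun i => (hX i).ae_eq_mk) fun k hk => ?_
  rw [← real_congr fun x => b < ‖∑ i ∈ Finset.Ico k l, x i‖]
  exact hc k hk

end Ottaviani

/-! ### Fluctuations along an increasing family of sets -/

section Sweep

variable {α : Type*} {c : α → ℝ} {J : ℝ → Set α}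

/-- The function `c (1_{J b} - 1_{J a})`: the amount of `c` that the family `J` picks up when its
parameter moves from `a` to `b`. -/
def increment (c : α → ℝ) (J : ℝ → Set α) (a b : ℝ) (p : α) : ℝ :=
  c p * ((J b).indicator 1 p - (J a).indicator 1 p)

lemma sum_Ico_increment (q : ℕ → ℝ) {k l : ℕ} (hkl : k ≤ l) (p : α) :
    ∑ i ∈ Finset.Ico k l, increment c J (q i) (q (i + 1)) p = increment c J (q k) (q l) p := by
  simp only [increment, ← Finset.mul_sum]
  rw [Finset.sum_Ico_sub (fun i => (J (q i)).indicator (1 : α → ℝ) p) hkl]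

/-- An increasing family of measurable sets that is continuous from one side, the same side at
every parameter. -/
structure IsSweep [MeasurableSpace α] (J : ℝ → Set α) : Prop where
  mono : Monotone J
  measurableSet : ∀ t, MeasurableSet (J t)
  eventually_mem_iff : (∀ t p, ∀ᶠ x in 𝓝[≥] t, (p ∈ J x ↔ p ∈ J t)) ∨
    ∀ t p, ∀ᶠ x in 𝓝[≤] t, (p ∈ J x ↔ p ∈ J t)

namespace IsSweep

variable [MeasurableSpace α] {μ κ : Measure α} {s a b u a' b' : ℝ}

lemma increment_of_le (hJ : IsSweep J) (hab : a ≤ b) :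
    increment c J a b = (J b \ J a).indicator c := by
  ext p
  have subset : p ∈ J a → p ∈ J b := @hJ.mono a b hab p
  by_cases ha : p ∈ J a <;> by_cases hb : p ∈ J b <;> simp_all [increment]

lemma increment_eq_indicator (hJ : IsSweep J) (hsa : s ≤ a) (hab : a ≤ b) (hbu : b ≤ u) :
    increment c J a b = (J b \ J a).indicator (increment c J s u) := by
  rw [hJ.increment_of_le hab, hJ.increment_of_le (hsa.trans (hab.trans hbu)),
    Set.indicator_indicator, Set.inter_eq_left.2]
  exact Set.sdiff_subset_sdiff (hJ.mono hbu) (hJ.mono hsa)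

lemma isTestFunction_increment (hJ : IsSweep J) (hsa : s ≤ a) (hab : a ≤ b) (hbu : b ≤ u)
    (h : IsTestFunction μ (increment c J s u)) : IsTestFunction μ (increment c J a b) := by
  rw [hJ.increment_eq_indicator hsa hab hbu]
  exact h.indicator ((hJ.measurableSet b).diff (hJ.measurableSet a))

lemma abs_increment_le (hJ : IsSweep J) (hsa : s ≤ a) (hab : a ≤ b) (hbu : b ≤ u) (p : α) :
    |increment c J a b p| ≤ |increment c J s u p| := by
  rw [hJ.increment_eq_indicator hsa hab hbu]
  exact norm_indicator_le_norm_self (increment c J s u) p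

lemma integral_increment_sq_le (hJ : IsSweep J) (hsa : s ≤ a) (hab : a ≤ b) (hbu : b ≤ u)
    (h : IsTestFunction μ (increment c J s u)) :
    ∫ p, increment c J a b p ^ 2 ∂μ ≤ ∫ p, increment c J s u p ^ 2 ∂μ :=
  integral_mono (hJ.isTestFunction_increment hsa hab hbu h).integrable_sq h.integrable_sq
    fun p => sq_le_sq.2 (hJ.abs_increment_le hsa hab hbu p)

lemma increment_eq_zero_or (hJ : IsSweep J) (hab : a ≤ b) (hba : b ≤ a') (hab' : a' ≤ b') (p : α) :
    increment c J a b p = 0 ∨ increment c J a' b' p = 0 := by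
  rw [hJ.increment_of_le hab, hJ.increment_of_le hab']
  by_cases hp : p ∈ J b
  · exact .inr (Set.indicator_of_notMem (fun h => h.2 (hJ.mono hba hp)) _)
  · exact .inl (Set.indicator_of_notMem (fun h => hp h.1) _)

lemma pairwise_increment_eq_zero_or (hJ : IsSweep J) {q : ℕ → ℝ} (hq : Monotone q) :
    Pairwise fun i j => ∀ p,
      increment c J (q i) (q (i + 1)) p = 0 ∨ increment c J (q j) (q (j + 1)) p = 0 := by
  intro i j hij p
  rcases lt_or_gt_of_ne hij with hlt | hlt
  · exact hJ.increment_eq_zero_or (hq i.le_succ) (hq hlt) (hq j.le_succ) p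
  · exact (hJ.increment_eq_zero_or (hq j.le_succ) (hq hlt) (hq i.le_succ) p).symm

lemma tendsto_integral_increment (hJ : IsSweep J) {t : ℝ} (hκ : Integrable (increment c J s u) κ)
    {q : ℕ → ℝ} (hq : ∀ m, q m ∈ Set.Icc s u) (hlim : ∀ p, ∀ᶠ m in atTop, (p ∈ J (q m) ↔ p ∈ J t)) :
    Tendsto (fun m => ∫ p, increment c J s (q m) p ∂κ) atTop
      (𝓝 (∫ p, increment c J s t p ∂κ)) := by
  refine tendsto_integral_of_dominated_convergence (fun p => |increment c J s u p|) (fun m => ?_)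
    hκ.abs (fun m => .of_forall (hJ.abs_increment_le le_rfl (hq m).1 (hq m).2))
    (.of_forall fun p => tendsto_const_nhds.congr' ?_)
  · rw [hJ.increment_eq_indicator le_rfl (hq m).1 (hq m).2]
    exact hκ.aestronglyMeasurable.indicator ((hJ.measurableSet _).diff (hJ.measurableSet _))
  · filter_upwards [hlim p] with m hm
    by_cases hp : p ∈ J t <;> simp [increment, hp, hm]

lemma tendsto_fluctuation_increment (hJ : IsSweep J) (ε : ℝ) {t : ℝ}
    (hμ : Integrable (increment c J s u) μ) (hκ : Integrable (increment c J s u) κ)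
    {q : ℕ → ℝ} (hq : ∀ m, q m ∈ Set.Icc s u) (hlim : ∀ p, ∀ᶠ m in atTop, (p ∈ J (q m) ↔ p ∈ J t)) :
    Tendsto (fun m => fluctuation μ ε κ (increment c J s (q m))) atTop
      (𝓝 (fluctuation μ ε κ (increment c J s t))) :=
  (((hJ.tendsto_integral_increment hκ hq hlim).const_mul ε).sub
    (hJ.tendsto_integral_increment hμ hq hlim)).const_mul (√ε)⁻¹

end IsSweep

end Sweep

section DyadicPoint

variable {s u : ℝ}

/-- The `k`-th point of the grid that divides `[s, u]` into `2 ^ m` equal parts. -/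
def dyadicPoint (s u : ℝ) (m k : ℕ) : ℝ := AffineMap.lineMap s u ((k : ℝ) / 2 ^ m)

lemma dyadicPoint_zero (s u : ℝ) (m : ℕ) : dyadicPoint s u m 0 = s := by
  simp [dyadicPoint]

lemma dyadicPoint_two_pow (s u : ℝ) (m : ℕ) : dyadicPoint s u m (2 ^ m) = u := by
  simp [dyadicPoint]

lemma dyadicPoint_succ (s u : ℝ) (m k : ℕ) :
    dyadicPoint s u (m + 1) (2 * k) = dyadicPoint s u m k := by
  rw [dyadicPoint, dyadicPoint, pow_succ', Nat.cast_mul, Nat.cast_ofNat,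
    mul_div_mul_left _ _ two_ne_zero]

lemma dyadicPoint_monotone (hsu : s ≤ u) (m : ℕ) : Monotone (dyadicPoint s u m) :=
  fun _ _ hkl => AffineMap.lineMap_mono hsu (by gcongr)

lemma dyadicPoint_mem_Icc (hsu : s ≤ u) {m k : ℕ} (hk : k ≤ 2 ^ m) :
    dyadicPoint s u m k ∈ Set.Icc s u :=
  ⟨(dyadicPoint_zero s u m).ge.trans (dyadicPoint_monotone hsu m k.zero_le),
    (dyadicPoint_monotone hsu m hk).trans (dyadicPoint_two_pow s u m).le⟩

lemma tendsto_lineMap_natCast_div (s u : ℝ) {x : ℝ} {r : ℝ → ℕ}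
    (hr : Tendsto (fun y : ℝ => (r (x * y) : ℝ) / y) atTop (𝓝 x)) :
    Tendsto (fun m => dyadicPoint s u m (r (x * 2 ^ m))) atTop
      (𝓝 (AffineMap.lineMap s u x)) :=
  (AffineMap.lineMap_continuous.tendsto x).comp
    (hr.comp (tendsto_pow_atTop_atTop_of_one_lt one_lt_two))

lemma exists_tendsto_dyadicPoint_nhdsGE {t : ℝ} (ht : t ∈ Set.Icc s u) :
    ∃ k : ℕ → ℕ, (∀ m, k m ≤ 2 ^ m) ∧
      Tendsto (fun m => dyadicPoint s u m (k m)) atTop (𝓝[≥] t) := by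
  have hsu := ht.1.trans ht.2
  rw [← segment_eq_Icc hsu, segment_eq_image_lineMap] at ht
  obtain ⟨x, ⟨hx0, hx1⟩, rfl⟩ := ht
  refine ⟨fun m => ⌈x * 2 ^ m⌉₊, fun m => Nat.ceil_le.2 ?_, tendsto_nhdsWithin_iff.2
    ⟨tendsto_lineMap_natCast_div s u (tendsto_nat_ceil_mul_div_atTop hx0),
      .of_forall fun m => AffineMap.lineMap_mono hsu ?_⟩⟩
  · push_cast
    exact mul_le_of_le_one_left (by positivity) hx1
  · rw [le_div_iff₀ (by positivity)]
    exact Nat.le_ceil _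

lemma exists_tendsto_dyadicPoint_nhdsLE {t : ℝ} (ht : t ∈ Set.Icc s u) :
    ∃ k : ℕ → ℕ, (∀ m, k m ≤ 2 ^ m) ∧
      Tendsto (fun m => dyadicPoint s u m (k m)) atTop (𝓝[≤] t) := by
  have hsu := ht.1.trans ht.2
  rw [← segment_eq_Icc hsu, segment_eq_image_lineMap] at ht
  obtain ⟨x, ⟨hx0, hx1⟩, rfl⟩ := ht
  refine ⟨fun m => ⌊x * 2 ^ m⌋₊, fun m => Nat.floor_le_of_le ?_, tendsto_nhdsWithin_iff.2
    ⟨tendsto_lineMap_natCast_div s u (tendsto_nat_floor_mul_div_atTop hx0),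
      .of_forall fun m => AffineMap.lineMap_mono hsu ?_⟩⟩
  · push_cast
    exact mul_le_of_le_one_left (by positivity) hx1
  · rw [div_le_iff₀ (by positivity)]
    exact Nat.floor_le (by positivity)

lemma monotone_exists_dyadicPoint {Ω : Type*} (s u : ℝ) (p : ℝ → Ω → Prop) :
    Monotone fun m : ℕ => {ω | ∃ k ≤ 2 ^ m, p (dyadicPoint s u m k) ω} := by
  refine monotone_nat_of_le_succ fun m ω => ?_
  rintro ⟨k, hk, hω⟩
  exact ⟨2 * k, by rw [pow_succ']; gcongr, by rwa [dyadicPoint_succ]⟩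

lemma IsSweep.exists_eventually_mem_dyadicPoint_iff {α : Type*} [MeasurableSpace α]
    {J : ℝ → Set α} (hJ : IsSweep J) {t : ℝ} (ht : t ∈ Set.Icc s u) :
    ∃ k : ℕ → ℕ, (∀ m, k m ≤ 2 ^ m) ∧
      ∀ p, ∀ᶠ m in atTop, (p ∈ J (dyadicPoint s u m (k m)) ↔ p ∈ J t) := by
  rcases hJ.eventually_mem_iff with right_continuous | left_continuous
  · obtain ⟨k, hk, hlim⟩ := exists_tendsto_dyadicPoint_nhdsGE ht
    exact ⟨k, hk, fun p => hlim.eventually (right_continuous t p)⟩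
  · obtain ⟨k, hk, hlim⟩ := exists_tendsto_dyadicPoint_nhdsLE ht
    exact ⟨k, hk, fun p => hlim.eventually (left_continuous t p)⟩

end DyadicPoint

section Maximal

variable {Ω : Type*} [MeasurableSpace Ω] {P : Measure Ω} {N : Ω → Measure MarkedLine}
  {μ : Measure MarkedLine} {ε : ℝ} {c : MarkedLine → ℝ} {J : ℝ → Set MarkedLine}

lemma ae_sum_Ico_fluctuation_increment (hN : IsPoissonProcess P N (ENNReal.ofReal ε⁻¹ • μ))
    {q : ℕ → ℝ} (hh : ∀ i, IsTestFunction μ (increment c J (q i) (q (i + 1)))) :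
    ∀ᵐ ω ∂P, ∀ k l, k ≤ l →
      ∑ i ∈ Finset.Ico k l, fluctuation μ ε (N ω) (increment c J (q i) (q (i + 1)))
        = fluctuation μ ε (N ω) (increment c J (q k) (q l)) := by
  filter_upwards [ae_all_iff.2 fun i => (hh i).ae_integrable hN] with ω hω k l hkl
  rw [← fluctuation_sum _ (fun i _ => (hh i).integrable) fun i _ => hω i]
  exact congrArg _ (funext (sum_Ico_increment q hkl))

namespace IsSweep

variable [IsProbabilityMeasure P]

lemma measureReal_exists_le_gt_le (hJ : IsSweep J) (hε : 0 < ε)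
    (hN : IsPoissonProcess P N (ENNReal.ofReal ε⁻¹ • μ)) {q : ℕ → ℝ} (hq : Monotone q)
    (hh : ∀ k, IsTestFunction μ (increment c J (q 0) (q k))) {δ : ℝ} (hδ : 0 < δ) {l : ℕ}
    (hσ : 48 * (∫ p, increment c J (q 0) (q l) p ^ 2 ∂μ) / δ ^ 2 ≤ 1 / 2) :
    P.real {ω | ∃ k ≤ l, 2 * δ < |fluctuation μ ε (N ω) (increment c J (q 0) (q k))|}
      ≤ 2 * P.real {ω | δ < |fluctuation μ ε (N ω) (increment c J (q 0) (q l))|} := by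
  have isTestFunction {i k : ℕ} (hik : i ≤ k) : IsTestFunction μ (increment c J (q i) (q k)) :=
    hJ.isTestFunction_increment (hq i.zero_le) (hq hik) le_rfl (hh k)
  have sum_eq := ae_sum_Ico_fluctuation_increment hN fun i => isTestFunction i.le_succ
  have real_final_eq {k : ℕ} (hk : k ≤ l) : P.real {ω | δ < ‖∑ i ∈ Finset.Ico k l,
        fluctuation μ ε (N ω) (increment c J (q i) (q (i + 1)))‖}
      = P.real {ω | δ < |fluctuation μ ε (N ω) (increment c J (q k) (q l))|} := by
    refine measureReal_congr (eventuallyEq_set.2 ?_)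
    filter_upwards [sum_eq] with ω hω
    simp only [hω k l hk, Real.norm_eq_abs]
  have real_exceed_eq : P.real {ω | ∃ k ≤ l, δ + δ < ‖∑ i ∈ Finset.range k,
        fluctuation μ ε (N ω) (increment c J (q i) (q (i + 1)))‖}
      = P.real {ω | ∃ k ≤ l, 2 * δ < |fluctuation μ ε (N ω) (increment c J (q 0) (q k))|} := by
    refine measureReal_congr (eventuallyEq_set.2 ?_)
    filter_upwards [sum_eq] with ω hω
    simp only [Finset.range_eq_Ico, hω 0 _ (Nat.zero_le _), Real.norm_eq_abs, two_mul]
  have tail_le (k : ℕ) (hk : k ≤ l) : P.real {ω | δ < ‖∑ i ∈ Finset.Ico k l,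
      fluctuation μ ε (N ω) (increment c J (q i) (q (i + 1)))‖} ≤ 1 / 2 := by
    rw [real_final_eq hk]
    refine ((isTestFunction hk).measureReal_fluctuation_gt_le hε hN hδ).trans (le_trans ?_ hσ)
    gcongr ?_ * ?_ / _
    exact hJ.integral_increment_sq_le (hq k.zero_le) (hq hk) le_rfl (hh l)
  have key := ottaviani (a := δ)
    (fun i => (isTestFunction i.le_succ).aemeasurable_fluctuation hN)
    (iIndepFun_fluctuation hε hN (fun i => isTestFunction i.le_succ)
      (hJ.pairwise_increment_eq_zero_or hq)) tail_le
  rw [real_exceed_eq, Finset.range_eq_Ico, real_final_eq l.zero_le] at key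
  linarith

lemma measureReal_exists_dyadicPoint_gt_le (hJ : IsSweep J) (hε : 0 < ε)
    (hN : IsPoissonProcess P N (ENNReal.ofReal ε⁻¹ • μ)) {s u : ℝ} (hsu : s ≤ u)
    (hh : IsTestFunction μ (increment c J s u)) {δ : ℝ} (hδ : 0 < δ)
    (hσ : 48 * (∫ p, increment c J s u p ^ 2 ∂μ) / δ ^ 2 ≤ 1 / 2) (m : ℕ) :
    P.real {ω | ∃ k ≤ 2 ^ m,
        2 * δ < |fluctuation μ ε (N ω) (increment c J s (dyadicPoint s u m k))|}
      ≤ 2 * P.real {ω | δ < |fluctuation μ ε (N ω) (increment c J s u)|} := by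
  let q (k : ℕ) : ℝ := dyadicPoint s u m (min k (2 ^ m))
  have q_of_le {k : ℕ} (hk : k ≤ 2 ^ m) : q k = dyadicPoint s u m k := by
    simp only [q, min_eq_left hk]
  have q_zero : q 0 = s := (q_of_le (Nat.zero_le _)).trans (dyadicPoint_zero s u m)
  have q_last : q (2 ^ m) = u := (q_of_le le_rfl).trans (dyadicPoint_two_pow s u m)
  have q_mem (k : ℕ) : q k ∈ Set.Icc s u := dyadicPoint_mem_Icc hsu (min_le_right _ _)
  have key := hJ.measureReal_exists_le_gt_le (c := c) (q := q) (l := 2 ^ m) hε hN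
    (fun _ _ hkl => dyadicPoint_monotone hsu m (min_le_min_right _ hkl))
    (fun k => hJ.isTestFunction_increment q_zero.ge (by rw [q_zero]; exact (q_mem k).1)
      (q_mem k).2 hh) hδ (by rwa [q_zero, q_last])
  rw [q_zero, q_last] at key
  convert key using 5 with ω
  ext k
  exact and_congr_right fun hk => by rw [q_of_le hk]

lemma measureReal_exists_gt_le (hJ : IsSweep J) (hε : 0 < ε)
    (hN : IsPoissonProcess P N (ENNReal.ofReal ε⁻¹ • μ)) {s u : ℝ} (hsu : s ≤ u)
    (hh : IsTestFunction μ (increment c J s u)) {δ : ℝ} (hδ : 0 < δ)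
    (hσ : 48 * (∫ p, increment c J s u p ^ 2 ∂μ) / δ ^ 2 ≤ 1 / 2) :
    P.real {ω | ∃ t ∈ Set.Icc s u, 2 * δ < |fluctuation μ ε (N ω) (increment c J s t)|}
      ≤ 2 * P.real {ω | δ < |fluctuation μ ε (N ω) (increment c J s u)|} := by
  let exceed (t : ℝ) (ω : Ω) : Prop := 2 * δ < |fluctuation μ ε (N ω) (increment c J s t)|
  have subset_dyadic : ({ω | ∃ t ∈ Set.Icc s u, exceed t ω} : Set Ω)
      ≤ᵐ[P] ⋃ m, {ω | ∃ k ≤ 2 ^ m, exceed (dyadicPoint s u m k) ω} := by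
    filter_upwards [hh.ae_integrable hN] with ω hω
    rintro ⟨t, ht, hlt⟩
    obtain ⟨k, hk, hlim⟩ := hJ.exists_eventually_mem_dyadicPoint_iff ht
    have tendsto_abs := (hJ.tendsto_fluctuation_increment ε hh.integrable hω
      (fun m => dyadicPoint_mem_Icc hsu (hk m)) hlim).abs
    obtain ⟨m, hm⟩ := (tendsto_abs.eventually_const_lt hlt).exists
    exact Set.mem_iUnion.2 ⟨m, k m, hk m, hm⟩
  refine ENNReal.toReal_le_of_le_ofReal (by positivity) ((measure_mono_ae subset_dyadic).trans ?_)
  rw [(monotone_exists_dyadicPoint s u exceed).measure_iUnion]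
  refine iSup_le fun m => ?_
  rw [← ofReal_measureReal]
  exact ENNReal.ofReal_le_ofReal (hJ.measureReal_exists_dyadicPoint_gt_le hε hN hsu hh hδ hσ m)

end IsSweep

end Maximal

/-! ### The path space -/

section Path

lemma isCompact_Icc_natCast (n : ℕ) : Set.Icc (-(n : ℝ)) n ∈ {K : Set ℝ | IsCompact K} :=
  isCompact_Icc

lemma monotone_Icc_natCast : Monotone fun n : ℕ => Set.Icc (-(n : ℝ)) n := fun _ _ h =>
  Set.Icc_subset_Icc (neg_le_neg (Nat.cast_le.2 h)) (Nat.cast_le.2 h)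

lemma exists_subset_Icc_natCast (K : Set ℝ) (hK : K ∈ {K : Set ℝ | IsCompact K}) :
    ∃ n : ℕ, K ⊆ Set.Icc (-(n : ℝ)) n := by
  obtain ⟨r, hr⟩ := (show IsCompact K from hK).isBounded.subset_closedBall 0
  obtain ⟨n, hn⟩ := exists_nat_ge r
  refine ⟨n, fun x hx => ?_⟩
  exact abs_le.1 ((mem_closedBall_zero_iff.1 (hr hx)).trans hn)

instance : (uniformity PathSpace).IsCountablyGenerated :=
  UniformOnFun.isCountablyGenerated_uniformity _ isCompact_Icc_natCast monotone_Icc_natCast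
    exists_subset_Icc_natCast

lemma hasBasis_uniformity_pathSpace :
    (uniformity PathSpace).HasBasis (fun i : ℕ × ℝ => 0 < i.2) fun i =>
      {q | ∀ t ∈ Set.Icc (-(i.1 : ℝ)) i.1,
        |UniformOnFun.toFun _ q.1 t - UniformOnFun.toFun _ q.2 t| < i.2} :=
  UniformOnFun.hasBasis_uniformity_of_covering_of_basis _ isCompact_Icc_natCast
    monotone_Icc_natCast.directed_le exists_subset_Icc_natCast Metric.uniformity_basis_dist

lemma exists_abs_sub_le_of_uniformContinuous {F : PathSpace → ℝ} (hF : UniformContinuous F) {η : ℝ}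
    (hη : 0 < η) : ∃ R : ℕ, ∃ δ > 0, ∀ f g : ℝ → ℝ,
      (∀ t ∈ Set.Icc (-(R : ℝ)) R, |f t - g t| < δ) → |F (toPath f) - F (toPath g)| ≤ η := by
  obtain ⟨⟨R, δ⟩, hδ, h⟩ := hasBasis_uniformity_pathSpace.mem_iff.1
    (hF (Metric.dist_mem_uniformity hη))
  exact ⟨R, δ, hδ, fun f g hfg => le_of_lt (@h (toPath f, toPath g) hfg)⟩

lemma tendsto_toPath {ι : Type*} {l : Filter ι} {f : ι → ℝ → ℝ} {g : ℝ → ℝ}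
    (h : ∀ R : ℕ, ∀ δ > 0, ∀ᶠ i in l, ∀ t ∈ Set.Icc (-(R : ℝ)) R, |g t - f i t| < δ) :
    Tendsto (fun i => toPath (f i)) l (𝓝 (toPath g)) := by
  rw [(nhds_basis_uniformity' hasBasis_uniformity_pathSpace).tendsto_right_iff]
  rintro ⟨R, δ⟩ hδ
  exact h R δ hδ

lemma continuous_toPath_sum {ι : Type*} [Fintype ι] (ρ : ι → ℝ → ℝ) (hρ : ∀ i t, |ρ i t| ≤ 1) :
    Continuous fun u : ι → ℝ => toPath fun t => ∑ i, u i * ρ i t := by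
  rw [continuous_iff_continuousAt]
  intro u
  refine tendsto_toPath fun R δ hδ => ?_
  have h1 : Tendsto (fun v : ι → ℝ => ∑ i, |u i - v i|) (𝓝 u) (𝓝 0) := by
    have : Continuous fun v : ι → ℝ => ∑ i, |u i - v i| := by fun_prop
    simpa using this.tendsto u
  filter_upwards [h1.eventually_lt_const hδ] with v hv t _
  refine lt_of_le_of_lt ?_ hv
  rw [← Finset.sum_sub_distrib]
  refine (Finset.abs_sum_le_sum_abs _ _).trans (Finset.sum_le_sum fun i _ => ?_)
  rw [← sub_mul, abs_mul]
  exact mul_le_of_le_one_right (abs_nonneg _) (hρ i t)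

end Path

/-! ### Outer expectations -/

section OuterExpectation

variable {Ω : Type*} [MeasurableSpace Ω] {P : Measure Ω} [IsFiniteMeasure P] {f g : Ω → ℝ} {m M : ℝ}

lemma outerExpectation_le (hf : ∀ ω, m ≤ f ω) (hg : Integrable g P)
    (hfg : ∀ ω, f ω ≤ g ω) : outerExpectation P f ≤ ∫ ω, g ω ∂P := by
  refine csInf_le ⟨∫ _, m ∂P, ?_⟩ ⟨g, hg, hfg, rfl⟩
  rintro c ⟨g', hg', hfg', rfl⟩
  exact integral_mono (integrable_const m) hg' fun ω => (hf ω).trans (hfg' ω)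

lemma le_outerExpectation {a : ℝ} (hM : ∀ ω, f ω ≤ M)
    (h : ∀ g : Ω → ℝ, Integrable g P → (∀ ω, f ω ≤ g ω) → a ≤ ∫ ω, g ω ∂P) :
    a ≤ outerExpectation P f := by
  refine le_csInf ⟨_, fun _ => M, integrable_const M, hM, rfl⟩ ?_
  rintro c ⟨g, hg, hfg, rfl⟩
  exact h g hg hfg

lemma outerExpectation_mono (hf : ∀ ω, m ≤ f ω) (hg : ∀ ω, g ω ≤ M)
    (hfg : ∀ ω, f ω ≤ g ω) : outerExpectation P f ≤ outerExpectation P g :=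
  le_outerExpectation hg fun _ hk hgk => outerExpectation_le hf hk fun ω => (hfg ω).trans (hgk ω)

lemma outerExpectation_comp_mono {E : Type*} [TopologicalSpace E] {F G : E →ᵇ ℝ}
    (hFG : ∀ x, F x ≤ G x) (X : Ω → E) :
    outerExpectation P (fun ω => F (X ω)) ≤ outerExpectation P fun ω => G (X ω) :=
  outerExpectation_mono (fun ω => (abs_le.1 (F.norm_coe_le_norm (X ω))).1)
    (fun ω => (abs_le.1 (G.norm_coe_le_norm (X ω))).2) fun ω => hFG (X ω)

end OuterExpectation

section InfConvolution

variable {X : Type*} [PseudoMetricSpace X]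

/-- The Lipschitz regularization of `F`: the largest `m`-Lipschitz function below `F`. -/
def infConv (F : X →ᵇ ℝ) (m : ℕ) (x : X) : ℝ := ⨅ y, F y + m * dist x y

lemma neg_norm_le_add_mul_dist (F : X →ᵇ ℝ) (m : ℕ) (x y : X) : -‖F‖ ≤ F y + m * dist x y := by
  have dist_nonneg : 0 ≤ m * dist x y := by positivity
  linarith [(abs_le.1 (F.norm_coe_le_norm y)).1]

lemma infConv_le_add (F : X →ᵇ ℝ) (m : ℕ) (x y : X) : infConv F m x ≤ F y + m * dist x y :=
  ciInf_le ⟨-‖F‖, by rintro _ ⟨z, rfl⟩; exact neg_norm_le_add_mul_dist F m x z⟩ y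

lemma infConv_le (F : X →ᵇ ℝ) (m : ℕ) (x : X) : infConv F m x ≤ F x := by
  simpa using infConv_le_add F m x x

lemma le_infConv {F : X →ᵇ ℝ} {m : ℕ} {x : X} {a : ℝ} (h : ∀ y, a ≤ F y + m * dist x y) :
    a ≤ infConv F m x :=
  have : Nonempty X := ⟨x⟩
  le_ciInf h

lemma abs_infConv_le (F : X →ᵇ ℝ) (m : ℕ) (x : X) : |infConv F m x| ≤ ‖F‖ :=
  abs_le.2 ⟨le_infConv fun y => neg_norm_le_add_mul_dist F m x y,
    (infConv_le F m x).trans (abs_le.1 (F.norm_coe_le_norm x)).2⟩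

lemma lipschitzWith_infConv (F : X →ᵇ ℝ) (m : ℕ) : LipschitzWith m (infConv F m) := by
  refine LipschitzWith.of_le_add_mul _ fun x y => ?_
  refine sub_le_iff_le_add.1 (le_infConv fun z => sub_le_iff_le_add.2 ?_)
  calc infConv F m x ≤ F z + m * dist x z := infConv_le_add F m x z
    _ ≤ F z + m * (dist x y + dist y z) := by gcongr; exact dist_triangle x y z
    _ = F z + m * dist y z + m * dist x y := by ring

lemma tendsto_infConv (F : X →ᵇ ℝ) (x : X) :
    Tendsto (fun m => infConv F m x) atTop (𝓝 (F x)) := by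
  rw [tendsto_order]
  refine ⟨fun a ha => ?_, fun a ha => .of_forall fun m => (infConv_le F m x).trans_lt ha⟩
  obtain ⟨b, hab, hb⟩ := exists_between ha
  obtain ⟨δ, hδ, lt_of_dist_lt⟩ :=
    Metric.eventually_nhds_iff.1 (F.continuous.continuousAt.eventually_const_lt hb)
  filter_upwards [tendsto_natCast_atTop_atTop.eventually_ge_atTop (2 * ‖F‖ / δ)] with m hm
  refine hab.trans_le (le_infConv fun y => ?_)
  rcases lt_or_ge (dist y x) δ with near | far
  · have dist_nonneg : 0 ≤ m * dist x y := by positivity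
    linarith [lt_of_dist_lt near]
  · have oscillation_le : 2 * ‖F‖ ≤ m * dist x y := by
      rw [dist_comm]
      exact ((div_le_iff₀ hδ).1 hm).trans (by gcongr)
    linarith [(abs_le.1 (F.norm_coe_le_norm x)).2, (abs_le.1 (F.norm_coe_le_norm y)).1]

end InfConvolution

section UniformlyContinuous

variable {E : Type*} [UniformSpace E] [(uniformity E).IsCountablyGenerated]
  {Ω' : Type*} [MeasurableSpace Ω'] {P' : Measure Ω'} [IsFiniteMeasure P']

lemma exists_uniformContinuous_le (F : E →ᵇ ℝ) {Y : Ω' → E}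
    (hY : AEStronglyMeasurable Y P') {η : ℝ} (hη : 0 < η) :
    ∃ G : E →ᵇ ℝ, UniformContinuous G ∧ (∀ x, G x ≤ F x) ∧
      ∫ ω, F (Y ω) ∂P' - η < ∫ ω, G (Y ω) ∂P' := by
  let _ := UniformSpace.pseudoMetricSpace E
  let G (m : ℕ) : E →ᵇ ℝ := BoundedContinuousFunction.ofNormedAddCommGroup
    (infConv F m) (lipschitzWith_infConv F m).continuous ‖F‖ (abs_infConv_le F m)
  have tendsto_integral :
      Tendsto (fun m => ∫ ω, G m (Y ω) ∂P') atTop (𝓝 (∫ ω, F (Y ω) ∂P')) :=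
    tendsto_integral_of_dominated_convergence (fun _ => ‖F‖)
      (fun m => (G m).continuous.comp_aestronglyMeasurable hY) (integrable_const _)
      (fun m => .of_forall fun ω => abs_infConv_le F m (Y ω))
      (.of_forall fun ω => tendsto_infConv F (Y ω))
  obtain ⟨m, hm⟩ := (tendsto_integral.eventually_const_lt (sub_lt_self _ hη)).exists
  exact ⟨G m, (lipschitzWith_infConv F m).uniformContinuous, fun x => infConv_le F m x, hm⟩

variable {β : Type*} {l : Filter β} {Ω : β → Type*} [∀ ε, MeasurableSpace (Ω ε)]
  {P : ∀ ε, Measure (Ω ε)} [∀ ε, IsFiniteMeasure (P ε)]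

lemma tendsto_outerExpectation_of_uniformContinuous {X : ∀ ε, Ω ε → E} {Y : Ω' → E}
    (hY : AEStronglyMeasurable Y P')
    (h : ∀ F : E →ᵇ ℝ, UniformContinuous F →
      Tendsto (fun ε => outerExpectation (P ε) fun ω => F (X ε ω)) l (𝓝 (∫ ω, F (Y ω) ∂P')))
    (F : E →ᵇ ℝ) :
    Tendsto (fun ε => outerExpectation (P ε) fun ω => F (X ε ω)) l (𝓝 (∫ ω, F (Y ω) ∂P')) := by
  rw [tendsto_order]
  constructor
  · intro a ha
    obtain ⟨G, hGu, hGF, hG⟩ := exists_uniformContinuous_le F hY (sub_pos.2 ha)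
    rw [sub_sub_cancel] at hG
    filter_upwards [(h G hGu).eventually_const_lt hG] with ε hε
    exact hε.trans_le (outerExpectation_comp_mono hGF (X ε))
  · intro a ha
    obtain ⟨G, hGu, hGF, hG⟩ := exists_uniformContinuous_le (-F) hY (sub_pos.2 ha)
    have integral_neg_lt : ∫ ω, (-G) (Y ω) ∂P' < a := by
      simp only [BoundedContinuousFunction.coe_neg, Pi.neg_apply, integral_neg] at hG ⊢
      linarith
    filter_upwards [(h (-G) hGu.neg).eventually_lt_const integral_neg_lt] with ε hε
    exact (outerExpectation_comp_mono (fun x => le_neg_of_le_neg (hGF x)) (X ε)).trans_lt hε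

end UniformlyContinuous

/-! ### Step functions on a grid -/

/-- The `j`-th point of the grid of mesh `1 / (n + 1)` that starts at `-R`. -/
def gridPoint (R n j : ℕ) : ℝ := j / (n + 1) - R

/-- The number of cells of the grid on `[-R, R]`. -/
abbrev gridSize (R n : ℕ) : ℕ := 2 * R * (n + 1)

/-- The index of the last grid point in `[-R, R]` to the left of `t`. -/
def gridIndex (R n : ℕ) (t : ℝ) : ℕ := min ⌊(t + R) * (n + 1)⌋₊ (gridSize R n)

lemma gridIndex_le (R n : ℕ) (t : ℝ) : gridIndex R n t ≤ gridSize R n := min_le_right _ _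

lemma gridPoint_mono (R n : ℕ) : Monotone (gridPoint R n) := by
  intro i j h
  unfold gridPoint
  gcongr

lemma gridPoint_succ_sub (R n j : ℕ) : gridPoint R n (j + 1) - gridPoint R n j = 1 / (n + 1) := by
  unfold gridPoint
  push_cast
  ring

lemma gridPoint_center (R n : ℕ) : gridPoint R n (R * (n + 1)) = 0 := by
  unfold gridPoint
  push_cast
  field_simp
  ring

lemma gridPoint_zero (R n : ℕ) : gridPoint R n 0 = -R := by
  simp [gridPoint]

lemma gridPoint_gridSize (R n : ℕ) : gridPoint R n (gridSize R n) = R := by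
  unfold gridPoint gridSize
  push_cast
  field_simp
  ring

lemma gridPoint_mem (R n : ℕ) {j : ℕ} (hj : j ≤ gridSize R n) :
    gridPoint R n j ∈ Set.Icc (-(R : ℝ)) R :=
  ⟨(gridPoint_zero R n).symm.le.trans (gridPoint_mono R n (Nat.zero_le j)),
    (gridPoint_mono R n hj).trans (gridPoint_gridSize R n).le⟩

lemma gridIndex_spec {R n : ℕ} {t : ℝ} (ht : t ∈ Set.Icc (-(R : ℝ)) R) :
    (gridIndex R n t < gridSize R n ∧
      t ∈ Set.Icc (gridPoint R n (gridIndex R n t)) (gridPoint R n (gridIndex R n t + 1))) ∨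
    t = gridPoint R n (gridIndex R n t) := by
  have mesh_pos : (0 : ℝ) < n + 1 := by positivity
  have scaled_nonneg : 0 ≤ (t + R) * (n + 1) := mul_nonneg (by linarith [ht.1]) mesh_pos.le
  rcases ht.2.eq_or_lt with right_end | lt_right_end
  · right
    have floor_eq : ⌊(t + R) * (n + 1)⌋₊ = gridSize R n := by
      rw [right_end, show ((R : ℝ) + R) * (n + 1) = (gridSize R n : ℕ) by push_cast; ring,
        Nat.floor_natCast]
    rw [gridIndex, floor_eq, min_self, gridPoint_gridSize, right_end]
  · left
    have floor_lt : ⌊(t + R) * (n + 1)⌋₊ < gridSize R n := by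
      rw [Nat.floor_lt scaled_nonneg]
      push_cast
      nlinarith
    rw [gridIndex, min_eq_left floor_lt.le]
    refine ⟨floor_lt, ?_, ?_⟩
    · unfold gridPoint
      rw [sub_le_iff_le_add, div_le_iff₀ mesh_pos]
      exact Nat.floor_le scaled_nonneg
    · unfold gridPoint
      rw [le_sub_iff_add_le, le_div_iff₀ mesh_pos]
      push_cast
      exact (Nat.lt_floor_add_one _).le

lemma abs_sub_gridPoint_le {R n : ℕ} {t : ℝ} (ht : t ∈ Set.Icc (-(R : ℝ)) R) :
    |t - gridPoint R n (gridIndex R n t)| ≤ 1 / (n + 1) := by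
  rcases gridIndex_spec (n := n) ht with ⟨-, left_le, le_right⟩ | eq_gridPoint
  · rw [abs_of_nonneg (by linarith), ← gridPoint_succ_sub R n (gridIndex R n t)]
    linarith
  · rw [← eq_gridPoint, sub_self, abs_zero]
    positivity

/-- The increments of a function over the cells of the grid. -/
def gridIncrement (R n : ℕ) (f : ℝ → ℝ) (j : Fin (gridSize R n)) : ℝ :=
  f (gridPoint R n (j + 1)) - f (gridPoint R n j)

/-- The weight of the increment over the `j`-th cell at time `t`. -/
def gridWeight (R n : ℕ) (j : Fin (gridSize R n)) (t : ℝ) : ℝ :=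
  (if (j : ℕ) < gridIndex R n t then 1 else 0) - if (j : ℕ) < R * (n + 1) then 1 else 0

lemma abs_gridWeight_le (R n : ℕ) (j : Fin (gridSize R n)) (t : ℝ) : |gridWeight R n j t| ≤ 1 := by
  unfold gridWeight
  split_ifs <;> norm_num

/-- The step function with prescribed increments that vanishes at `0`. -/
def gridPath (R n : ℕ) (u : Fin (gridSize R n) → ℝ) (t : ℝ) : ℝ := ∑ j, u j * gridWeight R n j t

lemma continuous_toPath_gridPath (R n : ℕ) : Continuous fun u => toPath (gridPath R n u) :=
  continuous_toPath_sum _ (abs_gridWeight_le R n)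

lemma sum_gridIncrement_of_lt (f : ℝ → ℝ) {R n i : ℕ} (hi : i ≤ gridSize R n) :
    ∑ j, gridIncrement R n f j * (if (j : ℕ) < i then 1 else 0)
      = f (gridPoint R n i) - f (gridPoint R n 0) := by
  rw [← Finset.sum_range_sub (fun j => f (gridPoint R n j)) i]
  simp only [gridIncrement]
  rw [Fin.sum_univ_eq_sum_range (fun j => (f (gridPoint R n (j + 1)) - f (gridPoint R n j))
    * (if j < i then 1 else 0)) (gridSize R n)]
  simp only [mul_ite, mul_one, mul_zero]
  rw [← Finset.sum_filter]
  congr 1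
  ext j
  simp only [Finset.mem_filter, Finset.mem_range]
  omega

lemma gridPath_gridIncrement {R n : ℕ} {f : ℝ → ℝ} (hf : f 0 = 0) (t : ℝ) :
    gridPath R n (gridIncrement R n f) t = f (gridPoint R n (gridIndex R n t)) := by
  have center_le : R * (n + 1) ≤ gridSize R n := by nlinarith [Nat.zero_le (R * (n + 1))]
  simp only [gridPath, gridWeight, mul_sub, Finset.sum_sub_distrib]
  rw [sum_gridIncrement_of_lt f (gridIndex_le R n t), sum_gridIncrement_of_lt f center_le,
    gridPoint_center, hf]
  ring

lemma eventually_abs_sub_lt {f : ℝ → ℝ} (hf : Continuous f) (R : ℕ) {δ : ℝ} (hδ : 0 < δ) :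
    ∀ᶠ n : ℕ in atTop, ∀ s ∈ Set.Icc (-(R : ℝ)) R, ∀ t ∈ Set.Icc (-(R : ℝ)) R,
      |s - t| ≤ 1 / (n + 1) → |f s - f t| < δ := by
  obtain ⟨θ, hθ, dist_lt⟩ := Metric.uniformContinuousOn_iff.1
    (isCompact_Icc.uniformContinuousOn_of_continuous hf.continuousOn) δ hδ
  filter_upwards [tendsto_one_div_add_atTop_nhds_zero_nat.eventually_lt_const hθ]
    with n hn s hs t ht hst
  exact dist_lt s hs t ht (hst.trans_lt hn)

lemma eventually_abs_gridIncrement_lt {f : ℝ → ℝ} (hf : Continuous f) (R : ℕ) {δ : ℝ}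
    (hδ : 0 < δ) : ∀ᶠ n : ℕ in atTop, ∀ j, |gridIncrement R n f j| < δ := by
  filter_upwards [eventually_abs_sub_lt hf R hδ] with n hn j
  refine hn _ (gridPoint_mem R n j.isLt) _ (gridPoint_mem R n j.isLt.le) ?_
  rw [gridPoint_succ_sub, abs_of_nonneg (by positivity)]

lemma sum_gridIncrement_sq_le {f : ℝ → ℝ} (hf : Monotone f) {R n : ℕ} {θ : ℝ}
    (hθ : ∀ j, gridIncrement R n f j ≤ θ) :
    ∑ j, gridIncrement R n f j ^ 2 ≤ θ * (f R - f (-R)) := by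
  have telescoping : ∑ j, gridIncrement R n f j = f R - f (-R) := by
    simpa [gridPoint_gridSize, gridPoint_zero] using
      sum_gridIncrement_of_lt (R := R) (n := n) f le_rfl
  rw [← telescoping, Finset.mul_sum]
  refine Finset.sum_le_sum fun j _ => ?_
  rw [sq]
  exact mul_le_mul_of_nonneg_right (hθ j) (sub_nonneg.2 (hf (gridPoint_mono R n j.val.le_succ)))

lemma eventually_abs_sub_gridPath_lt {f : ℝ → ℝ} (hf : Continuous f) (hf0 : f 0 = 0) (R : ℕ) {δ : ℝ}
    (hδ : 0 < δ) : ∀ᶠ n : ℕ in atTop, ∀ t ∈ Set.Icc (-(R : ℝ)) R,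
      |f t - gridPath R n (gridIncrement R n f) t| < δ := by
  filter_upwards [eventually_abs_sub_lt hf R hδ] with n hn t ht
  rw [gridPath_gridIncrement hf0]
  exact hn t ht _ (gridPoint_mem R n (gridIndex_le R n t)) (abs_sub_gridPoint_le ht)

lemma tendsto_toPath_gridPath {f : ℝ → ℝ} (hf : Continuous f) (hf0 : f 0 = 0) :
    Tendsto (fun n => toPath (gridPath n n (gridIncrement n n f))) atTop (𝓝 (toPath f)) := by
  refine tendsto_toPath fun R δ hδ => ?_
  filter_upwards [eventually_abs_sub_lt hf (R + 1) hδ, eventually_ge_atTop R] with n hn hRn t ht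
  have le_natCast : (R : ℝ) ≤ n := by exact_mod_cast hRn
  have dist_le := abs_sub_gridPoint_le (n := n) (t := t) (R := n)
    ⟨by linarith [ht.1], by linarith [ht.2]⟩
  have mesh_le_one : (1 : ℝ) / (n + 1) ≤ 1 := by
    rw [div_le_one (by positivity)]
    linarith [n.cast_nonneg (α := ℝ)]
  have dist_le_one := abs_le.1 (dist_le.trans mesh_le_one)
  rw [gridPath_gridIncrement hf0]
  push_cast at hn
  exact hn t ⟨by linarith [ht.1], by linarith [ht.2]⟩ _
    ⟨by linarith [ht.1], by linarith [ht.2]⟩ dist_le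

/-! ### Convergence in law by approximation -/

section Comparison

variable {Ω : Type*} [MeasurableSpace Ω] {P : Measure Ω} {f g : Ω → ℝ}

lemma abs_outerExpectation_sub_integral_le_integral [IsFiniteMeasure P] {M : ℝ} {e : Ω → ℝ}
    (hf : ∀ ω, |f ω| ≤ M) (hg : Integrable g P) (he : Integrable e P)
    (hfg : ∀ ω, |f ω - g ω| ≤ e ω) :
    |outerExpectation P f - ∫ ω, g ω ∂P| ≤ ∫ ω, e ω ∂P := by
  have lower : ∫ ω, (g ω - e ω) ∂P ≤ outerExpectation P f := by
    refine le_outerExpectation (fun ω => (abs_le.1 (hf ω)).2) fun k hk hfk => ?_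
    refine integral_mono (hg.sub he) hk fun ω => le_trans ?_ (hfk ω)
    linarith [(abs_le.1 (hfg ω)).1]
  have upper : outerExpectation P f ≤ ∫ ω, (g ω + e ω) ∂P :=
    outerExpectation_le (fun ω => (abs_le.1 (hf ω)).1) (hg.add he) fun ω => by
      linarith [(abs_le.1 (hfg ω)).2]
  rw [integral_sub hg he] at lower
  rw [integral_add hg he] at upper
  exact abs_le.2 ⟨by linarith, by linarith⟩

lemma abs_outerExpectation_sub_integral_le [IsProbabilityMeasure P] {M η : ℝ} {S : Set Ω}
    (hη : 0 ≤ η) (hf : ∀ ω, |f ω| ≤ M) (hg : ∀ ω, |g ω| ≤ M) (hgm : AEStronglyMeasurable g P)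
    (h : ∀ ω ∉ S, |f ω - g ω| ≤ η) :
    |outerExpectation P f - ∫ ω, g ω ∂P| ≤ η + 2 * M * P.real S := by
  let T := toMeasurable P S
  have measurableSet_T : MeasurableSet T := measurableSet_toMeasurable P S
  have integrable_indicator : Integrable (T.indicator fun _ => 2 * M) P :=
    (integrable_const _).indicator measurableSet_T
  have abs_sub_le (ω : Ω) : |f ω - g ω| ≤ η + T.indicator (fun _ => 2 * M) ω := by
    by_cases hω : ω ∈ T
    · rw [Set.indicator_of_mem hω]
      linarith [abs_sub (f ω) (g ω), hf ω, hg ω]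
    · rw [Set.indicator_of_notMem hω, add_zero]
      exact h ω fun hS => hω (subset_toMeasurable P S hS)
  calc |outerExpectation P f - ∫ ω, g ω ∂P|
      ≤ ∫ ω, (η + T.indicator (fun _ => 2 * M) ω) ∂P :=
        abs_outerExpectation_sub_integral_le_integral hf
          ((integrable_const M).mono' hgm (.of_forall hg))
          ((integrable_const η).add integrable_indicator) abs_sub_le
    _ = η + 2 * M * P.real S := by
        rw [integral_add (integrable_const η) integrable_indicator,
          integral_indicator_const _ measurableSet_T]
        simp [T, measureReal_def, measure_toMeasurable, mul_comm]

lemma eventually_abs_integral_sub_le_two_mul [IsProbabilityMeasure P] {g : ℕ → Ω → ℝ}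
    {M η : ℝ} (hη : 0 < η)
    (hf : ∀ ω, |f ω| ≤ M) (hg : ∀ n ω, |g n ω| ≤ M) (hfm : AEStronglyMeasurable f P)
    (hgm : ∀ n, AEStronglyMeasurable (g n) P)
    (hfg : ∀ᵐ ω ∂P, ∀ᶠ n in atTop, |f ω - g n ω| ≤ η) :
    ∀ᶠ n in atTop, |∫ ω, f ω ∂P - ∫ ω, g n ω ∂P| ≤ 2 * η := by
  have integrable_f : Integrable f P := (integrable_const M).mono' hfm (.of_forall hf)
  have integrable_g (n : ℕ) : Integrable (g n) P :=
    (integrable_const M).mono' (hgm n) (.of_forall (hg n))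
  let D (n : ℕ) (ω : Ω) : ℝ := max η |f ω - g n ω|
  have D_measurable (n : ℕ) : AEStronglyMeasurable (D n) P :=
    aestronglyMeasurable_const.sup (hfm.sub (hgm n)).norm
  have D_le (n : ℕ) (ω : Ω) : ‖D n ω‖ ≤ η + (M + M) := by
    have M_nonneg : 0 ≤ M := (abs_nonneg _).trans (hf ω)
    rw [Real.norm_of_nonneg (hη.le.trans (le_max_left _ _))]
    exact max_le (by linarith) (by linarith [abs_sub (f ω) (g n ω), hf ω, hg n ω])
  have tendsto_D : Tendsto (fun n => ∫ ω, D n ω ∂P) atTop (𝓝 (∫ _, η ∂P)) := by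
    refine tendsto_integral_of_dominated_convergence (fun _ => η + (M + M)) D_measurable
      (integrable_const _) (fun n => .of_forall (D_le n)) ?_
    filter_upwards [hfg] with ω hω
    refine tendsto_const_nhds.congr' ?_
    filter_upwards [hω] with n hn
    exact (max_eq_left hn).symm
  simp only [integral_const, probReal_univ, one_smul] at tendsto_D
  filter_upwards [tendsto_D.eventually_le_const (show η < 2 * η by linarith)] with n hn
  rw [← integral_sub integrable_f (integrable_g n)]
  refine abs_integral_le_integral_abs.trans (le_trans ?_ hn)
  exact integral_mono (integrable_f.sub (integrable_g n)).abs
    ((integrable_const _).mono' (D_measurable n) (.of_forall (D_le n))) fun ω => le_max_right _ _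

end Comparison

section Approximation

variable {Ω : ℝ → Type*} [∀ ε, MeasurableSpace (Ω ε)] {P : ∀ ε, Measure (Ω ε)}
  [∀ ε, IsProbabilityMeasure (P ε)] {X : ∀ ε, Ω ε → ℝ → ℝ}
  {Ω' : Type*} [MeasurableSpace Ω'] {P' : Measure Ω'} [IsProbabilityMeasure P'] {Y : Ω' → ℝ → ℝ}

theorem tendstoInLaw_of_approximation {Z : ℕ → ℕ → ∀ ε, Ω ε → ℝ → ℝ} {Y' : ℕ → ℕ → Ω' → ℝ → ℝ}
    (hY : AEStronglyMeasurable (fun ω => toPath (Y ω)) P')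
    (hY' : ∀ R n, AEStronglyMeasurable (fun ω => toPath (Y' R n ω)) P')
    (hZ : ∀ R n, ∀ᶠ ε in 𝓝[>] 0, AEStronglyMeasurable (fun ω => toPath (Z R n ε ω)) (P ε))
    (hZY' : ∀ R n (F : PathSpace →ᵇ ℝ),
      Tendsto (fun ε => ∫ ω, F (toPath (Z R n ε ω)) ∂(P ε)) (𝓝[>] 0)
        (𝓝 (∫ ω, F (toPath (Y' R n ω)) ∂P')))
    (hYY' : ∀ (R : ℕ), ∀ δ > 0, ∀ᵐ ω ∂P', ∀ᶠ n in atTop,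
      ∀ t ∈ Set.Icc (-(R : ℝ)) R, |Y ω t - Y' R n ω t| < δ)
    (hXZ : ∀ (R : ℕ), ∀ δ > 0, ∀ η > 0, ∀ᶠ n in atTop, ∀ᶠ ε in 𝓝[>] 0,
      (P ε).real {ω | ∃ t ∈ Set.Icc (-(R : ℝ)) R, δ ≤ |X ε ω t - Z R n ε ω t|} ≤ η) :
    TendstoInLaw P X P' Y := by
  refine ⟨hY, tendsto_outerExpectation_of_uniformContinuous (X := fun ε ω => toPath (X ε ω)) hY
    fun F hFu => Metric.tendsto_nhds.2 fun θ hθ => ?_⟩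
  obtain ⟨η, hη, mul_lt⟩ := exists_pos_mul_lt hθ (4 + 2 * ‖F‖)
  obtain ⟨R, δ, hδ, abs_sub_le⟩ := exists_abs_sub_le_of_uniformContinuous hFu hη
  have limits_close : ∀ᶠ n in atTop,
      |∫ ω, F (toPath (Y ω)) ∂P' - ∫ ω, F (toPath (Y' R n ω)) ∂P'| ≤ 2 * η := by
    refine eventually_abs_integral_sub_le_two_mul hη (fun ω => F.norm_coe_le_norm _)
      (fun n ω => F.norm_coe_le_norm _) (F.continuous.comp_aestronglyMeasurable hY)
      (fun n => F.continuous.comp_aestronglyMeasurable (hY' R n)) ?_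
    filter_upwards [hYY' R δ hδ] with ω hω
    exact hω.mono fun n hn => abs_sub_le _ _ hn
  obtain ⟨n, limit_close, process_close⟩ := (limits_close.and (hXZ R δ hδ η hη)).exists
  filter_upwards [process_close, hZ R n, Metric.tendsto_nhds.1 (hZY' R n F) η hη]
    with ε exceptional_le measurable_Z integral_close
  have outer_close := abs_outerExpectation_sub_integral_le
    (S := {ω | ∃ t ∈ Set.Icc (-(R : ℝ)) R, δ ≤ |X ε ω t - Z R n ε ω t|}) hη.le (M := ‖F‖)
    (f := fun ω => F (toPath (X ε ω))) (g := fun ω => F (toPath (Z R n ε ω)))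
    (fun ω => F.norm_coe_le_norm _) (fun ω => F.norm_coe_le_norm _)
    (F.continuous.comp_aestronglyMeasurable measurable_Z) fun ω hω =>
      abs_sub_le _ _ fun t ht => not_le.1 fun hle => hω ⟨t, ht, hle⟩
  have exceptional_mul_le := mul_le_mul_of_nonneg_left exceptional_le
    (mul_nonneg zero_le_two (norm_nonneg F))
  rw [Real.dist_eq] at integral_close ⊢
  rw [abs_le] at outer_close limit_close
  rw [abs_lt] at integral_close ⊢
  constructor <;> linarith

end Approximation

/-! ### Time changed Brownian motion -/

section Brownian

variable {Ω' : Type*} [MeasurableSpace Ω'] {P' : Measure Ω'}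
  {W : ℝ → Ω' → ℝ} {G : ℝ → ℝ}

lemma IsTwoSidedBrownian.aemeasurable_sub (hW : IsTwoSidedBrownian P' W) (s t : ℝ) :
    AEMeasurable (fun ω => W t ω - W s ω) P' := by
  rcases le_total s t with h | h
  · exact (hW.hasLaw_increment s t h).aemeasurable
  · exact (hW.hasLaw_increment t s h).aemeasurable.neg.congr (.of_forall fun ω => neg_sub _ _)

lemma IsTwoSidedBrownian.aemeasurable_gridIncrement (hW : IsTwoSidedBrownian P' W) (R n : ℕ) :
    AEMeasurable (fun ω => gridIncrement R n fun t => W (G t) ω) P' :=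
  aemeasurable_pi_lambda _ fun _ => hW.aemeasurable_sub _ _

lemma IsTwoSidedBrownian.ae_continuous (hW : IsTwoSidedBrownian P' W) (hG : Continuous G)
    (hG0 : G 0 = 0) : ∀ᵐ ω ∂P', (Continuous fun t => W (G t) ω) ∧ W (G 0) ω = 0 := by
  filter_upwards [hW.continuous_paths, hW.zero] with ω continuous_path zero
  exact ⟨continuous_path.comp hG, by rw [hG0, zero]⟩

lemma IsTwoSidedBrownian.aestronglyMeasurable_toPath (hW : IsTwoSidedBrownian P' W)
    (hG : Continuous G) (hG0 : G 0 = 0) :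
    AEStronglyMeasurable (fun ω => toPath fun t => W (G t) ω) P' := by
  let _ := UniformSpace.pseudoMetricSpace PathSpace
  refine aestronglyMeasurable_of_tendsto_ae atTop
    (f := fun n ω => toPath (gridPath n n (gridIncrement n n fun t => W (G t) ω))) (fun n => ?_) ?_
  · exact (continuous_toPath_gridPath n n).comp_aestronglyMeasurable
      (hW.aemeasurable_gridIncrement n n).aestronglyMeasurable
  · filter_upwards [hW.ae_continuous hG hG0] with ω hω
    exact tendsto_toPath_gridPath hω.1 hω.2

lemma IsTwoSidedBrownian.map_gridIncrement [IsProbabilityMeasure P'] (hW : IsTwoSidedBrownian P' W)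
    (hG : Monotone G) (R n : ℕ) :
    P'.map (fun ω => gridIncrement R n fun t => W (G t) ω) =
      Measure.pi fun j => gaussianReal 0 (gridIncrement R n G j).toNNReal := by
  have indep := hW.indep_increments (gridSize R n) (fun j => G (gridPoint R n j))
    (hG.comp ((gridPoint_mono R n).comp Fin.val_strictMono.monotone))
  rw [iIndepFun_iff_map_fun_eq_pi_map fun j => hW.aemeasurable_sub _ _] at indep
  refine indep.trans (congrArg Measure.pi (funext fun j => ?_))
  exact (hW.hasLaw_increment _ _ (hG (gridPoint_mono R n (Nat.le_succ j)))).map_eq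

end Brownian

/-! ### Fluctuations along a pair of sweeps -/

section PairIncrement

variable {α : Type*} {c d : α → ℝ} {J K : ℝ → Set α}

lemma increment_add_increment (a b e : ℝ) (p : α) :
    increment c J a b p + increment c J b e p = increment c J a e p := by
  unfold increment
  ring

lemma neg_increment (a b : ℝ) : -increment c J a b = increment c J b a := by
  ext p
  simp only [increment, Pi.neg_apply]
  ring

lemma increment_eq_zero {p : α} (hp : c p = 0) (a b : ℝ) : increment c J a b p = 0 := by
  simp [increment, hp]

/-- The sum of the increments of two weighted families of sets. -/
def pairIncrement (c : α → ℝ) (J : ℝ → Set α) (d : α → ℝ) (K : ℝ → Set α) (a b : ℝ) (p : α) : ℝ :=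
  increment c J a b p + increment d K a b p

lemma pairIncrement_sq_comm (a b : ℝ) (p : α) :
    pairIncrement c J d K a b p ^ 2 = pairIncrement c J d K b a p ^ 2 := by
  unfold pairIncrement increment
  ring

variable [MeasurableSpace α] {μ κ : Measure α}

lemma IsSweep.increment_sq_add (hJ : IsSweep J) {a b e : ℝ} (hab : a ≤ b) (hbe : b ≤ e) (p : α) :
    increment c J a b p ^ 2 + increment c J b e p ^ 2 = increment c J a e p ^ 2 := by
  rw [← increment_add_increment a b e]
  rcases hJ.increment_eq_zero_or (c := c) hab le_rfl hbe p with hp | hp <;> simp [hp]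

lemma exists_natCast_abs_le_and_abs_le (a b : ℝ) : ∃ R : ℕ, |a| ≤ R ∧ |b| ≤ R := by
  obtain ⟨R, hR⟩ := exists_nat_ge (max |a| |b|)
  exact ⟨R, (le_max_left _ _).trans hR, (le_max_right _ _).trans hR⟩

lemma IsSweep.isTestFunction_increment_of_forall (hJ : IsSweep J)
    (h : ∀ R : ℕ, IsTestFunction μ (increment c J (-R) R)) {a b : ℝ} (hab : a ≤ b) :
    IsTestFunction μ (increment c J a b) := by
  obtain ⟨R, ha, hb⟩ := exists_natCast_abs_le_and_abs_le a b
  exact hJ.isTestFunction_increment (abs_le.1 ha).1 hab (abs_le.1 hb).2 (h R)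

lemma IsSweep.integrable_increment (hJ : IsSweep J)
    (h : ∀ R : ℕ, Integrable (increment c J (-R) R) κ) (a b : ℝ) :
    Integrable (increment c J a b) κ := by
  wlog hab : a ≤ b generalizing a b
  · rw [← neg_increment]
    exact (this b a (le_of_not_ge hab)).neg
  obtain ⟨R, ha, hb⟩ := exists_natCast_abs_le_and_abs_le a b
  rw [hJ.increment_eq_indicator (abs_le.1 ha).1 hab (abs_le.1 hb).2]
  exact (h R).indicator ((hJ.measurableSet b).diff (hJ.measurableSet a))

/-- Two sweeps whose weights are nowhere simultaneously non-zero and whose increments over bounded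
intervals are test functions. -/
structure IsSweepPair (μ : Measure α) (c : α → ℝ) (J : ℝ → Set α) (d : α → ℝ) (K : ℝ → Set α) :
    Prop where
  fst : IsSweep J
  snd : IsSweep K
  eq_zero_or : ∀ p, c p = 0 ∨ d p = 0
  isTestFunction_fst : ∀ R : ℕ, IsTestFunction μ (increment c J (-R) R)
  isTestFunction_snd : ∀ R : ℕ, IsTestFunction μ (increment d K (-R) R)

namespace IsSweepPair

lemma isTestFunction_pairIncrement (h : IsSweepPair μ c J d K) {a b : ℝ} (hab : a ≤ b) :
    IsTestFunction μ (pairIncrement c J d K a b) :=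
  (h.fst.isTestFunction_increment_of_forall h.isTestFunction_fst hab).add
    (h.snd.isTestFunction_increment_of_forall h.isTestFunction_snd hab)

lemma pairIncrement_sq (h : IsSweepPair μ c J d K) (a b : ℝ) (p : α) :
    pairIncrement c J d K a b p ^ 2 = increment c J a b p ^ 2 + increment d K a b p ^ 2 := by
  unfold pairIncrement
  rcases h.eq_zero_or p with hp | hp <;> simp [increment_eq_zero hp]

lemma pairIncrement_sq_add (h : IsSweepPair μ c J d K) {a b e : ℝ} (hab : a ≤ b) (hbe : b ≤ e)
    (p : α) :
    pairIncrement c J d K a b p ^ 2 + pairIncrement c J d K b e p ^ 2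
      = pairIncrement c J d K a e p ^ 2 := by
  simp only [h.pairIncrement_sq, ← h.fst.increment_sq_add hab hbe, ← h.snd.increment_sq_add hab hbe]
  ring

lemma integrable_pairIncrement_sq (h : IsSweepPair μ c J d K) (a b : ℝ) :
    Integrable (fun p => pairIncrement c J d K a b p ^ 2) μ := by
  rcases le_total a b with hab | hba
  · exact (h.isTestFunction_pairIncrement hab).integrable_sq
  · simp only [pairIncrement_sq_comm a b]
    exact (h.isTestFunction_pairIncrement hba).integrable_sq

lemma integral_pairIncrement_sq_add (h : IsSweepPair μ c J d K) {a b e : ℝ} (hab : a ≤ b)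
    (hbe : b ≤ e) :
    ∫ p, pairIncrement c J d K a b p ^ 2 ∂μ + ∫ p, pairIncrement c J d K b e p ^ 2 ∂μ
      = ∫ p, pairIncrement c J d K a e p ^ 2 ∂μ := by
  rw [← integral_add (h.integrable_pairIncrement_sq a b) (h.integrable_pairIncrement_sq b e)]
  simp only [h.pairIncrement_sq_add hab hbe]

lemma tendsto_integral_pairIncrement_sq (h : IsSweepPair μ c J d K) {t : ℝ}
    (ht : ∀ᵐ p ∂μ, ∀ᶠ u in 𝓝 t, pairIncrement c J d K t u p = 0) :
    Tendsto (fun u => ∫ p, pairIncrement c J d K t u p ^ 2 ∂μ) (𝓝 t) (𝓝 0) := by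
  rw [← integral_zero α ℝ (μ := μ)]
  refine tendsto_integral_filter_of_dominated_convergence
    (fun p => pairIncrement c J d K (t - 1) (t + 1) p ^ 2)
    (.of_forall fun u => (h.integrable_pairIncrement_sq t u).aestronglyMeasurable) ?_
    (h.integrable_pairIncrement_sq _ _) ?_
  · filter_upwards [Icc_mem_nhds (sub_one_lt t) (lt_add_one t)] with u hu
    refine .of_forall fun p => ?_
    rw [Real.norm_of_nonneg (sq_nonneg _)]
    rcases le_total t u with htu | hut
    · linarith [h.pairIncrement_sq_add (sub_one_lt t).le (htu.trans hu.2) p,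
        h.pairIncrement_sq_add htu hu.2 p, sq_nonneg (pairIncrement c J d K (t - 1) t p),
        sq_nonneg (pairIncrement c J d K u (t + 1) p)]
    · rw [pairIncrement_sq_comm]
      linarith [h.pairIncrement_sq_add (hu.1.trans hut) (lt_add_one t).le p,
        h.pairIncrement_sq_add hu.1 hut p, sq_nonneg (pairIncrement c J d K (t - 1) u p),
        sq_nonneg (pairIncrement c J d K t (t + 1) p)]
  · filter_upwards [ht] with p hp
    exact tendsto_const_nhds.congr' (hp.mono fun u hu => by simp [hu])

lemma integral_increment_sq_le (h : IsSweepPair μ c J d K) {a b : ℝ} (hab : a ≤ b) :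
    ∫ p, increment c J a b p ^ 2 ∂μ ≤ ∫ p, pairIncrement c J d K a b p ^ 2 ∂μ ∧
      ∫ p, increment d K a b p ^ 2 ∂μ ≤ ∫ p, pairIncrement c J d K a b p ^ 2 ∂μ := by
  have fst_sq := (h.fst.isTestFunction_increment_of_forall h.isTestFunction_fst hab).integrable_sq
  have snd_sq := (h.snd.isTestFunction_increment_of_forall h.isTestFunction_snd hab).integrable_sq
  simp_rw [h.pairIncrement_sq]
  exact ⟨integral_mono fst_sq (fst_sq.add snd_sq) fun p => le_add_of_nonneg_right (sq_nonneg _),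
    integral_mono snd_sq (fst_sq.add snd_sq) fun p => le_add_of_nonneg_left (sq_nonneg _)⟩

lemma pairwise_pairIncrement_eq_zero_or (h : IsSweepPair μ c J d K) {q : ℕ → ℝ} (hq : Monotone q) :
    Pairwise fun i j => ∀ p, pairIncrement c J d K (q i) (q (i + 1)) p = 0 ∨
      pairIncrement c J d K (q j) (q (j + 1)) p = 0 := by
  intro i j hij p
  unfold pairIncrement
  rcases h.eq_zero_or p with hp | hp
  · simpa [increment_eq_zero hp] using h.snd.pairwise_increment_eq_zero_or hq hij p
  · simpa [increment_eq_zero hp] using h.fst.pairwise_increment_eq_zero_or hq hij p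

lemma integrable_pairIncrement (h : IsSweepPair μ c J d K)
    (hκc : ∀ R : ℕ, Integrable (increment c J (-R) R) κ)
    (hκd : ∀ R : ℕ, Integrable (increment d K (-R) R) κ) (a b : ℝ) :
    Integrable (pairIncrement c J d K a b) κ :=
  (h.fst.integrable_increment hκc a b).add (h.snd.integrable_increment hκd a b)

section Fluctuation

variable {ε : ℝ} (hκc : ∀ R : ℕ, Integrable (increment c J (-R) R) κ)
  (hκd : ∀ R : ℕ, Integrable (increment d K (-R) R) κ)

include hκc hκd

lemma fluctuation_pairIncrement (h : IsSweepPair μ c J d K) (a b : ℝ) :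
    fluctuation μ ε κ (pairIncrement c J d K a b)
      = fluctuation μ ε κ (increment c J a b) + fluctuation μ ε κ (increment d K a b) :=
  fluctuation_add (h.fst.integrable_increment (fun R => (h.isTestFunction_fst R).integrable) a b)
    (h.snd.integrable_increment (fun R => (h.isTestFunction_snd R).integrable) a b)
    (h.fst.integrable_increment hκc a b) (h.snd.integrable_increment hκd a b)

lemma fluctuation_pairIncrement_sub (h : IsSweepPair μ c J d K) (a b e : ℝ) :
    fluctuation μ ε κ (pairIncrement c J d K a e) - fluctuation μ ε κ (pairIncrement c J d K a b)
      = fluctuation μ ε κ (pairIncrement c J d K b e) := by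
  have integrable_mean := h.integrable_pairIncrement (fun R => (h.isTestFunction_fst R).integrable)
    fun R => (h.isTestFunction_snd R).integrable
  have integrable_sample := h.integrable_pairIncrement hκc hκd
  rw [sub_eq_iff_eq_add', ← fluctuation_add (integrable_mean a b) (integrable_mean b e)
    (integrable_sample a b) (integrable_sample b e)]
  congr 1
  ext p
  simp only [pairIncrement, ← increment_add_increment a b e p]
  ring

lemma gridPath_fluctuation (h : IsSweepPair μ c J d K) (R n : ℕ) (t : ℝ) :
    gridPath R n (fun j => fluctuation μ ε κ
        (pairIncrement c J d K (gridPoint R n j) (gridPoint R n (j + 1)))) t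
      = fluctuation μ ε κ (pairIncrement c J d K 0 (gridPoint R n (gridIndex R n t))) := by
  have vanishes_at_zero : fluctuation μ ε κ (pairIncrement c J d K 0 0) = 0 := by
    simp [fluctuation, pairIncrement, increment]
  rw [← gridPath_gridIncrement
    (f := fun t => fluctuation μ ε κ (pairIncrement c J d K 0 t)) vanishes_at_zero]
  congr 2
  ext j
  exact (h.fluctuation_pairIncrement_sub hκc hκd _ _ _).symm

lemma abs_sub_gridPath_fluctuation_le (h : IsSweepPair μ c J d K) {δ : ℝ} (hδ : 0 ≤ δ) {R n : ℕ}
    (hosc : ∀ j < gridSize R n, ∀ t ∈ Set.Icc (gridPoint R n j) (gridPoint R n (j + 1)),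
      |fluctuation μ ε κ (pairIncrement c J d K (gridPoint R n j) t)| ≤ δ)
    {t : ℝ} (ht : t ∈ Set.Icc (-(R : ℝ)) R) :
    |fluctuation μ ε κ (pairIncrement c J d K 0 t) - gridPath R n (fun j => fluctuation μ ε κ
        (pairIncrement c J d K (gridPoint R n j) (gridPoint R n (j + 1)))) t| ≤ δ := by
  rw [h.gridPath_fluctuation hκc hκd]
  rcases gridIndex_spec (n := n) ht with ⟨index_lt, mem_cell⟩ | eq_gridPoint
  · rw [h.fluctuation_pairIncrement_sub hκc hκd]
    exact hosc _ index_lt t mem_cell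
  · rwa [← eq_gridPoint, sub_self, abs_zero]

end Fluctuation

end IsSweepPair

end PairIncrement

section PairLimit

variable {c d : MarkedLine → ℝ} {J K : ℝ → Set MarkedLine} {μ : Measure MarkedLine}
  {Ω : ℝ → Type*} [∀ ε, MeasurableSpace (Ω ε)] {P : ∀ ε, Measure (Ω ε)}
  {N : ∀ ε, Ω ε → Measure MarkedLine}

lemma IsSweepPair.ae_forall_integrable_increment (h : IsSweepPair μ c J d K) {ε : ℝ}
    (hN : IsPoissonProcess (P ε) (N ε) (ENNReal.ofReal ε⁻¹ • μ)) :
    ∀ᵐ ω ∂(P ε), (∀ R : ℕ, Integrable (increment c J (-R) R) (N ε ω)) ∧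
      ∀ R : ℕ, Integrable (increment d K (-R) R) (N ε ω) :=
  (ae_all_iff.2 fun R => (h.isTestFunction_fst R).ae_integrable hN).and
    (ae_all_iff.2 fun R => (h.isTestFunction_snd R).ae_integrable hN)

variable [∀ ε, IsProbabilityMeasure (P ε)]

lemma IsSweep.eventually_measureReal_exists_gt_le (hJ : IsSweep J)
    (hN : ∀ ε : ℝ, 0 < ε → IsPoissonProcess (P ε) (N ε) (ENNReal.ofReal ε⁻¹ • μ))
    {s u : ℝ} (hsu : s ≤ u) (hh : IsTestFunction μ (increment c J s u)) {δ η v : ℝ} (hδ : 0 < δ)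
    (hη : 0 < η) (hv : ∫ p, increment c J s u p ^ 2 ∂μ ≤ v) (hvδ : 96 * v ≤ δ ^ 2) :
    ∀ᶠ ε in 𝓝[>] 0,
      (P ε).real {ω | ∃ t ∈ Set.Icc s u, 2 * δ < |fluctuation μ ε (N ε ω) (increment c J s t)|}
        ≤ 2 * ((∫ x, x ^ 4 ∂(gaussianReal 0 1)) * v ^ 2 / δ ^ 4) + η := by
  have tail_mono : (∫ x, x ^ 4 ∂(gaussianReal 0 1)) * (∫ p, increment c J s u p ^ 2 ∂μ) ^ 2 / δ ^ 4
      ≤ (∫ x, x ^ 4 ∂(gaussianReal 0 1)) * v ^ 2 / δ ^ 4 := by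
    gcongr
  filter_upwards [hh.eventually_measureReal_fluctuation_gt_le hN hδ (half_pos hη),
    self_mem_nhdsWithin] with ε endpoint_le hε
  have maximal := hJ.measureReal_exists_gt_le hε (hN ε hε) hsu hh hδ <| by
    rw [div_le_iff₀ (by positivity)]
    linarith
  linarith

namespace IsSweepPair

lemma eventually_measureReal_exists_gt_le (h : IsSweepPair μ c J d K)
    (hN : ∀ ε : ℝ, 0 < ε → IsPoissonProcess (P ε) (N ε) (ENNReal.ofReal ε⁻¹ • μ))
    {s u : ℝ} (hsu : s ≤ u) {δ η v : ℝ} (hδ : 0 < δ) (hη : 0 < η)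
    (hv : ∫ p, pairIncrement c J d K s u p ^ 2 ∂μ = v) (hvδ : 96 * v ≤ δ ^ 2) :
    ∀ᶠ ε in 𝓝[>] 0, (P ε).real
        {ω | ∃ t ∈ Set.Icc s u, 4 * δ < |fluctuation μ ε (N ε ω) (pairIncrement c J d K s t)|}
      ≤ 4 * ((∫ x, x ^ 4 ∂(gaussianReal 0 1)) * v ^ 2 / δ ^ 4) + η := by
  obtain ⟨fst_le, snd_le⟩ := h.integral_increment_sq_le hsu
  filter_upwards [h.fst.eventually_measureReal_exists_gt_le hN hsu
      (h.fst.isTestFunction_increment_of_forall h.isTestFunction_fst hsu) hδ (half_pos hη)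
      (fst_le.trans_eq hv) hvδ,
    h.snd.eventually_measureReal_exists_gt_le hN hsu
      (h.snd.isTestFunction_increment_of_forall h.isTestFunction_snd hsu) hδ (half_pos hη)
      (snd_le.trans_eq hv) hvδ, self_mem_nhdsWithin] with ε fst_osc snd_osc hε
  let oscillates (e : MarkedLine → ℝ) (L : ℝ → Set MarkedLine) : Set (Ω ε) :=
    {ω | ∃ t ∈ Set.Icc s u, 2 * δ < |fluctuation μ ε (N ε ω) (increment e L s t)|}
  have subset_union : ({ω | ∃ t ∈ Set.Icc s u,
      4 * δ < |fluctuation μ ε (N ε ω) (pairIncrement c J d K s t)|} : Set (Ω ε))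
      ≤ᵐ[P ε] (oscillates c J ∪ oscillates d K : Set (Ω ε)) := by
    filter_upwards [h.ae_forall_integrable_increment (hN ε hε)] with ω ⟨hc, hd⟩ ⟨t, ht, lt_abs⟩
    rw [h.fluctuation_pairIncrement hc hd] at lt_abs
    by_contra not_mem
    obtain ⟨hc, hd⟩ := not_or.1 not_mem
    have fst_le := not_lt.1 fun hlt => hc ⟨t, ht, hlt⟩
    have snd_le := not_lt.1 fun hlt => hd ⟨t, ht, hlt⟩
    linarith [abs_add_le (fluctuation μ ε (N ε ω) (increment c J s t))
      (fluctuation μ ε (N ε ω) (increment d K s t))]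
  have measureReal_le := (ENNReal.toReal_mono (measure_ne_top _ _)
    (measure_mono_ae subset_union)).trans (measureReal_union_le _ _)
  simp only [← measureReal_def] at measureReal_le
  linarith

variable {Ω' : Type*} [MeasurableSpace Ω'] {P' : Measure Ω'} [IsProbabilityMeasure P']
  {W : ℝ → Ω' → ℝ} {G : ℝ → ℝ} {X : ∀ ε, Ω ε → ℝ → ℝ}

lemma tendsto_integral_gridPath (h : IsSweepPair μ c J d K) (hW : IsTwoSidedBrownian P' W)
    (hN : ∀ ε : ℝ, 0 < ε → IsPoissonProcess (P ε) (N ε) (ENNReal.ofReal ε⁻¹ • μ))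
    (hGm : Monotone G)
    (hG : ∀ s t, s ≤ t → ∫ p, pairIncrement c J d K s t p ^ 2 ∂μ = G t - G s)
    (R n : ℕ) (F : PathSpace →ᵇ ℝ) :
    Tendsto (fun ε => ∫ ω, F (toPath (gridPath R n fun j => fluctuation μ ε (N ε ω)
        (pairIncrement c J d K (gridPoint R n j) (gridPoint R n (j + 1))))) ∂(P ε)) (𝓝[>] 0)
      (𝓝 (∫ ω, F (toPath (gridPath R n (gridIncrement R n fun t => W (G t) ω))) ∂P')) := by
  have cell_le (j : ℕ) : gridPoint R n j ≤ gridPoint R n (j + 1) := gridPoint_mono R n j.le_succ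
  have clt := tendsto_integral_fluctuation (ι := Fin (gridSize R n))
    (h := fun j => pairIncrement c J d K (gridPoint R n j) (gridPoint R n (j + 1))) hN
    (fun j => h.isTestFunction_pairIncrement (cell_le j))
    ((h.pairwise_pairIncrement_eq_zero_or (gridPoint_mono R n)).comp_of_injective
      Fin.val_injective)
    (F.compContinuous ⟨_, continuous_toPath_gridPath R n⟩)
  simp_rw [hG _ _ (cell_le _)] at clt
  change Tendsto _ _ (𝓝 (∫ x, _ ∂(Measure.pi fun j =>
    gaussianReal 0 (gridIncrement R n G j).toNNReal))) at clt
  rwa [← hW.map_gridIncrement hGm, integral_map (hW.aemeasurable_gridIncrement R n)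
    (BoundedContinuousFunction.continuous _).aestronglyMeasurable] at clt

lemma measureReal_exists_gridPath_le_sum (h : IsSweepPair μ c J d K) {ε δ : ℝ} (hδ : 0 ≤ δ)
    (hN : IsPoissonProcess (P ε) (N ε) (ENNReal.ofReal ε⁻¹ • μ))
    (hX : ∀ᵐ ω ∂(P ε), ∀ t, X ε ω t = fluctuation μ ε (N ε ω) (pairIncrement c J d K 0 t))
    (R n : ℕ) :
    (P ε).real {ω | ∃ t ∈ Set.Icc (-(R : ℝ)) R, δ < |X ε ω t -
        gridPath R n (fun j => fluctuation μ ε (N ε ω)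
          (pairIncrement c J d K (gridPoint R n j) (gridPoint R n (j + 1)))) t|}
      ≤ ∑ j : Fin (gridSize R n), (P ε).real
          {ω | ∃ t ∈ Set.Icc (gridPoint R n j) (gridPoint R n (j + 1)),
            δ < |fluctuation μ ε (N ε ω) (pairIncrement c J d K (gridPoint R n j) t)|} := by
  refine (ENNReal.toReal_mono (measure_ne_top _ _) (measure_mono_ae ?_)).trans
    (measureReal_iUnion_fintype_le _)
  filter_upwards [hX, h.ae_forall_integrable_increment hN] with ω hXω ⟨hc, hd⟩ ⟨t, ht, lt_abs⟩
  by_contra not_mem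
  have osc_le : ∀ j < gridSize R n, ∀ x ∈ Set.Icc (gridPoint R n j) (gridPoint R n (j + 1)),
      |fluctuation μ ε (N ε ω) (pairIncrement c J d K (gridPoint R n j) x)| ≤ δ :=
    fun j hj x hx => not_lt.1 fun hlt => not_mem (Set.mem_iUnion.2 ⟨⟨j, hj⟩, x, hx, hlt⟩)
  rw [hXω] at lt_abs
  exact lt_abs.not_ge (h.abs_sub_gridPath_fluctuation_le hc hd hδ osc_le ht)

lemma eventually_measureReal_exists_gridPath_le (h : IsSweepPair μ c J d K)
    (hN : ∀ ε : ℝ, 0 < ε → IsPoissonProcess (P ε) (N ε) (ENNReal.ofReal ε⁻¹ • μ))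
    (hG : ∀ s t, s ≤ t → ∫ p, pairIncrement c J d K s t p ^ 2 ∂μ = G t - G s)
    (hX : ∀ ε, 0 < ε → ∀ᵐ ω ∂(P ε), ∀ t,
      X ε ω t = fluctuation μ ε (N ε ω) (pairIncrement c J d K 0 t))
    {δ η : ℝ} (hδ : 0 < δ) (hη : 0 < η) {R n : ℕ}
    (hsmall : ∀ j, 96 * gridIncrement R n G j ≤ δ ^ 2) :
    ∀ᶠ ε in 𝓝[>] 0, (P ε).real {ω | ∃ t ∈ Set.Icc (-(R : ℝ)) R, 4 * δ < |X ε ω t -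
        gridPath R n (fun j => fluctuation μ ε (N ε ω)
          (pairIncrement c J d K (gridPoint R n j) (gridPoint R n (j + 1)))) t|}
      ≤ 4 * (∫ x, x ^ 4 ∂(gaussianReal 0 1)) / δ ^ 4 * ∑ j, gridIncrement R n G j ^ 2 + η := by
  have cell_bound : ∀ᶠ ε in 𝓝[>] 0, ∀ j : Fin (gridSize R n), (P ε).real
      {ω | ∃ t ∈ Set.Icc (gridPoint R n j) (gridPoint R n (j + 1)),
        4 * δ < |fluctuation μ ε (N ε ω) (pairIncrement c J d K (gridPoint R n j) t)|}
      ≤ 4 * ((∫ x, x ^ 4 ∂(gaussianReal 0 1)) * gridIncrement R n G j ^ 2 / δ ^ 4)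
        + η / (gridSize R n + 1) :=
    eventually_all.2 fun j => h.eventually_measureReal_exists_gt_le hN
      (gridPoint_mono R n j.val.le_succ) hδ (by positivity)
      (hG _ _ (gridPoint_mono R n j.val.le_succ)) (hsmall j)
  filter_upwards [cell_bound, self_mem_nhdsWithin] with ε cell_bound hε
  refine ((h.measureReal_exists_gridPath_le_sum (by positivity) (hN ε hε) (hX ε hε) R n).trans
    (Finset.sum_le_sum fun j _ => cell_bound j)).trans ?_
  rw [Finset.sum_add_distrib, Finset.mul_sum]
  refine add_le_add (Finset.sum_le_sum fun j _ => le_of_eq (by ring)) ?_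
  rw [Finset.sum_const, Finset.card_fin, nsmul_eq_mul, mul_div_assoc', div_le_iff₀ (by positivity)]
  linarith

/-- Since the variances of the cells add up to `G R - G (-R)`, the sum of their squares tends to
zero with the mesh. -/
lemma eventually_measureReal_exists_le_abs_sub_gridPath (h : IsSweepPair μ c J d K)
    (hN : ∀ ε : ℝ, 0 < ε → IsPoissonProcess (P ε) (N ε) (ENNReal.ofReal ε⁻¹ • μ))
    (hGm : Monotone G) (hGc : Continuous G)
    (hG : ∀ s t, s ≤ t → ∫ p, pairIncrement c J d K s t p ^ 2 ∂μ = G t - G s)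
    (hX : ∀ ε, 0 < ε → ∀ᵐ ω ∂(P ε), ∀ t,
      X ε ω t = fluctuation μ ε (N ε ω) (pairIncrement c J d K 0 t))
    (R : ℕ) {δ η : ℝ} (hδ : 0 < δ) (hη : 0 < η) :
    ∀ᶠ n in atTop, ∀ᶠ ε in 𝓝[>] 0,
      (P ε).real {ω | ∃ t ∈ Set.Icc (-(R : ℝ)) R, δ ≤ |X ε ω t -
        gridPath R n (fun j => fluctuation μ ε (N ε ω)
          (pairIncrement c J d K (gridPoint R n j) (gridPoint R n (j + 1)))) t|} ≤ η := by
  obtain ⟨δ, δ_pos, rfl⟩ : ∃ δ' > 0, δ = 5 * δ' := ⟨δ / 5, by positivity, by ring⟩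
  set C := 4 * (∫ x, x ^ 4 ∂(gaussianReal 0 1)) / δ ^ 4
  have C_nonneg : 0 ≤ C :=
    div_nonneg (mul_nonneg zero_le_four (integral_nonneg fun x => by positivity)) (by positivity)
  obtain ⟨θ, hθ, small_variance⟩ := exists_pos_mul_lt (lt_min (pow_pos δ_pos 2) (half_pos hη))
    (max 96 (C * (G R - G (-R))))
  rw [lt_min_iff] at small_variance
  filter_upwards [eventually_abs_gridIncrement_lt hGc R hθ] with n increment_lt
  have increment_le (j) : gridIncrement R n G j ≤ θ := (le_abs_self _).trans (increment_lt j).le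
  filter_upwards [h.eventually_measureReal_exists_gridPath_le hN hG hX δ_pos (half_pos hη)
    fun j => (mul_le_mul (le_max_left _ _) (increment_le j)
      (sub_nonneg.2 (hGm (gridPoint_mono R n j.val.le_succ))) (by positivity)).trans
        small_variance.1.le] with ε measure_le
  refine (measureReal_mono ?_).trans (measure_le.trans ?_)
  · rintro ω ⟨t, ht, dist_ge⟩
    exact ⟨t, ht, by linarith⟩
  · have sum_le : C * ∑ j, gridIncrement R n G j ^ 2 ≤ η / 2 := calc
      C * ∑ j, gridIncrement R n G j ^ 2 ≤ C * (θ * (G R - G (-R))) :=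
        mul_le_mul_of_nonneg_left (sum_gridIncrement_sq_le hGm increment_le) C_nonneg
      _ = C * (G R - G (-R)) * θ := by ring
      _ ≤ max 96 (C * (G R - G (-R))) * θ := by gcongr; exact le_max_right _ _
      _ ≤ η / 2 := small_variance.2.le
    linarith

theorem tendstoInLaw (h : IsSweepPair μ c J d K) (hW : IsTwoSidedBrownian P' W)
    (hN : ∀ ε : ℝ, 0 < ε → IsPoissonProcess (P ε) (N ε) (ENNReal.ofReal ε⁻¹ • μ))
    (hGm : Monotone G) (hGc : Continuous G) (hG0 : G 0 = 0)
    (hG : ∀ s t, s ≤ t → ∫ p, pairIncrement c J d K s t p ^ 2 ∂μ = G t - G s)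
    (hX : ∀ ε, 0 < ε → ∀ᵐ ω ∂(P ε), ∀ t,
      X ε ω t = fluctuation μ ε (N ε ω) (pairIncrement c J d K 0 t)) :
    TendstoInLaw P X P' fun ω t => W (G t) ω := by
  refine tendstoInLaw_of_approximation
    (Z := fun R n ε ω => gridPath R n fun j => fluctuation μ ε (N ε ω)
      (pairIncrement c J d K (gridPoint R n j) (gridPoint R n (j + 1))))
    (Y' := fun R n ω => gridPath R n (gridIncrement R n fun t => W (G t) ω))
    (hW.aestronglyMeasurable_toPath hGc hG0) (fun R n => ?_) (fun R n => ?_)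
    (h.tendsto_integral_gridPath hW hN hGm hG) (fun R δ hδ => ?_)
    fun R δ hδ η hη =>
      h.eventually_measureReal_exists_le_abs_sub_gridPath hN hGm hGc hG hX R hδ hη
  · exact (continuous_toPath_gridPath R n).comp_aestronglyMeasurable
      (hW.aemeasurable_gridIncrement R n).aestronglyMeasurable
  · filter_upwards [self_mem_nhdsWithin] with ε hε
    refine (continuous_toPath_gridPath R n).comp_aestronglyMeasurable
      (AEMeasurable.aestronglyMeasurable (aemeasurable_pi_lambda _ fun j => ?_))
    exact (h.isTestFunction_pairIncrement
      (gridPoint_mono R n j.val.le_succ)).aemeasurable_fluctuation (hN ε hε)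
  · filter_upwards [hW.ae_continuous hGc hG0] with ω hω
    exact eventually_abs_sub_gridPath_lt hω.1 hω.2 R hδ

end IsSweepPair

end PairLimit

/-! ### Lines crossed along a path -/

section Offset

/-- The horizontal displacement of a point from the line `p`. -/
def offset (p : MarkedLine) : ℝ × ℝ →ᵃ[ℝ] ℝ :=
  (LinearMap.fst ℝ ℝ ℝ - p.2.1 • LinearMap.snd ℝ ℝ ℝ).toAffineMap - AffineMap.const ℝ (ℝ × ℝ) p.1

lemma offset_apply (p : MarkedLine) (q : ℝ × ℝ) : offset p q = q.1 - (p.1 + q.2 * p.2.1) := by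
  simp [offset]
  ring

lemma mem_line_iff {p : MarkedLine} {q : ℝ × ℝ} : q ∈ line p ↔ offset p q = 0 := by
  simp only [line, Set.mem_range, offset_apply, sub_eq_zero, Prod.ext_iff]
  refine ⟨fun ⟨t, hx, ht⟩ => ?_, fun h => ⟨q.2, ?_, rfl⟩⟩
  · rw [← hx, ← ht, mul_comm]
  · rw [h, mul_comm]

lemma mem_rightHalf_iff {p : MarkedLine} {q : ℝ × ℝ} : q ∈ rightHalf p ↔ 0 ≤ offset p q := by
  simp [rightHalf, offset_apply]

lemma mem_leftHalf_iff {p : MarkedLine} {q : ℝ × ℝ} : q ∈ leftHalf p ↔ offset p q < 0 := by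
  simp [leftHalf, offset_apply]

lemma mem_linesMeeting_iff {p : MarkedLine} {a b : ℝ × ℝ} :
    p ∈ linesMeeting a b ↔ 0 ∈ Set.uIcc (offset p a) (offset p b) := by
  rw [← segment_eq_uIcc, ← image_segment]
  exact exists_congr fun q => and_comm.trans (and_congr_right' mem_line_iff)

lemma mem_linesMeeting_self {p : MarkedLine} {a : ℝ × ℝ} :
    p ∈ linesMeeting a a ↔ offset p a = 0 := by
  rw [mem_linesMeeting_iff, Set.uIcc_self, Set.mem_singleton_iff, eq_comm]

lemma measurable_offset (q : ℝ × ℝ) : Measurable fun p : MarkedLine => offset p q := by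
  simp only [offset_apply]
  fun_prop

lemma continuous_offset (p : MarkedLine) : Continuous (offset p) := by
  simp only [funext (offset_apply p)]
  fun_prop

lemma measurableSet_linesMeeting (a b : ℝ × ℝ) : MeasurableSet (linesMeeting a b) := by
  simp only [Set.ext fun _ => mem_linesMeeting_iff]
  exact (measurableSet_le ((measurable_offset a).min (measurable_offset b)) measurable_const).inter
    (measurableSet_le measurable_const ((measurable_offset a).max (measurable_offset b)))

end Offset

section MarkSq

variable {μ : Measure MarkedLine}

lemma integrableOn_mark_sq {A : Set MarkedLine} (hA : MeasurableSet A) (h : markSq μ A ≠ ∞) :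
    IntegrableOn (fun p => p.2.2 ^ 2) A μ := by
  rw [markSq, withDensity_apply _ hA] at h
  refine ⟨by fun_prop, ?_⟩
  rw [hasFiniteIntegral_iff_ofReal (.of_forall fun p => sq_nonneg _)]
  exact h.lt_top

lemma setIntegral_mark_sq {A : Set MarkedLine} (hA : MeasurableSet A) :
    ∫ p in A, p.2.2 ^ 2 ∂μ = (markSq μ A).toReal := by
  rw [integral_eq_lintegral_of_nonneg_ae (.of_forall fun p => sq_nonneg _) (by fun_prop), markSq,
    withDensity_apply _ hA]

lemma IsAdmissible.isTestFunction (hμ : IsAdmissible μ) {h : MarkedLine → ℝ} (hm : Measurable h)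
    {a b : ℝ × ℝ} (hle : ∀ p, |h p| ≤ (linesMeeting a b).indicator (fun p => |p.2.2|) p) :
    IsTestFunction μ h where
  measurable := hm
  support := by
    refine ne_top_of_le_ne_top (ENNReal.add_lt_top.1 (hμ a b)).1.ne (measure_mono fun p hp => ?_)
    by_contra not_mem
    have abs_le := hle p
    rw [Set.indicator_of_notMem not_mem] at abs_le
    exact hp (abs_nonpos_iff.1 abs_le)
  memLp := by
    have dominating := (integrable_indicator_iff (measurableSet_linesMeeting a b)).2
      (integrableOn_mark_sq (measurableSet_linesMeeting a b) (ENNReal.add_lt_top.1 (hμ a b)).2.ne)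
    refine (memLp_two_iff_integrable_sq hm.aestronglyMeasurable).2
      (dominating.mono' (hm.pow_const 2).aestronglyMeasurable (.of_forall fun p => ?_))
    have abs_le := hle p
    rw [Real.norm_of_nonneg (sq_nonneg _)]
    by_cases hp : p ∈ linesMeeting a b
    · rw [Set.indicator_of_mem hp] at abs_le ⊢
      exact sq_le_sq.2 abs_le
    · rw [Set.indicator_of_notMem hp] at abs_le ⊢
      simp [abs_nonpos_iff.1 abs_le]

lemma ae_mark_eq_zero_or_offset_ne_zero {q : ℝ × ℝ} (h : markSq μ (linesMeeting q q) = 0) :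
    ∀ᵐ p ∂μ, p.2.2 = 0 ∨ offset p q ≠ 0 := by
  rw [markSq, withDensity_apply _ (measurableSet_linesMeeting q q),
    lintegral_eq_zero_iff (by fun_prop)] at h
  filter_upwards [(ae_restrict_iff' (measurableSet_linesMeeting q q)).1 h] with p hp
  by_cases on_line : offset p q = 0
  · exact .inl (by simpa [sq_nonpos_iff] using hp (mem_linesMeeting_self.2 on_line))
  · exact .inr on_line

end MarkSq

section CrossingPair

section Sweep

variable {α : Type*} [MeasurableSpace α] {τ c : α → ℝ} {J : ℝ → Set α}

lemma isSweep_setOf_le (hτ : Measurable τ) : IsSweep fun t => {p | τ p ≤ t} where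
  mono _ _ hst _ hp := le_trans hp hst
  measurableSet _ := measurableSet_le hτ measurable_const
  eventually_mem_iff := .inl fun t p => by
    rcases le_or_gt (τ p) t with h | h
    · filter_upwards [self_mem_nhdsWithin] with x hx using iff_of_true (h.trans hx) h
    · filter_upwards [nhdsWithin_le_nhds (Iio_mem_nhds h)] with x hx
      exact iff_of_false (not_le.2 hx) (not_le.2 h)

lemma isSweep_setOf_lt (hτ : Measurable τ) : IsSweep fun t => {p | τ p < t} where
  mono _ _ hst _ hp := lt_of_lt_of_le hp hst
  measurableSet _ := measurableSet_lt hτ measurable_const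
  eventually_mem_iff := .inr fun t p => by
    rcases lt_or_ge (τ p) t with h | h
    · filter_upwards [nhdsWithin_le_nhds (Ioi_mem_nhds h)] with x hx using iff_of_true hx h
    · filter_upwards [self_mem_nhdsWithin] with x hx
      exact iff_of_false (not_lt.2 (le_trans hx h)) (not_lt.2 h)

lemma IsSweep.measurable_increment (hJ : IsSweep J) (hc : Measurable c) (a b : ℝ) :
    Measurable (increment c J a b) :=
  hc.mul ((measurable_one.indicator (hJ.measurableSet b)).sub
    (measurable_one.indicator (hJ.measurableSet a)))

end Sweep

variable {c d : MarkedLine → ℝ} {J K : ℝ → Set MarkedLine} {γ : ℝ → ℝ × ℝ} {μ : Measure MarkedLine}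

/-- Two weighted sweeps that together record, up to sign, the marks of the lines met by the chords
of the path `γ`. For lines through an end point of the chord only an upper bound is required, so
that the family may be continuous from either side. -/
structure IsCrossingPair (γ : ℝ → ℝ × ℝ) (c : MarkedLine → ℝ) (J : ℝ → Set MarkedLine)
    (d : MarkedLine → ℝ) (K : ℝ → Set MarkedLine) : Prop where
  measurable_fst : Measurable c
  measurable_snd : Measurable d
  fst : IsSweep J
  snd : IsSweep K
  eq_zero_or : ∀ p, c p = 0 ∨ d p = 0
  abs_le : ∀ s t p, |pairIncrement c J d K s t p|
    ≤ (linesMeeting (γ s) (γ t)).indicator (fun p => |p.2.2|) p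
  abs_eq : ∀ s t p, offset p (γ s) ≠ 0 → offset p (γ t) ≠ 0 → p ∈ linesMeeting (γ s) (γ t) →
    |pairIncrement c J d K s t p| = |p.2.2|

namespace IsCrossingPair

lemma isSweepPair (h : IsCrossingPair γ c J d K) (hμ : IsAdmissible μ) :
    IsSweepPair μ c J d K where
  fst := h.fst
  snd := h.snd
  eq_zero_or := h.eq_zero_or
  isTestFunction_fst R := by
    refine hμ.isTestFunction (h.fst.measurable_increment h.measurable_fst _ _) fun p =>
      le_trans ?_ (h.abs_le (-R) R p)
    rcases h.eq_zero_or p with hp | hp <;> simp [pairIncrement, increment_eq_zero hp]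
  isTestFunction_snd R := by
    refine hμ.isTestFunction (h.snd.measurable_increment h.measurable_snd _ _) fun p =>
      le_trans ?_ (h.abs_le (-R) R p)
    rcases h.eq_zero_or p with hp | hp <;> simp [pairIncrement, increment_eq_zero hp]

lemma pairIncrement_eq_zero (h : IsCrossingPair γ c J d K) {s t : ℝ} {p : MarkedLine}
    (hp : p.2.2 = 0 ∨ p ∉ linesMeeting (γ s) (γ t)) : pairIncrement c J d K s t p = 0 := by
  refine abs_nonpos_iff.1 ((h.abs_le s t p).trans_eq ?_)
  rcases hp with hp | hp <;> simp [Set.indicator, hp]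

lemma integral_pairIncrement_sq (h : IsCrossingPair γ c J d K)
    (hnull : ∀ t, markSq μ (linesMeeting (γ t) (γ t)) = 0) (s t : ℝ) :
    ∫ p, pairIncrement c J d K s t p ^ 2 ∂μ = (markSq μ (linesMeeting (γ s) (γ t))).toReal := by
  rw [← setIntegral_mark_sq (measurableSet_linesMeeting _ _),
    ← integral_indicator (measurableSet_linesMeeting _ _)]
  refine integral_congr_ae ?_
  filter_upwards [ae_mark_eq_zero_or_offset_ne_zero (hnull s),
    ae_mark_eq_zero_or_offset_ne_zero (hnull t)] with p hs ht
  by_cases mark_eq_zero : p.2.2 = 0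
  · simp [h.pairIncrement_eq_zero (.inl mark_eq_zero), Set.indicator, mark_eq_zero]
  by_cases hp : p ∈ linesMeeting (γ s) (γ t)
  · rw [Set.indicator_of_mem hp, sq_eq_sq_iff_abs_eq_abs]
    exact h.abs_eq s t p (hs.resolve_left mark_eq_zero) (ht.resolve_left mark_eq_zero) hp
  · simp [h.pairIncrement_eq_zero (.inr hp), Set.indicator_of_notMem hp]

lemma eventually_pairIncrement_eq_zero (h : IsCrossingPair γ c J d K) (hγ : Continuous γ) {t : ℝ}
    {p : MarkedLine} (hp : p.2.2 = 0 ∨ offset p (γ t) ≠ 0) :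
    ∀ᶠ u in 𝓝 t, pairIncrement c J d K t u p = 0 := by
  rcases hp with mark_eq_zero | off_line
  · exact .of_forall fun u => h.pairIncrement_eq_zero (.inl mark_eq_zero)
  have tendsto_offset := ((continuous_offset p).comp hγ).tendsto t
  rcases lt_or_gt_of_ne off_line with neg | pos
  · filter_upwards [tendsto_offset.eventually_lt_const neg] with u hu
    refine h.pairIncrement_eq_zero (.inr fun hmeet => ?_)
    exact (mem_linesMeeting_iff.1 hmeet).2.not_gt (max_lt neg hu)
  · filter_upwards [tendsto_offset.eventually_const_lt pos] with u hu
    refine h.pairIncrement_eq_zero (.inr fun hmeet => ?_)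
    exact (mem_linesMeeting_iff.1 hmeet).1.not_gt (lt_min pos hu)

end IsCrossingPair

end CrossingPair

section SignedClock

lemma sign_mul_sub_sign_mul {V : ℝ → ℝ → ℝ} (hsymm : ∀ s t, V s t = V t s)
    (hadd : ∀ s t u, s ≤ t → t ≤ u → V s t + V t u = V s u) {s t : ℝ} (hst : s ≤ t) :
    Real.sign t * V 0 t - Real.sign s * V 0 s = V s t := by
  have diag : V 0 0 = 0 := left_eq_add.1 (hadd 0 0 0 le_rfl le_rfl).symm
  have of_nonneg (t : ℝ) (ht : 0 ≤ t) : Real.sign t * V 0 t = V 0 t := by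
    rcases ht.eq_or_lt with rfl | pos
    · simp [diag]
    · rw [Real.sign_of_pos pos, one_mul]
  have of_nonpos (t : ℝ) (ht : t ≤ 0) : Real.sign t * V 0 t = -V t 0 := by
    rcases ht.eq_or_lt with rfl | neg
    · simp [diag]
    · rw [Real.sign_of_neg neg, neg_one_mul, hsymm]
  rcases le_total 0 s with hs | hs
  · rw [of_nonneg s hs, of_nonneg t (hs.trans hst), ← hadd 0 s t hs hst, add_sub_cancel_left]
  rcases le_total 0 t with ht | ht
  · rw [of_nonpos s hs, of_nonneg t ht, ← hadd s 0 t hs ht]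
    ring
  · rw [of_nonpos s hs, of_nonpos t ht, ← hadd s t 0 hst ht]
    ring

lemma continuous_sign_mul {V : ℝ → ℝ → ℝ} (hnonneg : ∀ s t, 0 ≤ V s t)
    (hsymm : ∀ s t, V s t = V t s) (hadd : ∀ s t u, s ≤ t → t ≤ u → V s t + V t u = V s u)
    (hlim : ∀ t, Tendsto (V t) (𝓝 t) (𝓝 0)) : Continuous fun t => Real.sign t * V 0 t := by
  refine continuous_iff_continuousAt.2 fun t => ?_
  rw [ContinuousAt, tendsto_iff_norm_sub_tendsto_zero]
  refine (hlim t).congr fun u => ?_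
  rw [Real.norm_eq_abs]
  rcases le_total t u with htu | hut
  · rw [sign_mul_sub_sign_mul hsymm hadd htu, abs_of_nonneg (hnonneg t u)]
  · rw [abs_sub_comm, sign_mul_sub_sign_mul hsymm hadd hut, abs_of_nonneg (hnonneg u t), hsymm]

end SignedClock

section PathLimit

variable {c d : MarkedLine → ℝ} {J K : ℝ → Set MarkedLine} {γ : ℝ → ℝ × ℝ} {μ : Measure MarkedLine}
  {Ω : ℝ → Type*} [∀ ε, MeasurableSpace (Ω ε)] {P : ∀ ε, Measure (Ω ε)}
  [∀ ε, IsProbabilityMeasure (P ε)] {N : ∀ ε, Ω ε → Measure MarkedLine}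
  {Ω' : Type*} [MeasurableSpace Ω'] {P' : Measure Ω'} [IsProbabilityMeasure P']
  {W : ℝ → Ω' → ℝ} {X : ∀ ε, Ω ε → ℝ → ℝ}

theorem IsCrossingPair.tendstoInLaw (h : IsCrossingPair γ c J d K) (hμ : IsAdmissible μ)
    (hW : IsTwoSidedBrownian P' W)
    (hN : ∀ ε : ℝ, 0 < ε → IsPoissonProcess (P ε) (N ε) (ENNReal.ofReal ε⁻¹ • μ))
    (hγ : Continuous γ) (hnull : ∀ t, markSq μ (linesMeeting (γ t) (γ t)) = 0)
    (hX : ∀ ε, 0 < ε → ∀ᵐ ω ∂(P ε), ∀ t,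
      X ε ω t = fluctuation μ ε (N ε ω) (pairIncrement c J d K 0 t)) :
    TendstoInLaw P X P' fun ω t =>
      W (Real.sign t * (markSq μ (linesMeeting (γ 0) (γ t))).toReal) ω := by
  have pair := h.isSweepPair hμ
  simp only [← h.integral_pairIncrement_sq hnull]
  let V (s t : ℝ) : ℝ := ∫ p, pairIncrement c J d K s t p ^ 2 ∂μ
  have V_nonneg (s t) : 0 ≤ V s t := integral_nonneg fun p => sq_nonneg _
  have V_symm (s t) : V s t = V t s := by simp only [V, pairIncrement_sq_comm s t]
  have V_add (s t u) (hst : s ≤ t) (htu : t ≤ u) : V s t + V t u = V s u :=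
    pair.integral_pairIncrement_sq_add hst htu
  have V_tendsto (t) : Tendsto (V t) (𝓝 t) (𝓝 0) :=
    pair.tendsto_integral_pairIncrement_sq <| (ae_mark_eq_zero_or_offset_ne_zero (hnull t)).mono
      fun p hp => h.eventually_pairIncrement_eq_zero hγ hp
  have V_eq_sub (s t) (hst : s ≤ t) : V s t = Real.sign t * V 0 t - Real.sign s * V 0 s :=
    (sign_mul_sub_sign_mul V_symm V_add hst).symm
  have monotone_clock : Monotone fun t => Real.sign t * V 0 t := fun s t hst =>
    sub_nonneg.1 ((V_nonneg s t).trans_eq (V_eq_sub s t hst))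
  exact pair.tendstoInLaw hW hN monotone_clock
    (continuous_sign_mul V_nonneg V_symm V_add V_tendsto) (by simp) V_eq_sub hX

end PathLimit

/-! ### Quasi-particles and mass -/

section Crossing

variable {S : Set ℝ} {a b : ℝ × ℝ} {p : MarkedLine}

/-- The mark of a line, counted positively if the displacement from the line enters `S` between `a`
and `b` and negatively if it leaves `S`. Taking `S` to be `Set.Ici 0` or `Set.Ioi 0` decides on
which side of a line its own points lie. -/
def crossing (S : Set ℝ) (a b : ℝ × ℝ) (p : MarkedLine) : ℝ :=
  p.2.2 * (S.indicator 1 (offset p b) - S.indicator 1 (offset p a))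

lemma crossing_add_crossing (S : Set ℝ) (a b e : ℝ × ℝ) (p : MarkedLine) :
    crossing S a b p + crossing S b e p = crossing S a e p := by
  unfold crossing
  ring

lemma measurable_crossing (hS : MeasurableSet S) (a b : ℝ × ℝ) : Measurable (crossing S a b) :=
  measurable_snd.snd.mul (((measurable_one.indicator hS).comp (measurable_offset b)).sub
    ((measurable_one.indicator hS).comp (measurable_offset a)))

lemma abs_crossing_le (hS : Set.Ioi 0 ⊆ S) (hS' : S ⊆ Set.Ici 0) (a b : ℝ × ℝ) (p : MarkedLine) :
    |crossing S a b p| ≤ (linesMeeting a b).indicator (fun p => |p.2.2|) p := by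
  rw [crossing, abs_mul]
  by_cases meets : p ∈ linesMeeting a b
  · rw [Set.indicator_of_mem meets]
    refine mul_le_of_le_one_right (abs_nonneg _) ?_
    by_cases ha : offset p a ∈ S <;> by_cases hb : offset p b ∈ S <;> simp [ha, hb]
  have same_side : offset p a ∈ S ↔ offset p b ∈ S := by
    rw [mem_linesMeeting_iff, Set.mem_uIcc] at meets
    refine ⟨fun ha => hS ?_, fun hb => hS ?_⟩
    · exact not_le.1 fun hb => meets (.inr ⟨hb, hS' ha⟩)
    · exact not_le.1 fun ha => meets (.inl ⟨ha, hS' hb⟩)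
  by_cases hb : offset p b ∈ S <;> simp [same_side, hb, meets]

lemma abs_crossing_eq (hS : Set.Ioi 0 ⊆ S) (hS' : S ⊆ Set.Ici 0) (ha : offset p a ≠ 0)
    (hb : offset p b ≠ 0) (hp : p ∈ linesMeeting a b) : |crossing S a b p| = |p.2.2| := by
  have not_mem {x : ℝ} (hx : x < 0) : x ∉ S := fun h => hx.not_ge (hS' h)
  rw [mem_linesMeeting_iff, Set.mem_uIcc] at hp
  rcases hp with ⟨ha_le, hb_ge⟩ | ⟨hb_le, ha_ge⟩
  · simp [crossing, not_mem (ha_le.lt_of_ne ha), hS (hb_ge.lt_of_ne' hb)]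
  · simp [crossing, not_mem (hb_le.lt_of_ne hb), hS (ha_ge.lt_of_ne' ha)]

lemma IsAdmissible.isTestFunction_crossing {μ : Measure MarkedLine} (hμ : IsAdmissible μ)
    (hm : MeasurableSet S) (hS : Set.Ioi 0 ⊆ S) (hS' : S ⊆ Set.Ici 0) (a b : ℝ × ℝ) :
    IsTestFunction μ (crossing S a b) :=
  hμ.isTestFunction (measurable_crossing hm a b) (abs_crossing_le hS hS' a b)

end Crossing

section QuasiParticle

variable {μ ν κ : Measure MarkedLine} {a b : ℝ × ℝ} {p : MarkedLine} {x v t : ℝ}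

lemma mem_linesPos_iff : p ∈ linesPos a b ↔ offset p a < 0 ∧ 0 ≤ offset p b := by
  simp only [linesPos, Set.mem_ofPred_eq, mem_leftHalf_iff, mem_rightHalf_iff,
    and_iff_right_iff_imp]
  exact fun ⟨ha, hb⟩ => mem_linesMeeting_iff.2 (Set.mem_uIcc_of_le ha.le hb)

lemma mem_linesNeg_iff : p ∈ linesNeg a b ↔ 0 ≤ offset p a ∧ offset p b < 0 := by
  simp only [linesNeg, Set.mem_ofPred_eq, mem_leftHalf_iff, mem_rightHalf_iff,
    and_iff_right_iff_imp]
  exact fun ⟨ha, hb⟩ => mem_linesMeeting_iff.2 (Set.mem_uIcc_of_ge hb.le ha)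

lemma measurableSet_linesPos (a b : ℝ × ℝ) : MeasurableSet (linesPos a b) := by
  simp only [Set.ext fun _ => mem_linesPos_iff]
  exact (measurableSet_lt (measurable_offset a) measurable_const).inter
    (measurableSet_le measurable_const (measurable_offset b))

lemma measurableSet_linesNeg (a b : ℝ × ℝ) : MeasurableSet (linesNeg a b) := by
  simp only [Set.ext fun _ => mem_linesNeg_iff]
  exact (measurableSet_le measurable_const (measurable_offset a)).inter
    (measurableSet_lt (measurable_offset b) measurable_const)

lemma crossing_eq_of_mem_linesPos (hp : p ∈ linesPos a b) :
    crossing (Set.Ici 0) a b p = p.2.2 := by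
  rw [mem_linesPos_iff] at hp
  simp [crossing, hp.1, hp.2]

lemma crossing_eq_of_mem_linesNeg (hp : p ∈ linesNeg a b) :
    crossing (Set.Ici 0) a b p = -p.2.2 := by
  rw [mem_linesNeg_iff] at hp
  simp [crossing, hp.1, hp.2]

lemma crossing_eq_zero_of_notMem (hpos : p ∉ linesPos a b) (hneg : p ∉ linesNeg a b) :
    crossing (Set.Ici 0) a b p = 0 := by
  have same_side : 0 ≤ offset p a ↔ 0 ≤ offset p b := by
    rw [mem_linesPos_iff] at hpos
    rw [mem_linesNeg_iff] at hneg
    grind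
  simp [crossing, Set.indicator, same_side]

lemma disjoint_linesPos_linesNeg (a b : ℝ × ℝ) : Disjoint (linesPos a b) (linesNeg a b) :=
  Set.disjoint_left.2 fun _ hpos hneg =>
    (mem_linesPos_iff.1 hpos).1.not_ge (mem_linesNeg_iff.1 hneg).1

lemma surface_eq_integral (h : Integrable (crossing (Set.Ici 0) (0, 0) b) ν) :
    surface ν b = ∫ p, crossing (Set.Ici 0) (0, 0) b p ∂ν := by
  have integral_pos : ∫ p in linesPos (0, 0) b, p.2.2 ∂ν
      = ∫ p in linesPos (0, 0) b, crossing (Set.Ici 0) (0, 0) b p ∂ν :=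
    setIntegral_congr_fun (measurableSet_linesPos _ _) fun p hp =>
      (crossing_eq_of_mem_linesPos hp).symm
  have integral_neg : -∫ p in linesNeg (0, 0) b, p.2.2 ∂ν
      = ∫ p in linesNeg (0, 0) b, crossing (Set.Ici 0) (0, 0) b p ∂ν := by
    rw [← integral_neg]
    exact setIntegral_congr_fun (measurableSet_linesNeg _ _) fun p hp =>
      (crossing_eq_of_mem_linesNeg hp).symm
  rw [surface, sub_eq_add_neg, integral_pos, integral_neg,
    ← setIntegral_union (disjoint_linesPos_linesNeg _ _) (measurableSet_linesNeg _ _)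
      h.integrableOn h.integrableOn]
  refine setIntegral_eq_integral_of_forall_compl_eq_zero fun p hp => ?_
  exact crossing_eq_zero_of_notMem (fun h => hp (.inl h)) fun h => hp (.inr h)

lemma quasiParticle_sub (hx : Integrable (crossing (Set.Ici 0) (0, 0) (x, 0)) ν)
    (ht : Integrable (crossing (Set.Ici 0) (x, 0) (x + v * t, t)) ν) :
    quasiParticle ν x v t - quasiParticle ν x v 0
      = v * t + ∫ p, crossing (Set.Ici 0) (x, 0) (x + v * t, t) p ∂ν := by
  have add_eq := funext (crossing_add_crossing (Set.Ici 0) (0, 0) (x, 0) (x + v * t, t))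
  have integrable_add : Integrable (crossing (Set.Ici 0) (0, 0) (x + v * t, t)) ν :=
    add_eq ▸ hx.add ht
  rw [quasiParticle, quasiParticle, mul_zero, add_zero, surface_eq_integral integrable_add,
    surface_eq_integral hx, ← add_eq, integral_add hx ht]
  ring

lemma quasiFluctuation_eq {ε : ℝ} (hε : 0 < ε)
    (hμx : Integrable (crossing (Set.Ici 0) (0, 0) (x, 0)) μ)
    (hμt : Integrable (crossing (Set.Ici 0) (x, 0) (x + v * t, t)) μ)
    (hκx : Integrable (crossing (Set.Ici 0) (0, 0) (x, 0)) κ)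
    (hκt : Integrable (crossing (Set.Ici 0) (x, 0) (x + v * t, t)) κ) :
    quasiFluctuation μ ε κ x v t
      = fluctuation μ ε κ (crossing (Set.Ici 0) (x, 0) (x + v * t, t)) := by
  rw [quasiFluctuation, quasiParticle_sub hμx hμt,
    quasiParticle_sub (hκx.smul_measure ENNReal.ofReal_ne_top)
      (hκt.smul_measure ENNReal.ofReal_ne_top),
    integral_smul_measure, ENNReal.toReal_ofReal hε.le, fluctuation, smul_eq_mul,
    add_sub_add_left_eq_sub]

/-- The mark of a line slower than `v`, which the path `t ↦ (x + v t, t)` crosses from left to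
right, and `0` for the other lines. -/
def slowMark (v : ℝ) : MarkedLine → ℝ := {p | p.2.1 < v}.indicator fun p => p.2.2

/-- The opposite of the mark of a line faster than `v`, which the path `t ↦ (x + v t, t)` crosses
from right to left, and `0` for the other lines. -/
def fastMark (v : ℝ) : MarkedLine → ℝ := {p | v < p.2.1}.indicator fun p => -p.2.2

/-- The time at which the path `t ↦ (x + v t, t)` crosses the line `p`; it takes the value `0` for
lines of velocity `v`. -/
def crossingTime (x v : ℝ) (p : MarkedLine) : ℝ := (p.1 - x) / (v - p.2.1)

lemma offset_nonneg_iff_of_lt (h : p.2.1 < v) :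
    0 ≤ offset p (x + v * t, t) ↔ crossingTime x v p ≤ t := by
  rw [offset_apply, crossingTime, div_le_iff₀ (sub_pos.2 h)]
  constructor <;> intro <;> linarith

lemma offset_nonneg_iff_of_gt (h : v < p.2.1) :
    0 ≤ offset p (x + v * t, t) ↔ ¬crossingTime x v p < t := by
  rw [offset_apply, crossingTime, not_lt, le_div_iff_of_neg (sub_neg.2 h)]
  constructor <;> intro <;> linarith

lemma pairIncrement_eq_crossing (x v s t : ℝ) :
    pairIncrement (slowMark v) (fun t => {p | crossingTime x v p ≤ t}) (fastMark v)
      (fun t => {p | crossingTime x v p < t}) s t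
      = crossing (Set.Ici 0) (x + v * s, s) (x + v * t, t) := by
  ext p
  rcases lt_trichotomy p.2.1 v with slower | same | faster
  · simp [pairIncrement, increment, slowMark, fastMark, crossing, Set.indicator, slower,
      slower.not_gt, offset_nonneg_iff_of_lt slower]
  · have offset_eq (u : ℝ) : offset p (x + v * u, u) = x - p.1 := by
      rw [offset_apply, same]
      ring
    simp [pairIncrement, increment, slowMark, fastMark, crossing, same, offset_eq]
  · simp only [pairIncrement, increment, slowMark, fastMark, crossing, Set.indicator, faster,
      faster.not_gt, offset_nonneg_iff_of_gt faster, Set.mem_Ici, Set.mem_ofPred_eq, if_true,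
      if_false, ite_not, Pi.one_apply]
    split_ifs <;> simp

lemma isCrossingPair_quasiParticle (x v : ℝ) :
    IsCrossingPair (fun t => (x + v * t, t)) (slowMark v) (fun t => {p | crossingTime x v p ≤ t})
      (fastMark v) (fun t => {p | crossingTime x v p < t}) where
  measurable_fst := measurable_snd.snd.indicator
    (measurableSet_lt (measurable_fst.comp measurable_snd) measurable_const)
  measurable_snd := measurable_snd.snd.neg.indicator
    (measurableSet_lt measurable_const (measurable_fst.comp measurable_snd))
  fst := isSweep_setOf_le (by unfold crossingTime; fun_prop)
  snd := isSweep_setOf_lt (by unfold crossingTime; fun_prop)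
  eq_zero_or p := by
    rcases le_total p.2.1 v with h | h
    · exact .inr (by simp [fastMark, h.not_gt])
    · exact .inl (by simp [slowMark, h.not_gt])
  abs_le s t p := by
    rw [pairIncrement_eq_crossing]
    exact abs_crossing_le Set.Ioi_subset_Ici_self le_rfl _ _ p
  abs_eq s t p hs ht hp := by
    rw [pairIncrement_eq_crossing]
    exact abs_crossing_eq Set.Ioi_subset_Ici_self le_rfl hs ht hp

end QuasiParticle

section Mass

variable {t : ℝ}

lemma indicator_Ico_sub_indicator_Ico (x z : ℝ) :
    (Set.Ico 0 x).indicator (1 : ℝ → ℝ) z - (Set.Ico x 0).indicator 1 z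
      = (Set.Ioi 0).indicator 1 (x - z) - (Set.Ioi 0).indicator 1 (0 - z) := by
  simp only [Set.indicator, Set.mem_Ico, Set.mem_Ioi, sub_pos, Pi.one_apply]
  grind

lemma mass_evolve (t x : ℝ) (ν : Measure MarkedLine) :
    mass x (evolve t ν) = ∫ p, crossing (Set.Ioi 0) (0, t) (x, t) p ∂ν := by
  have measurable_integrand : Measurable fun p : MarkedLine =>
      p.2.2 * ((Set.Ico 0 x).indicator (1 : ℝ → ℝ) p.1 - (Set.Ico x 0).indicator 1 p.1) :=
    measurable_snd.snd.mul (((measurable_one.indicator measurableSet_Ico).comp measurable_fst).sub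
      ((measurable_one.indicator measurableSet_Ico).comp measurable_fst))
  rw [mass, evolve, integral_map (by fun_prop) measurable_integrand.aestronglyMeasurable]
  simp only [indicator_Ico_sub_indicator_Ico, crossing, offset_apply, mul_comm t]

lemma pairIncrement_zero_eq_crossing (t a b : ℝ) :
    pairIncrement 0 (fun x => {p : MarkedLine | p.1 + p.2.1 * t < x}) (fun p => p.2.2)
      (fun x => {p | p.1 + p.2.1 * t < x}) a b = crossing (Set.Ioi 0) (a, t) (b, t) := by
  ext p
  simp [pairIncrement, increment, crossing, Set.indicator, offset_apply, mul_comm t]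

lemma isCrossingPair_mass (t : ℝ) :
    IsCrossingPair (fun x => (x, t)) 0 (fun x => {p | p.1 + p.2.1 * t < x}) (fun p => p.2.2)
      (fun x => {p | p.1 + p.2.1 * t < x}) where
  measurable_fst := measurable_zero
  measurable_snd := measurable_snd.snd
  fst := isSweep_setOf_lt (by fun_prop)
  snd := isSweep_setOf_lt (by fun_prop)
  eq_zero_or _ := .inl rfl
  abs_le a b p := by
    rw [pairIncrement_zero_eq_crossing]
    exact abs_crossing_le le_rfl Set.Ioi_subset_Ici_self _ _ p
  abs_eq a b p ha hb hp := by
    rw [pairIncrement_zero_eq_crossing]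
    exact abs_crossing_eq le_rfl Set.Ioi_subset_Ici_self ha hb hp

end Mass

section Limits

variable {μ : Measure MarkedLine} {Ω : ℝ → Type*} [∀ ε, MeasurableSpace (Ω ε)]
  {P : ∀ ε, Measure (Ω ε)} [∀ ε, IsProbabilityMeasure (P ε)] {N : ∀ ε, Ω ε → Measure MarkedLine}
  {Ω' : Type*} [MeasurableSpace Ω'] {P' : Measure Ω'} [IsProbabilityMeasure P'] {W : ℝ → Ω' → ℝ}

theorem tendstoInLaw_quasiFluctuation (hμ : IsAdmissible μ) (hW : IsTwoSidedBrownian P' W)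
    (hN : ∀ ε : ℝ, 0 < ε → IsPoissonProcess (P ε) (N ε) (ENNReal.ofReal ε⁻¹ • μ)) (x v : ℝ)
    (hnull : ∀ t : ℝ, markSq μ (linesMeeting (x + v * t, t) (x + v * t, t)) = 0) :
    TendstoInLaw P (fun ε ω t => quasiFluctuation μ ε (N ε ω) x v t) P'
      fun ω t => W (Real.sign t * (markSq μ (linesMeeting (x, 0) (x + v * t, t))).toReal) ω := by
  have isTestFunction_crossing :=
    hμ.isTestFunction_crossing measurableSet_Ici Set.Ioi_subset_Ici_self le_rfl
  have pair := isCrossingPair_quasiParticle x v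
  have limit := pair.tendstoInLaw hμ hW hN (by fun_prop) hnull
    (X := fun ε ω t => quasiFluctuation μ ε (N ε ω) x v t) fun ε hε => by
      filter_upwards [(isTestFunction_crossing (0, 0) (x, 0)).ae_integrable (hN ε hε),
        (pair.isSweepPair hμ).ae_forall_integrable_increment (hN ε hε)] with ω hx hpair t
      have integrable_pair := (pair.isSweepPair hμ).integrable_pairIncrement hpair.1 hpair.2 0 t
      rw [pairIncrement_eq_crossing, mul_zero, add_zero] at integrable_pair ⊢
      exact quasiFluctuation_eq hε (isTestFunction_crossing _ _).integrable
        (isTestFunction_crossing _ _).integrable hx integrable_pair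
  simpa only [mul_zero, add_zero] using limit

theorem tendstoInLaw_massFluctuation (hμ : IsAdmissible μ) (hW : IsTwoSidedBrownian P' W)
    (hN : ∀ ε : ℝ, 0 < ε → IsPoissonProcess (P ε) (N ε) (ENNReal.ofReal ε⁻¹ • μ)) (t : ℝ)
    (hnull : ∀ x : ℝ, markSq μ (linesMeeting (x, t) (x, t)) = 0) :
    TendstoInLaw P (fun ε ω x => massFluctuation μ ε (N ε ω) t x) P'
      fun ω x => W (Real.sign x * (markSq μ (linesMeeting (0, t) (x, t))).toReal) ω :=
  (isCrossingPair_mass t).tendstoInLaw hμ hW hN (by fun_prop) hnull fun ε _ => .of_forall fun ω x =>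
    by rw [massFluctuation, mass_evolve, mass_evolve, fluctuation, pairIncrement_zero_eq_crossing]

end Limits

end HardRods

end

theorem mainTheorem10
    (μ : Measure HardRods.MarkedLine) (hμ : HardRods.IsAdmissible μ)
    {Ω : ℝ → Type*} [∀ ε, MeasurableSpace (Ω ε)] (P : ∀ ε, Measure (Ω ε))
    [∀ ε, IsProbabilityMeasure (P ε)] (N : ∀ ε, Ω ε → Measure HardRods.MarkedLine)
    (hN : ∀ ε : ℝ, 0 < ε →
      HardRods.IsPoissonProcess (P ε) (N ε) (ENNReal.ofReal ε⁻¹ • μ))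
    {Ω' : Type*} [MeasurableSpace Ω'] (P' : Measure Ω') [IsProbabilityMeasure P']
    (W : ℝ → Ω' → ℝ) (hW : HardRods.IsTwoSidedBrownian P' W) :
    (∀ x v : ℝ,
      (∀ t : ℝ, HardRods.markSq μ
        (HardRods.linesMeeting (x + v * t, t) (x + v * t, t)) = 0) →
      HardRods.TendstoInLaw P
        (fun ε ω t => HardRods.quasiFluctuation μ ε (N ε ω) x v t) P'
        (fun ω' t => W (Real.sign t *
          (HardRods.markSq μ (HardRods.linesMeeting (x, 0) (x + v * t, t))).toReal) ω')) ∧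
    (∀ t : ℝ,
      (∀ x : ℝ, HardRods.markSq μ (HardRods.linesMeeting (x, t) (x, t)) = 0) →
      HardRods.TendstoInLaw P
        (fun ε ω x => HardRods.massFluctuation μ ε (N ε ω) t x) P'
        (fun ω' x => W (Real.sign x *
          (HardRods.markSq μ (HardRods.linesMeeting (0, t) (x, t))).toReal) ω')) :=
  ⟨fun x v hnull => HardRods.tendstoInLaw_quasiFluctuation hμ hW hN x v hnull,
    fun t hnull => HardRods.tendstoInLaw_massFluctuation hμ hW hN t hnull⟩
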